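/- A finite non-trivial group $G$ is called \emph{hyperelliptic in dimension $n$} if there are a complex torus $T=\mathbb{C}^n/\Lambda$ ($\Lambda\subset\mathbb{C}^n$ a lattice of rank $2n$) and a subgroup $H\cong G$ of the group of biholomorphic self-maps of $T$ such that $H$ acts freely on $T$ (no non-identity element of $H$ has a fixed point) and $H$ contains no translation of $T$ other than the identity; $T/H$ is then a hyperelliptic manifold with holonomy group $G$. Let $C_m$ denote the cyclic group of order $m$. \textbf{Theorem.} An Abelian group is hyperelliptic in dimension $4$ if and only if it is isomorphic to one of the following $44$ pairwise non-isomorphic groups: $C_2$, $C_3$, $C_4$, $C_2\times C_2$, $C_5$, $C_6$, $C_7$, $C_8$, $C_2\times C_4$, $C_2\times C_2\times C_2$, $C_9$, $C_3\times C_3$, $C_{10}$, $C_{12}$, $C_2\times C_6$, $C_{14}$, $C_{15}$, $C_4\times C_4$, $C_2\times C_8$, $C_2\times C_2\times C_4$, $C_{18}$, $C_3\times C_6$, $C_{20}$, $C_2\times C_{10}$, $C_{24}$, $C_2\times C_{12}$, $C_2\times C_2\times C_6$, $C_3\times C_3\times C_3$, $C_{30}$, $C_4\times C_8$, $C_2\times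 C_4\times C_4$, $C_3\times C_{12}$, $C_6\times C_6$, $C_2\times C_{20}$, $C_4\times C_{12}$, $C_2\times C_{24}$, $C_2\times C_2\times C_{12}$, $C_3\times C_3\times C_6$, $C_2\times C_{30}$, $C_6\times C_{12}$, $C_2\times C_6\times C_6$, $C_2\times C_4\times C_{12}$, $C_3\times C_6\times C_6$, $C_2\times C_6\times C_{12}$. Moreover, each of these groups is isomorphic to a subgroup of one of the nine groups $C_{14}$, $C_{18}$, $C_4\times C_8$, $C_2\times C_{20}$, $C_2\times C_{24}$, $C_2\times C_{30}$, $C_2\times C_4\times C_{12}$, $C_3\times C_6\times C_6$, $C_2\times C_6\times C_{12}$, which all belong to the list and are maximal in it: none of the nine is isomorphic to a subgroup of a different group of the list. -/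

import Mathlib

namespace Hyperelliptic

/-- The complex torus `T = ℂⁿ / Λ`. The subgroup `Λ` is required to be a lattice (discrete and
spanning `ℂⁿ` over `ℝ`) wherever tori are quantified over. -/
abbrev Torus {n : ℕ} (Λ : Submodule ℤ (Fin n → ℂ)) : Type :=
  (Fin n → ℂ) ⧸ Λ

/-- Holomorphy of a self-map of `T = ℂⁿ / Λ` for the complex structure in which the projection
`ℂⁿ → T` is a local biholomorphism: around every point the map is induced by a holomorphic map
from an open subset of `ℂⁿ` to `ℂⁿ`. (The local lift `F` is continuous, so `f` is continuous for
the quotient topology.) -/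
def IsHolomorphic {n : ℕ} (Λ : Submodule ℤ (Fin n → ℂ)) (f : Torus Λ → Torus Λ) : Prop :=
  ∀ z : Fin n → ℂ, ∃ U : Set (Fin n → ℂ), IsOpen U ∧ z ∈ U ∧
    ∃ F : (Fin n → ℂ) → (Fin n → ℂ), DifferentiableOn ℂ F U ∧
      ∀ w ∈ U, f (Submodule.Quotient.mk w) = Submodule.Quotient.mk (F w)

theorem isHolomorphic_id {n : ℕ} (Λ : Submodule ℤ (Fin n → ℂ)) :
    IsHolomorphic Λ (fun x => x) := fun z =>
  ⟨Set.univ, isOpen_univ, Set.mem_univ z, fun w => w, differentiableOn_id, fun _ _ => rfl⟩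

theorem IsHolomorphic.comp {n : ℕ} {Λ : Submodule ℤ (Fin n → ℂ)} {f g : Torus Λ → Torus Λ}
    (hf : IsHolomorphic Λ f) (hg : IsHolomorphic Λ g) :
    IsHolomorphic Λ (fun x => f (g x)) := by
  intro z
  obtain ⟨U, hU, hzU, G, hG, hGg⟩ := hg z
  obtain ⟨W, hW, hzW, F, hF, hFf⟩ := hf (G z)
  refine ⟨U ∩ G ⁻¹' W, hG.continuousOn.isOpen_inter_preimage hU hW, ⟨hzU, hzW⟩,
    fun w => F (G w), ?_, ?_⟩
  · exact hF.comp (hG.mono Set.inter_subset_left) (fun w hw => hw.2)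
  · intro w hw
    show f (g _) = _
    rw [hGg w hw.1, hFf (G w) hw.2]

/-- The group `Bihol(T)` of biholomorphic self-maps of `T = ℂⁿ / Λ`. -/
def Bihol {n : ℕ} (Λ : Submodule ℤ (Fin n → ℂ)) : Subgroup (Equiv.Perm (Torus Λ)) where
  carrier := {f | IsHolomorphic Λ f ∧ IsHolomorphic Λ f.symm}
  mul_mem' hf hg := ⟨hf.1.comp hg.1, hg.2.comp hf.2⟩
  one_mem' := ⟨isHolomorphic_id Λ, isHolomorphic_id Λ⟩
  inv_mem' hf := ⟨hf.2, hf.1⟩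

/-- The quotient `T / H` of `T = ℂⁿ / Λ` is a hyperelliptic manifold with holonomy group `H`:
`H` is a finite, non-trivial group of biholomorphic self-maps of `T` that acts freely on `T` and
contains no translation other than the identity. -/
structure IsHolonomyGroup {n : ℕ} (Λ : Submodule ℤ (Fin n → ℂ))
    (H : Subgroup (Equiv.Perm (Torus Λ))) : Prop where
  le_bihol : H ≤ Bihol Λ
  finite : Finite H
  nontrivial : Nontrivial H
  free : ∀ h ∈ H, h ≠ 1 → ∀ x : Torus Λ, h x ≠ x
  no_translation : ∀ h ∈ H, h ≠ 1 → ∀ t : Torus Λ, ¬ ∀ x : Torus Λ, h x = x + t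

/-- An abstract group `G` is hyperelliptic in dimension `n` if it is isomorphic to the holonomy
group of a hyperelliptic manifold of dimension `n`, i.e. of some `T / H` with `T = ℂⁿ / Λ` a
complex torus. (Such a `G` is automatically finite and non-trivial.) -/
def IsHyperelliptic (n : ℕ) (G : Type*) [Group G] : Prop :=
  ∃ (Λ : Submodule ℤ (Fin n → ℂ)) (_ : DiscreteTopology Λ) (_ : IsZLattice ℝ Λ)
    (H : Subgroup (Equiv.Perm (Torus Λ))), IsHolonomyGroup Λ H ∧ Nonempty (G ≃* H)

/-- The direct product `C_{d₁} × ⋯ × C_{dₖ}` of cyclic groups, for the list `[d₁, …, dₖ]`. -/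
abbrev CyclicProduct (d : List ℕ) : Type :=
  (i : Fin d.length) → Multiplicative (ZMod (d.get i))

/-- The table of abelian groups; the entry `[d₁, …, dₖ]` stands for `C_{d₁} × ⋯ × C_{dₖ}`. -/
def abelianTable : List (List ℕ) :=
  [[2], [3], [4], [2, 2], [5], [6], [7], [8], [2, 4], [2, 2, 2], [9], [3, 3], [10], [12], [2, 6],
   [14], [15], [4, 4], [2, 8], [2, 2, 4], [18], [3, 6],
   [20], [2, 10], [24], [2, 12], [2, 2, 6], [3, 3, 3], [30], [4, 8], [2, 4, 4], [3, 12], [6, 6],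
   [2, 20], [4, 12], [2, 24], [2, 2, 12], [3, 3, 6], [2, 30], [6, 12], [2, 6, 6], [2, 4, 12],
   [3, 6, 6], [2, 6, 12]]

/-- The nine maximal groups of the table. -/
def maximalTable : List (List ℕ) :=
  [[14], [18], [4, 8], [2, 20], [2, 24], [2, 30], [2, 4, 12], [3, 6, 6], [2, 6, 12]]

end Hyperelliptic

/-! A holomorphic self-map of a torus is affine: the derivative of its local lifts is
lattice-periodic, hence bounded, and Liouville's theorem applies (`IsHolomorphic.exists_affine`).
The linear parts of a finite abelian `G` are simultaneously diagonalisable, so a hyperelliptic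
action amounts to characters `χ i`, a translation cocycle and a lattice (`IsDiagonalAction`). Three
facts bound `G`. Absence of translations makes the `χ i` jointly faithful. Freeness gives every `g`
some `i` with `χ i g = 1`; otherwise `χ(g) - 1` is invertible and `g` has a fixed point. Integrality
of traces on the lattice makes the family of the `χ i` and their inverses Galois stable, so the
conjugates of a character of order `d` occupy at least `φ(d) / 2` coordinates
(`IsDiagonalAction.totient_orderOf_le`).

If some `φ(d) ≥ 3`, the characters generating the same cyclic group fill two or three coordinates,
and covering `G` by kernels makes another character trivial (`eq_one_or_eq_one_of_union`). At most
two independent characters remain, so `G` has the exponent and torsion bounds of one of finitely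
many `C_d × C_e`. Otherwise all orders divide 4 or 6 and `G` is `C₂^a × C₄^b × C₃^e`; fixed vectors
give `a + b ≤ 3` and `b + e ≤ 3`. The only non-trivial groups left outside the table, `C₄³` and
`C₆³`, are excluded by their translation parts: one character is trivial, three generators translate
that coordinate, and a relation between these translations yields an element that has a fixed point
itself or whose square has one.

Conversely, hyperellipticity passes to non-trivial subgroups, so it suffices to realise the nine
maximal groups. They act on cyclotomic tori times `ℂ / ℤ[i]`, where translations of the last curve
make the action free; a third cyclic factor also translates the first curve by a point fixed by the
root of unity acting there. Isomorphism and embedding questions reduce to the number of elements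
killed by 2, 4, 8, 3, 9, 5, 7 and to exponents, which are checked by finite computation. -/

namespace Hyperelliptic
open Filter Topology

/-! ### Holomorphic self-maps of complex tori are affine. -/

section Liouville

variable {n : ℕ} {Λ : Submodule ℤ (Fin n → ℂ)}

theorem exists_isOpen_inter_lattice [DiscreteTopology Λ] :
    ∃ U : Set (Fin n → ℂ), IsOpen U ∧ 0 ∈ U ∧ ∀ x ∈ U, x ∈ Λ → x = 0 := by
  obtain ⟨U, hU, hU'⟩ := isOpen_induced_iff.1 (isOpen_discrete ({0} : Set Λ))
  refine ⟨U, hU, ?_, fun x hx hxΛ => ?_⟩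
  · have : (0 : Λ) ∈ Subtype.val ⁻¹' U := hU' ▸ rfl
    exact this
  · have : (⟨x, hxΛ⟩ : Λ) ∈ Subtype.val ⁻¹' U := hx
    rw [hU'] at this
    exact congrArg Subtype.val this

/-- A continuous function with values in a discrete group is locally constant. -/
theorem eventually_eq_of_sub_mem_lattice [DiscreteTopology Λ] {X : Type*} [TopologicalSpace X]
    {g : X → Fin n → ℂ} {x : X} (hg : ContinuousAt g x) (hmem : ∀ᶠ y in 𝓝 x, g y ∈ Λ) :
    ∀ᶠ y in 𝓝 x, g y = g x := by
  obtain ⟨U, hU, h0, h⟩ := exists_isOpen_inter_lattice (Λ := Λ)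
  have hc : ContinuousAt (fun y => g y - g x) x := hg.sub continuousAt_const
  have : ∀ᶠ y in 𝓝 x, g y - g x ∈ U :=
    hc.preimage_mem_nhds (hU.mem_nhds (by simpa using h0))
  filter_upwards [this, hmem] with y hy hy'
  exact sub_eq_zero.1 (h _ hy (Λ.sub_mem hy' hmem.self_of_nhds))

/-- `F` is a holomorphic lift of the self-map `f` of the torus over the open set `U`. -/
structure IsLift (Λ : Submodule ℤ (Fin n → ℂ)) (f : Torus Λ → Torus Λ) (U : Set (Fin n → ℂ))
    (F : (Fin n → ℂ) → (Fin n → ℂ)) : Prop where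
  isOpen : IsOpen U
  diff : DifferentiableOn ℂ F U
  lift : ∀ w ∈ U, f (Submodule.Quotient.mk w) = Submodule.Quotient.mk (F w)

/-- Two lifts differ locally by a constant lattice vector, so the derivative depends only on the
point and not on the lift. -/
theorem IsLift.fderiv_eq [DiscreteTopology Λ] {f : Torus Λ → Torus Λ} {U V : Set (Fin n → ℂ)}
    {F G : (Fin n → ℂ) → (Fin n → ℂ)} (hF : IsLift Λ f U F) (hG : IsLift Λ f V G)
    {w : Fin n → ℂ} (hU : w ∈ U) (hV : w ∈ V) : fderiv ℂ F w = fderiv ℂ G w := by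
  have hUn := hF.isOpen.mem_nhds hU
  have hVn := hG.isOpen.mem_nhds hV
  have h := eventually_eq_of_sub_mem_lattice (Λ := Λ) (g := fun y => F y - G y) (x := w)
    ((hF.diff.continuousOn.continuousAt hUn).sub (hG.diff.continuousOn.continuousAt hVn))
    (by
      filter_upwards [hUn, hVn] with y hy hy'
      rw [← Submodule.Quotient.eq, ← hF.lift y hy, ← hG.lift y hy'])
  have h2 : F =ᶠ[𝓝 w] fun y => G y + (F w - G w) := by
    filter_upwards [h] with y hy
    rw [← hy]; abel
  rw [h2.fderiv_eq, fderiv_add_const]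

theorem IsLift.translate {f : Torus Λ → Torus Λ} {U : Set (Fin n → ℂ)}
    {F : (Fin n → ℂ) → (Fin n → ℂ)} (hF : IsLift Λ f U F) {l : Fin n → ℂ} (hl : l ∈ Λ) :
    IsLift Λ f ((fun w => w - l) ⁻¹' U) (fun w => F (w - l)) where
  isOpen := hF.isOpen.preimage (by fun_prop)
  diff := hF.diff.comp (by fun_prop) (fun w hw => hw)
  lift w hw := by
    rw [← hF.lift _ hw]
    congr 1
    rw [Submodule.Quotient.eq]
    simpa using hl

/-- Cauchy's estimate on discs in the direction `v`. A bound near each point is enough, since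
periodicity and compactness make it global. -/
theorem IsLift.exists_bound {f : Torus Λ → Torus Λ} {U : Set (Fin n → ℂ)}
    {F : (Fin n → ℂ) → (Fin n → ℂ)} (hF : IsLift Λ f U F) {z : Fin n → ℂ} (hz : z ∈ U)
    (v : Fin n → ℂ) : ∃ C : ℝ, ∀ᶠ w in 𝓝 z, w ∈ U ∧ ‖fderiv ℂ F w v‖ ≤ C := by
  have hUn := hF.isOpen.mem_nhds hz
  have hc := hF.diff.continuousOn.continuousAt hUn
  have h1 : ∀ᶠ w in 𝓝 z, ‖F w - F z‖ ≤ 1 := by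
    filter_upwards [hc.preimage_mem_nhds (Metric.closedBall_mem_nhds (F z) one_pos)] with w hw
    simpa [dist_eq_norm] using hw
  obtain ⟨r, hr, hball⟩ := Metric.nhds_basis_ball.mem_iff.1 (h1.and hUn)
  -- For `w` within `r / 2` of `z`, the disc `w + t • v`, `‖t‖ ≤ R`, stays in the ball of radius
  -- `r`; the summand 1 covers `v = 0`.
  set R : ℝ := r / 2 / (‖v‖ + 1) with hR
  have hR0 : 0 < R := by positivity
  refine ⟨1 / R, ?_⟩
  filter_upwards [Metric.ball_mem_nhds z (half_pos hr)] with w hw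
  have hmem : ∀ t ∈ Metric.closedBall (0 : ℂ) R, w + t • v ∈ Metric.ball z r := by
    intro t ht
    rw [mem_closedBall_zero_iff] at ht
    rw [mem_ball_iff_norm] at hw ⊢
    have : ‖t • v‖ ≤ r / 2 := by
      rw [norm_smul]
      calc ‖t‖ * ‖v‖ ≤ R * (‖v‖ + 1) := by gcongr; linarith
        _ = r / 2 := by rw [hR]; field_simp
    calc ‖w + t • v - z‖ = ‖(w - z) + t • v‖ := by congr 1; abel
      _ ≤ ‖w - z‖ + ‖t • v‖ := norm_add_le _ _
      _ < r := by linarith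
  have hw0 : w ∈ U := by
    have := (hball (hmem 0 (by simp [hR0.le]))).2
    rw [zero_smul, add_zero] at this
    exact this
  have hline : ∀ t : ℂ, HasDerivAt (fun t : ℂ => w + t • v) v t := by
    intro t
    simpa using ((hasDerivAt_id t).smul_const v).const_add w
  refine ⟨hw0, ?_⟩
  have hd : HasDerivAt (fun t : ℂ => F (w + t • v) - F z) (fderiv ℂ F w v) 0 := by
    have h2 : HasFDerivAt F (fderiv ℂ F w) (w + (0 : ℂ) • v) := by
      rw [zero_smul, add_zero]
      exact (hF.diff.differentiableAt (hF.isOpen.mem_nhds hw0)).hasFDerivAt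
    exact (h2.comp_hasDerivAt (0 : ℂ) (hline 0)).sub_const _
  have hdo : DifferentiableOn ℂ (fun t : ℂ => F (w + t • v) - F z) (Metric.closedBall 0 R) := by
    intro t ht
    have h2 := hF.diff.differentiableAt (hF.isOpen.mem_nhds (hball (hmem t ht)).2)
    exact ((h2.comp t (hline t).differentiableAt).sub_const _).differentiableWithinAt
  rw [← hd.deriv]
  refine Complex.norm_deriv_le_of_forall_mem_sphere_norm_le hR0
    (hdo.diffContOnCl_ball subset_rfl) ?_
  intro t ht
  exact (hball (hmem t (Metric.sphere_subset_closedBall ht))).1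

/-- Every point is moved by the lattice into a fundamental parallelepiped, which is compact. -/
theorem bounded_of_locally_bounded_of_periodic [DiscreteTopology Λ] [IsZLattice ℝ Λ]
    (g : (Fin n → ℂ) → ℝ) (hloc : ∀ z, ∃ C : ℝ, ∀ᶠ w in 𝓝 z, g w ≤ C)
    (hper : ∀ z, ∀ l ∈ Λ, g (z + l) = g z) : ∃ C : ℝ, ∀ z, g z ≤ C := by
  have := ZLattice.module_free ℝ Λ
  have := ZLattice.module_finite ℝ Λ
  let b := Module.Free.chooseBasis ℤ Λ
  let B := b.ofZLatticeBasis ℝ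
  have hcompact : IsCompact (parallelepiped B) := B.parallelepiped.isCompact
  obtain ⟨C, hC⟩ : ∃ C : ℝ, ∀ z ∈ parallelepiped B, g z ≤ C := by
    refine hcompact.induction_on (p := fun s => ∃ C : ℝ, ∀ z ∈ s, g z ≤ C) ⟨0, by simp⟩ ?_ ?_ ?_
    · rintro s t hst ⟨C, hC⟩
      exact ⟨C, fun z hz => hC z (hst hz)⟩
    · rintro s t ⟨C, hC⟩ ⟨C', hC'⟩
      refine ⟨max C C', ?_⟩
      rintro z (hz | hz)
      · exact (hC z hz).trans (le_max_left _ _)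
      · exact (hC' z hz).trans (le_max_right _ _)
    · intro z _
      obtain ⟨C, hC⟩ := hloc z
      exact ⟨_, mem_nhdsWithin_of_mem_nhds hC, C, fun w hw => hw⟩
  refine ⟨C, fun x => ?_⟩
  let x' : Λ := b.repr.symm (Finsupp.equivFunOnFinite.symm fun i ↦ ⌊B.repr x i⌋)
  rw [← hper x _ (- x').2]
  refine hC _ ?_
  simp [parallelepiped_basis_eq, x', B, Int.floor_le, Int.lt_floor_add_one, le_of_lt,
    add_comm (1 : ℝ)]

/-- A holomorphic self-map of a complex torus is induced by an affine map. -/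
theorem IsHolomorphic.exists_affine [DiscreteTopology Λ] [IsZLattice ℝ Λ]
    {f : Torus Λ → Torus Λ} (hf : IsHolomorphic Λ f) :
    ∃ A : (Fin n → ℂ) →ₗ[ℂ] (Fin n → ℂ), ∀ v : Fin n → ℂ,
      f (Submodule.Quotient.mk v) = f 0 + Submodule.Quotient.mk (A v) := by
  choose U hU hz F hF hFf using hf
  have hL : ∀ z, IsLift Λ f (U z) (F z) := fun z => ⟨hU z, hF z, hFf z⟩
  let D : (Fin n → ℂ) → (Fin n → ℂ) →L[ℂ] (Fin n → ℂ) := fun z => fderiv ℂ (F z) z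
  have hD : ∀ z, ∀ w ∈ U z, D w = fderiv ℂ (F z) w := fun z w hw =>
    (hL w).fderiv_eq (hL z) (hz w) hw
  have hper : ∀ z, ∀ l ∈ Λ, D (z + l) = D z := by
    intro z l hl
    have h1 := (hL (z + l)).fderiv_eq ((hL z).translate hl) (hz _)
      (by simpa using hz z)
    change fderiv ℂ (F (z + l)) (z + l) = fderiv ℂ (F z) z
    rw [h1, fderiv_comp_sub]
    simp
  refine ⟨D 0, fun v => ?_⟩
  obtain ⟨C, hC⟩ : ∃ C : ℝ, ∀ z, ‖D z v‖ ≤ C := by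
    refine bounded_of_locally_bounded_of_periodic (Λ := Λ) (fun z => ‖D z v‖) (fun z => ?_)
      (fun z l hl => by rw [hper z l hl])
    obtain ⟨C, hC⟩ := (hL z).exists_bound (hz z) v
    refine ⟨C, ?_⟩
    filter_upwards [hC] with w hw
    rw [hD z w hw.1]
    exact hw.2
  have hline : ∀ t : ℂ, HasDerivAt (fun t : ℂ => t • v) v t := fun t => by
    simpa using (hasDerivAt_id t).smul_const v
  have hcont : Continuous (fun t : ℂ => t • v) := by fun_prop
  have hderiv : ∀ z : Fin n → ℂ, ∀ t : ℂ, t • v ∈ U z →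
      HasDerivAt (fun t : ℂ => F z (t • v)) (D (t • v) v) t := by
    intro z t ht
    have h2 : HasFDerivAt (F z) (D (t • v)) (t • v) := by
      rw [hD z _ ht]
      exact ((hF z).differentiableAt ((hU z).mem_nhds ht)).hasFDerivAt
    exact h2.comp_hasDerivAt t (hline t)
  have hdiff : Differentiable ℂ (fun t : ℂ => D (t • v) v) := by
    intro t
    have hopen : IsOpen ((fun t : ℂ => t • v) ⁻¹' U (t • v)) := (hU _).preimage hcont
    have h1 : DifferentiableOn ℂ (fun s : ℂ => F (t • v) (s • v))
        ((fun t : ℂ => t • v) ⁻¹' U (t • v)) := fun s hs =>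
      (hderiv _ s hs).differentiableAt.differentiableWithinAt
    have h2 := (h1.deriv hopen).differentiableAt (hopen.mem_nhds (hz (t • v)))
    refine h2.congr_of_eventuallyEq ?_
    filter_upwards [hopen.mem_nhds (hz (t • v))] with s hs
    exact (hderiv _ s hs).deriv.symm
  -- Liouville's theorem in one variable: only the derivative along the line `ℂ v` is needed.
  have hconst : ∀ t : ℂ, D (t • v) v = D 0 v := by
    intro t
    have := hdiff.apply_eq_apply_of_bounded
      (isBounded_iff_forall_norm_le.2 ⟨C, by rintro _ ⟨t, rfl⟩; exact hC _⟩) t 0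
    simpa using this
  -- The deviation of `f` from an affine map along `ℂ v` is locally constant; connectedness of `ℂ`
  -- then compares `t = 1` with `t = 0`.
  have hloc : IsLocallyConstant (fun t : ℂ =>
      f (Submodule.Quotient.mk (t • v)) - Submodule.Quotient.mk (t • D 0 v)) := by
    rw [IsLocallyConstant.iff_exists_open]
    intro t
    have hopen : IsOpen ((fun t : ℂ => t • v) ⁻¹' U (t • v)) := (hU _).preimage hcont
    obtain ⟨r, hr, hball⟩ := Metric.isOpen_iff.1 hopen t (hz (t • v))
    refine ⟨Metric.ball t r, Metric.isOpen_ball, Metric.mem_ball_self hr, fun s hs => ?_⟩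
    have key : F (t • v) (s • v) - s • D 0 v = F (t • v) (t • v) - t • D 0 v := by
      refine (convex_ball t r).is_const_of_fderivWithin_eq_zero (𝕜 := ℂ)
        (f := fun s : ℂ => F (t • v) (s • v) - s • D 0 v) ?_ ?_ hs (Metric.mem_ball_self hr)
      · intro s hs
        have := ((hderiv (t • v) s (hball hs)).sub ((hasDerivAt_id s).smul_const (D 0 v)))
        exact this.differentiableAt.differentiableWithinAt
      · intro s hs
        have := ((hderiv (t • v) s (hball hs)).sub ((hasDerivAt_id s).smul_const (D 0 v)))
        rw [hconst s, one_smul, sub_self] at this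
        rw [fderivWithin_of_isOpen Metric.isOpen_ball hs]
        have h3 := this.hasFDerivAt.fderiv
        exact h3.trans (by simp)
    have h1 := hFf (t • v) (s • v) (hball hs)
    have h2 := hFf (t • v) (t • v) (hz _)
    change f _ - _ = f _ - _
    rw [h1, h2, ← Submodule.Quotient.mk_sub, ← Submodule.Quotient.mk_sub, key]
  have := hloc.apply_eq_of_isPreconnected isPreconnected_univ (Set.mem_univ (1 : ℂ))
    (Set.mem_univ (0 : ℂ))
  simp only [one_smul, zero_smul, Submodule.Quotient.mk_zero, sub_zero] at this
  exact sub_eq_iff_eq_add.1 this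

end Liouville
end Hyperelliptic

namespace Hyperelliptic
open Filter Topology

/-! ### From free torus actions to diagonal data, and back. -/

section DiagData

/-- The vector of values at `g` of a family of characters. -/
def charVec {n : ℕ} {G : Type*} [CommGroup G] (χ : Fin n → G →* ℂˣ) (g : G) : Fin n → ℂ :=
  fun i => (χ i g : ℂ)

/-- A free action without translations of `G` on `ℂⁿ / Λ` by `z ↦ χ(g) z + b(g)`, with diagonal
linear parts `χ(g)`. -/
structure IsDiagonalAction {n : ℕ} {G : Type*} [CommGroup G] (Λ : Submodule ℤ (Fin n → ℂ))
    (χ : Fin n → G →* ℂˣ) (b : G → Fin n → ℂ) : Prop where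
  mul_mem : ∀ g, ∀ z ∈ Λ, charVec χ g * z ∈ Λ
  cocycle : ∀ g h, b (g * h) - b g - charVec χ g * b h ∈ Λ
  free : ∀ g, g ≠ 1 → ∀ x, (charVec χ g - 1) * x + b g ∉ Λ
  faithful : ∀ g, (∀ i, χ i g = 1) → g = 1

variable {n : ℕ} {G : Type*} [CommGroup G] {Λ : Submodule ℤ (Fin n → ℂ)}

@[simp] theorem charVec_one (χ : Fin n → G →* ℂˣ) : charVec χ 1 = 1 := by
  ext i; simp [charVec]

theorem charVec_mul (χ : Fin n → G →* ℂˣ) (g h : G) :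
    charVec χ (g * h) = charVec χ g * charVec χ h := by
  ext i; simp [charVec]

/-- An affine map into a discrete group is locally constant. Hence the linear part of a self-map of
the torus is unique. -/
theorem linearMap_eq_zero_of_add_mem_lattice [DiscreteTopology Λ]
    (A : (Fin n → ℂ) →ₗ[ℂ] (Fin n → ℂ)) (c : Fin n → ℂ) (h : ∀ z, A z + c ∈ Λ) : A = 0 := by
  let A' : (Fin n → ℂ) →L[ℂ] (Fin n → ℂ) := LinearMap.toContinuousLinearMap A
  have h1 := eventually_eq_of_sub_mem_lattice (Λ := Λ) (g := fun z => A' z + c) (x := 0)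
    (by fun_prop) (Eventually.of_forall h)
  have h2 : (A' : (Fin n → ℂ) → (Fin n → ℂ)) =ᶠ[𝓝 0] fun _ => 0 := by
    filter_upwards [h1] with z hz
    simpa using hz
  have h3 := h2.fderiv_eq (𝕜 := ℂ)
  rw [A'.fderiv] at h3
  ext1 i
  have h4 : A' = 0 := by simpa using h3
  ext : 1
  change A' _ = 0
  rw [h4]; rfl

/-- Each `ρ g` is a root of the separable polynomial `X ^ |G| - 1`, hence semisimple, and the
operators commute; so joint eigenvectors span. -/
theorem exists_simultaneous_eigenbasis [Finite G] (ρ : G →* Module.End ℂ (Fin n → ℂ)) :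
    ∃ (v : Module.Basis (Fin n) ℂ (Fin n → ℂ)) (χ : Fin n → G →* ℂˣ),
      ∀ g i, ρ g (v i) = (χ i g : ℂ) • v i := by
  have hss : ∀ g, (ρ g).IsFinitelySemisimple := by
    intro g
    refine Module.End.IsSemisimple.isFinitelySemisimple ?_
    have hN : 0 < Nat.card G := Nat.card_pos
    refine Module.End.isSemisimple_of_squarefree_aeval_eq_zero
      (p := Polynomial.X ^ Nat.card G - 1) ?_ ?_
    · exact (Polynomial.X_pow_sub_one_separable_iff.2 (by exact_mod_cast hN.ne')).squarefree
    · rw [map_sub, map_pow, Polynomial.aeval_X, map_one, ← map_pow, pow_card_eq_one', map_one, sub_self]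
  have htop := Module.End.iSup_iInf_maxGenEigenspace_eq_top_of_iSup_maxGenEigenspace_eq_top_of_commute
    (fun g => ρ g) (fun g h _ => by
      change ρ g * ρ h = ρ h * ρ g
      rw [← map_mul, mul_comm, map_mul])
    (fun g => Module.End.iSup_maxGenEigenspace_eq_top (ρ g))
  let S : Set (Fin n → ℂ) := {v | ∀ g, ∃ c : ℂ, ρ g v = c • v}
  have hS : ⊤ ≤ Submodule.span ℂ S := by
    rw [← htop]
    refine iSup_le fun c v hv => Submodule.subset_span fun g => ⟨c g, ?_⟩
    have := (Submodule.mem_iInf _).1 hv g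
    rw [(hss g).maxGenEigenspace_eq_eigenspace] at this
    exact Module.End.mem_eigenspace_iff.1 this
  let B := Module.Basis.ofSpan hS
  have := Module.Finite.finite_basis B
  have := Fintype.ofFinite ((linearIndepOn_empty ℂ id).extend (Set.empty_subset S))
  let v : Module.Basis (Fin n) ℂ (Fin n → ℂ) := B.reindex (Fintype.equivFinOfCardEq
    (by rw [← Module.finrank_eq_card_basis B]; simp))
  have hv : ∀ i, v i ∈ S := fun i => by
    refine Module.Basis.ofSpan_subset hS ?_
    simp only [v, Module.Basis.reindex_apply]
    exact Set.mem_range_self _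
  choose c hc using hv
  have hne : ∀ i, v i ≠ 0 := fun i => v.ne_zero i
  refine ⟨v, fun i => MonoidHom.toHomUnits
    { toFun := c i
      map_one' := ?_
      map_mul' := ?_ }, fun g i => hc i g⟩
  · have h := hc i 1
    rw [map_one] at h
    exact (smul_left_injective ℂ (hne i) (by simpa using h)).symm
  · intro g h
    have h1 := hc i (g * h)
    rw [map_mul, Module.End.mul_apply, hc i h, map_smul, hc i g, smul_smul, mul_comm] at h1
    exact (smul_left_injective ℂ (hne i) h1).symm

/-- Uniqueness of the linear part makes it multiplicative in `g`; the lattice and the translations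
are then rewritten in a joint eigenbasis. -/
theorem IsHyperelliptic.exists_isDiagonalAction (h : IsHyperelliptic n G) :
    Finite G ∧ Nontrivial G ∧ ∃ (Λ : Submodule ℤ (Fin n → ℂ)) (_ : DiscreteTopology Λ)
      (_ : IsZLattice ℝ Λ) (χ : Fin n → G →* ℂˣ) (b : G → Fin n → ℂ),
      IsDiagonalAction Λ χ b := by
  obtain ⟨Λ, _, _, H, hH, ⟨e⟩⟩ := h
  have := hH.finite
  have := hH.nontrivial
  have hfin : Finite G := Finite.of_equiv H e.symm.toEquiv
  refine ⟨hfin, e.toEquiv.nontrivial, ?_⟩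
  choose A hA using fun g : G => (hH.le_bihol (e g).2).1.exists_affine
  choose b hb using fun g : G => Submodule.Quotient.mk_surjective Λ ((e g : Equiv.Perm (Torus Λ)) 0)
  have hAb : ∀ g v, (e g : Equiv.Perm (Torus Λ)) (Submodule.Quotient.mk v) =
      Submodule.Quotient.mk (b g + A g v) := fun g v => by
    rw [hA, ← hb]; rfl
  have huniq : ∀ (B C : (Fin n → ℂ) →ₗ[ℂ] (Fin n → ℂ)) (c d : Fin n → ℂ),
      (∀ v, (Submodule.Quotient.mk (c + B v) : Torus Λ) = Submodule.Quotient.mk (d + C v)) →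
      B = C := by
    intro B C c d hBC
    refine sub_eq_zero.1 (linearMap_eq_zero_of_add_mem_lattice (Λ := Λ) (B - C) (c - d) ?_)
    intro z
    have := (Submodule.Quotient.eq _).1 (hBC z)
    convert this using 1
    simp only [LinearMap.sub_apply]
    abel
  have hcoc : ∀ g h v, (Submodule.Quotient.mk (b (g * h) + A (g * h) v) : Torus Λ) =
      Submodule.Quotient.mk ((b g + A g (b h)) + (A g * A h) v) := by
    intro g h v
    rw [← hAb, map_mul, Subgroup.coe_mul, Equiv.Perm.mul_apply, hAb, hAb, map_add, add_assoc]
    rfl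
  let ρ : G →* Module.End ℂ (Fin n → ℂ) :=
    { toFun := A
      map_one' := huniq _ _ (b 1) 0 fun v => by rw [← hAb]; simp
      map_mul' := fun g h => huniq _ _ _ _ (hcoc g h) }
  obtain ⟨v, χ, hv⟩ := exists_simultaneous_eigenbasis ρ
  have hAv : ∀ g x, v.equivFun (A g x) = charVec χ g * v.equivFun x := by
    intro g x
    have h1 : A g x = ∑ i, v.equivFun x i • (χ i g : ℂ) • v i := by
      conv_lhs => rw [← v.sum_equivFun x]
      rw [map_sum]
      exact Finset.sum_congr rfl fun i _ => by rw [map_smul]; exact congrArg _ (hv g i)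
    rw [h1]
    simp_rw [smul_smul]
    rw [← v.equivFun_symm_apply, LinearEquiv.apply_symm_apply]
    ext i
    simp [charVec, mul_comm]
  have hAsymm : ∀ g x, v.equivFun.symm (charVec χ g * x) = A g (v.equivFun.symm x) := by
    intro g x
    rw [LinearEquiv.symm_apply_eq, hAv, LinearEquiv.apply_symm_apply]
  let E : (Fin n → ℂ) ≃L[ℝ] (Fin n → ℂ) :=
    (v.equivFun.symm.restrictScalars ℝ).toContinuousLinearEquiv
  have hE : ∀ x, E x = v.equivFun.symm x := fun x => rfl
  have hmem : ∀ x, x ∈ ZLattice.comap ℝ Λ E.toLinearMap ↔ v.equivFun.symm x ∈ Λ :=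
    fun x => Iff.rfl
  refine ⟨ZLattice.comap ℝ Λ E.toLinearMap, inferInstance, inferInstance, χ,
    fun g => v.equivFun (b g), ⟨?_, ?_, ?_, ?_⟩⟩
  · intro g z hz
    rw [hmem] at hz ⊢
    rw [hAsymm, ← Submodule.Quotient.mk_eq_zero]
    have h1 := hAb g 0
    rw [(Submodule.Quotient.mk_eq_zero Λ).2 (zero_mem Λ), ← (Submodule.Quotient.mk_eq_zero Λ).2 hz,
      hAb] at h1
    simpa using h1
  · intro g h
    have h1 := (Submodule.Quotient.eq _).1 (hcoc g h 0)
    rw [hmem, map_sub, map_sub, hAsymm]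
    simp only [LinearEquiv.symm_apply_apply]
    simpa [sub_sub] using h1
  · intro g hg x hx
    rw [hmem, map_add, sub_mul, one_mul, map_sub, hAsymm, LinearEquiv.symm_apply_apply] at hx
    have hne : (e g : Equiv.Perm (Torus Λ)) ≠ 1 := by
      intro h
      exact hg (e.injective (by rw [map_one]; exact Subtype.ext h))
    refine hH.free _ (e g).2 hne (Submodule.Quotient.mk (v.equivFun.symm x)) ?_
    rw [hAb, Submodule.Quotient.eq]
    convert hx using 1
    abel
  · intro g hg
    by_contra hg1
    have hne : (e g : Equiv.Perm (Torus Λ)) ≠ 1 := by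
      intro h
      exact hg1 (e.injective (by rw [map_one]; exact Subtype.ext h))
    refine hH.no_translation _ (e g).2 hne (Submodule.Quotient.mk (b g)) ?_
    intro x
    obtain ⟨x, rfl⟩ := Submodule.Quotient.mk_surjective Λ x
    have h1 : A g x = x := by
      apply v.equivFun.injective
      rw [hAv]
      ext i
      simp [charVec, hg i]
    rw [hAb, h1, ← Submodule.Quotient.mk_add, add_comm]

theorem isHolomorphic_of_affine {f : Torus Λ → Torus Λ} (A : (Fin n → ℂ) → (Fin n → ℂ))
    (hA : Differentiable ℂ A) (h : ∀ v, f (Submodule.Quotient.mk v) = Submodule.Quotient.mk (A v)) :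
    IsHolomorphic Λ f := fun z =>
  ⟨Set.univ, isOpen_univ, Set.mem_univ z, A, hA.differentiableOn, fun w _ => h w⟩

theorem IsDiagonalAction.isHyperelliptic [DiscreteTopology Λ] [IsZLattice ℝ Λ] [Finite G]
    [Nontrivial G] {χ : Fin n → G →* ℂˣ} {b : G → Fin n → ℂ} (h : IsDiagonalAction Λ χ b) :
    IsHyperelliptic n G := by
  let M : G → Torus Λ → Torus Λ := fun g x =>
    Λ.mapQ Λ (LinearMap.mulLeft ℤ (charVec χ g)) (fun z hz => h.mul_mem g z hz) x +
      Submodule.Quotient.mk (b g)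
  have hM : ∀ g z, M g (Submodule.Quotient.mk z) =
      Submodule.Quotient.mk (charVec χ g * z + b g) := fun g z => rfl
  have hb1 : b 1 ∈ Λ := by simpa using h.cocycle 1 1
  let φ : G →* Function.End (Torus Λ) :=
    { toFun := M
      map_one' := by
        funext x
        obtain ⟨x, rfl⟩ := Submodule.Quotient.mk_surjective Λ x
        rw [hM]
        change _ = Submodule.Quotient.mk x
        rw [Submodule.Quotient.eq]
        simpa using hb1
      map_mul' := by
        intro g k
        funext x
        obtain ⟨x, rfl⟩ := Submodule.Quotient.mk_surjective Λ x
        change _ = M g (M k (Submodule.Quotient.mk x))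
        rw [hM, hM, hM, Submodule.Quotient.eq]
        convert h.cocycle g k using 1
        rw [charVec_mul]
        ring }
  let ψ : G →* Equiv.Perm (Torus Λ) := φ.toHomPerm
  have hψ : ∀ g z, ψ g (Submodule.Quotient.mk z) =
      Submodule.Quotient.mk (charVec χ g * z + b g) := hM
  have hfree : ∀ g, g ≠ 1 → ∀ x, ψ g x ≠ x := by
    intro g hg x hx
    obtain ⟨x, rfl⟩ := Submodule.Quotient.mk_surjective Λ x
    rw [hψ, Submodule.Quotient.eq] at hx
    refine h.free g hg x ?_
    convert hx using 1
    ring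
  have hinj : Function.Injective ψ := by
    rw [injective_iff_map_eq_one]
    intro g hg
    by_contra hne
    exact hfree g hne 0 (by rw [hg]; rfl)
  have hhol : ∀ g, IsHolomorphic Λ (ψ g) := fun g =>
    isHolomorphic_of_affine _ (by fun_prop) (hψ g)
  let e : G ≃* ψ.range := MonoidHom.ofInjective hinj
  refine ⟨Λ, inferInstance, inferInstance, ψ.range, ⟨?_, ?_, ?_, ?_, ?_⟩, ⟨e⟩⟩
  · rintro _ ⟨g, rfl⟩
    refine ⟨hhol g, ?_⟩
    have := hhol g⁻¹
    rw [map_inv] at this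
    exact this
  · exact Finite.of_equiv G e.toEquiv
  · exact e.symm.toEquiv.nontrivial
  · rintro _ ⟨g, rfl⟩ hne
    exact hfree g (fun h => hne (by rw [h, map_one]))
  · rintro _ ⟨g, rfl⟩ hne t ht
    refine hne ?_
    obtain ⟨t, rfl⟩ := Submodule.Quotient.mk_surjective Λ t
    -- If `g` acts as translation by `t`, then `(χ(g) - 1) z + b(g) - t` lies in `Λ` for all `z`,
    -- which forces `χ(g) = 1`.
    have h1 := linearMap_eq_zero_of_add_mem_lattice (Λ := Λ)
      (LinearMap.mulLeft ℂ (charVec χ g - 1)) (b g - t) (fun z => by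
        have := ht (Submodule.Quotient.mk z)
        rw [hψ, ← Submodule.Quotient.mk_add, Submodule.Quotient.eq] at this
        convert this using 1
        simp only [LinearMap.mulLeft_apply]
        ring)
    have h2 : charVec χ g - 1 = 0 := by
      simpa using LinearMap.congr_fun h1 1
    rw [h.faithful g, map_one]
    intro i
    have := congrFun h2 i
    simp only [charVec, Pi.sub_apply, Pi.one_apply, Pi.zero_apply, sub_eq_zero] at this
    exact Units.ext this

theorem IsDiagonalAction.comp {K : Type*} [CommGroup K] {χ : Fin n → G →* ℂˣ}
    {b : G → Fin n → ℂ} (h : IsDiagonalAction Λ χ b) {f : K →* G} (hf : Function.Injective f) :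
    IsDiagonalAction Λ (fun i => (χ i).comp f) (fun k => b (f k)) where
  mul_mem g z hz := h.mul_mem (f g) z hz
  cocycle g k := by rw [map_mul]; exact h.cocycle (f g) (f k)
  free g hg := h.free (f g) (fun h1 => hg (hf (by rw [h1, map_one])))
  faithful g hg := hf (by rw [map_one]; exact h.faithful _ hg)

/-- Every element of a group acting freely has a fixed vector. -/
theorem IsDiagonalAction.exists_eq_one [NeZero n] {χ : Fin n → G →* ℂˣ} {b : G → Fin n → ℂ}
    (h : IsDiagonalAction Λ χ b) (g : G) : ∃ i, χ i g = 1 := by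
  by_cases hg : g = 1
  · exact ⟨0, by rw [hg, map_one]⟩
  by_contra! hne
  -- The solution of `(χ(g) - 1) x + b(g) = 0`, a fixed point of `g`.
  refine h.free g hg (fun i => -b g i / ((χ i g : ℂ) - 1)) ?_
  convert Λ.zero_mem using 1
  ext i
  have : (χ i g : ℂ) - 1 ≠ 0 := sub_ne_zero.2 fun h1 => hne i (Units.ext h1)
  simp only [charVec, Pi.add_apply, Pi.mul_apply, Pi.sub_apply, Pi.one_apply, Pi.zero_apply]
  field_simp
  ring

end DiagData
end Hyperelliptic

namespace Hyperelliptic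
open Filter Topology

/-! ### Galois stability of the characters and the totient bound. -/

section Galois

variable {n : ℕ} {G : Type*} [CommGroup G] {Λ : Submodule ℤ (Fin n → ℂ)}

theorem exists_int_trace_eq [DiscreteTopology Λ] [IsZLattice ℝ Λ]
    (L : (Fin n → ℂ) →ₗ[ℝ] (Fin n → ℂ)) (hL : ∀ z ∈ Λ, L z ∈ Λ) :
    ∃ m : ℤ, LinearMap.trace ℝ _ L = m := by
  have := ZLattice.module_free ℝ Λ
  have := ZLattice.module_finite ℝ Λ
  let b := Module.Free.chooseBasis ℤ Λ
  let B := b.ofZLatticeBasis ℝ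
  refine ⟨∑ i, b.repr ⟨L (b i), hL _ (b i).2⟩ i, ?_⟩
  rw [LinearMap.trace_eq_matrix_trace ℝ B, Matrix.trace, Int.cast_sum]
  refine Finset.sum_congr rfl fun i _ => ?_
  rw [Matrix.diag_apply, LinearMap.toMatrix_apply]
  have h1 := b.ofZLatticeBasis_repr_apply ℝ Λ ⟨L (b i), hL _ (b i).2⟩ i
  simpa [B] using h1

theorem trace_mulLeft_real (w : Fin n → ℂ) :
    LinearMap.trace ℝ _ (LinearMap.mulLeft ℝ w) = ∑ i, 2 * (w i).re := by
  rw [LinearMap.trace_eq_matrix_trace ℝ (Pi.basis fun _ : Fin n => Complex.basisOneI),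
    Matrix.trace, Fintype.sum_sigma]
  refine Finset.sum_congr rfl fun i _ => ?_
  simp only [Matrix.diag_apply, LinearMap.toMatrix_apply, LinearMap.mulLeft_apply]
  simp [Fin.sum_univ_two, Pi.basis_repr, two_mul]

theorem coe_apply_pow_card [Finite G] (ψ : G →* ℂˣ) (g : G) : (ψ g : ℂ) ^ Nat.card G = 1 := by
  rw [← Units.val_pow_eq_pow_val, ← map_pow, pow_card_eq_one', map_one, Units.val_one]

theorem add_inv_eq_two_re [Finite G] (ψ : G →* ℂˣ) (g : G) :
    (ψ g : ℂ) + ((ψ g)⁻¹ : ℂˣ) = ((2 * (ψ g : ℂ).re : ℝ) : ℂ) := by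
  have h1 : ‖(ψ g : ℂ)‖ = 1 :=
    Complex.norm_eq_one_of_pow_eq_one (coe_apply_pow_card ψ g) Nat.card_pos.ne'
  rw [Units.val_inv_eq_inv_val, Complex.inv_eq_conj h1, Complex.add_conj]

/-- The sum is the real trace of `χ(g)`, as inverse and complex conjugate agree on roots of unity;
in a basis of `Λ` this trace is an integer. -/
theorem IsDiagonalAction.exists_int_sum_eq [DiscreteTopology Λ] [IsZLattice ℝ Λ] [Finite G]
    {χ : Fin n → G →* ℂˣ} {b : G → Fin n → ℂ} (h : IsDiagonalAction Λ χ b) (g : G) :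
    ∃ m : ℤ, ∑ i, ((χ i g : ℂ) + ((χ i g)⁻¹ : ℂˣ)) = m := by
  obtain ⟨m, hm⟩ := exists_int_trace_eq (Λ := Λ) (LinearMap.mulLeft ℝ (charVec χ g))
    (fun z hz => h.mul_mem g z hz)
  refine ⟨m, ?_⟩
  rw [trace_mulLeft_real] at hm
  simp_rw [add_inv_eq_two_re]
  rw [← Complex.ofReal_sum]
  have : ((m : ℝ) : ℂ) = m := by simp
  rw [← this, ← hm]
  rfl

/-- The hypothesis is an integral polynomial relation for a primitive root of unity `ζ`; it persists
for `ζ ^ a`, which has the same minimal polynomial. -/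
theorem sum_pow_eq_of_sum_eq_int {N : ℕ} (hN : 0 < N) {ι : Type*} [Fintype ι] (w : ι → ℂ)
    (hw : ∀ i, w i ^ N = 1) {m : ℤ} (hm : ∑ i, w i = m) {a : ℕ} (ha : a.Coprime N) :
    ∑ i, w i ^ a = m := by
  have hζ := Complex.isPrimitiveRoot_exp N hN.ne'
  set ζ := Complex.exp (2 * Real.pi * Complex.I / N)
  have : NeZero N := ⟨hN.ne'⟩
  choose e _ he using fun i => hζ.eq_pow_of_pow_eq_one (hw i)
  let P : Polynomial ℤ := ∑ i, Polynomial.X ^ e i - Polynomial.C m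
  have hP : ∀ z : ℂ, Polynomial.aeval z P = ∑ i, z ^ e i - m := by
    intro z; simp [P]
  have h1 : Polynomial.aeval ζ P = 0 := by
    rw [hP, sub_eq_zero, ← hm]
    exact Finset.sum_congr rfl fun i _ => he i
  have h2 : minpoly ℤ ζ ∣ P := minpoly.isIntegrallyClosed_dvd (hζ.isIntegral hN) h1
  rw [hζ.minpoly_eq_pow_coprime ha] at h2
  have h3 : Polynomial.aeval (ζ ^ a) P = 0 :=
    Polynomial.aeval_eq_zero_of_dvd_aeval_eq_zero h2 (minpoly.aeval _ _)
  rw [hP, sub_eq_zero] at h3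
  rw [← h3]
  refine Finset.sum_congr rfl fun i _ => ?_
  rw [← he i, ← pow_mul, ← pow_mul, mul_comm]

theorem sum_char_eq_ite [Fintype G] (ψ : G →* ℂˣ) [Decidable (ψ = 1)] :
    ∑ g, (ψ g : ℂ) = ((if ψ = 1 then Fintype.card G else 0 : ℕ) : ℂ) := by
  classical
  have h := sum_hom_units ((Units.coeHom ℂ).comp ψ)
  have h1 : (Units.coeHom ℂ).comp ψ = 1 ↔ ψ = 1 := by
    constructor
    · intro h
      ext g
      exact DFunLike.congr_fun h g
    · rintro rfl
      ext g
      simp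
  simp only [h1, MonoidHom.comp_apply, Units.coeHom_apply] at h
  rw [h]

/-- The set of characters `χᵢ^{±1}` is stable under the Galois action. -/
theorem IsDiagonalAction.exists_pow_eq [DiscreteTopology Λ] [IsZLattice ℝ Λ] [Finite G]
    {χ : Fin n → G →* ℂˣ} {b : G → Fin n → ℂ} (h : IsDiagonalAction Λ χ b) {a : ℕ}
    (ha : a.Coprime (Nat.card G)) (j : Fin n) :
    ∃ p : Fin n × Bool, χ j ^ a = cond p.2 (χ p.1) (χ p.1)⁻¹ := by
  classical
  have := Fintype.ofFinite G
  let θ : Fin n × Bool → G →* ℂˣ := fun p => cond p.2 (χ p.1) (χ p.1)⁻¹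
  have h1 : ∀ g, ∑ p, (θ p g : ℂ) ^ a = ∑ p, (θ p g : ℂ) := by
    intro g
    obtain ⟨m, hm⟩ := h.exists_int_sum_eq g
    have hm' : ∑ p, (θ p g : ℂ) = m := by
      rw [← hm, Fintype.sum_prod_type]
      simp [θ]
    rw [hm']
    exact sum_pow_eq_of_sum_eq_int Nat.card_pos _ (fun p => coe_apply_pow_card _ g) hm' ha
  -- By orthogonality both sides are `|G|` times the multiplicity of `χ j ^ a`, among the `θ p ^ a`
  -- and among the `θ p`. The left multiplicity is positive because of `p = (j, true)`.
  have h2 : ∑ p, ∑ g, ((θ p ^ a * (χ j ^ a)⁻¹ : G →* ℂˣ) g : ℂ) =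
      ∑ p, ∑ g, ((θ p * (χ j ^ a)⁻¹ : G →* ℂˣ) g : ℂ) := by
    rw [Finset.sum_comm, Finset.sum_comm (s := Finset.univ (α := Fin n × Bool))]
    refine Finset.sum_congr rfl fun g _ => ?_
    simp only [MonoidHom.mul_apply, Units.val_mul, ← Finset.sum_mul]
    congr 1
    simpa using h1 g
  simp_rw [sum_char_eq_ite] at h2
  rw [← Nat.cast_sum, ← Nat.cast_sum, Nat.cast_inj] at h2
  by_contra! hne
  have h3 : ∑ p, (if θ p * (χ j ^ a)⁻¹ = 1 then Fintype.card G else 0) = 0 := by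
    refine Finset.sum_eq_zero fun p _ => if_neg fun hp => hne p ?_
    exact (mul_inv_eq_one.1 hp).symm
  rw [h3, Finset.sum_eq_zero_iff] at h2
  have h4 := h2 (j, true) (Finset.mem_univ _)
  have h5 : θ (j, true) ^ a * (χ j ^ a)⁻¹ = 1 := mul_inv_cancel (χ j ^ a)
  rw [if_pos h5] at h4
  exact Fintype.card_ne_zero h4

theorem orderOf_char_dvd_card [Finite G] (ψ : G →* ℂˣ) : orderOf ψ ∣ Nat.card G := by
  refine orderOf_dvd_of_pow_eq_one ?_
  ext g
  simpa using coe_apply_pow_card ψ g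

theorem zpowers_pow_of_coprime {A : Type*} [Group A] (x : A) {a : ℕ} (ha : a.Coprime (orderOf x)) :
    Subgroup.zpowers (x ^ a) = Subgroup.zpowers x := by
  refine le_antisymm (Subgroup.zpowers_le.2 (Subgroup.npow_mem_zpowers x a)) ?_
  rw [Subgroup.zpowers_le]
  obtain ⟨k, hk⟩ := exists_pow_eq_self_of_coprime ha
  have := Subgroup.npow_mem_zpowers (x ^ a) k
  rwa [hk] at this

/-- The Galois conjugates of a character of order `d` account for at least `φ(d) / 2`
coordinates. -/
theorem IsDiagonalAction.totient_orderOf_le [DiscreteTopology Λ] [IsZLattice ℝ Λ] [Finite G]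
    {χ : Fin n → G →* ℂˣ} {b : G → Fin n → ℂ} (h : IsDiagonalAction Λ χ b) (j : Fin n) :
    (orderOf (χ j)).totient ≤
      2 * Nat.card {i // Subgroup.zpowers (χ i) = Subgroup.zpowers (χ j)} := by
  have hd := orderOf_char_dvd_card (χ j)
  set d := orderOf (χ j) with hd'
  have hN : NeZero (Nat.card G) := ⟨Nat.card_pos.ne'⟩
  have hd0 : NeZero d := ⟨fun h0 => hN.out (Nat.eq_zero_of_zero_dvd (h0 ▸ hd))⟩
  -- A unit modulo `d` is lifted to one modulo `|G|`, where Galois stability applies. It is sent to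
  -- a coordinate and a sign realising that power of `χ j`; distinct units give distinct powers.
  choose u' hu' using ZMod.unitsMap_surjective hd
  let a : (ZMod d)ˣ → ℕ := fun u => (u' u : ZMod (Nat.card G)).val
  have ha : ∀ u, (a u).Coprime (Nat.card G) := fun u => ZMod.val_coe_unit_coprime _
  have hau : ∀ u, ((a u : ℕ) : ZMod d) = u := by
    intro u
    have h1 := congrArg Units.val (hu' u)
    rw [ZMod.unitsMap_val] at h1
    rw [← h1, ZMod.cast_eq_val]
  choose p hp using fun u => h.exists_pow_eq (ha u) j
  have hpz : ∀ u, Subgroup.zpowers (χ (p u).1) = Subgroup.zpowers (χ j) := by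
    intro u
    rw [← zpowers_pow_of_coprime (χ j) ((ha u).coprime_dvd_right hd), hp u]
    cases (p u).2 <;> simp
  have hinj : Function.Injective (fun u : (ZMod d)ˣ =>
      ((⟨(p u).1, hpz u⟩, (p u).2) :
        {i // Subgroup.zpowers (χ i) = Subgroup.zpowers (χ j)} × Bool)) := by
    intro u v huv
    simp only [Prod.mk.injEq, Subtype.mk.injEq] at huv
    have h1 : χ j ^ a u = χ j ^ a v := by rw [hp u, hp v, Prod.ext huv.1 huv.2]
    have h2 := (ZMod.natCast_eq_natCast_iff _ _ _).2 ((pow_eq_pow_iff_modEq (x := χ j) (m := a v) (n := a u)).1 h1)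
    rw [← hd'] at h2
    rw [hau, hau] at h2
    exact Units.ext h2
  have := Nat.card_le_card_of_injective _ hinj
  rw [Nat.card_prod, Nat.card_eq_fintype_card, ZMod.card_units_eq_totient] at this
  simpa [mul_comm] using this

end Galois
end Hyperelliptic

namespace Hyperelliptic
open Filter Topology

/-! ### Translation parts: excluding `C₄³` and `C₆³`. -/

section Translations

variable {n : ℕ} {G : Type*} [CommGroup G] {Λ : Submodule ℤ (Fin n → ℂ)}
  {χ : Fin n → G →* ℂˣ} {b : G → Fin n → ℂ}

/-- Change of origin: conjugation by the translation by `x₀`. -/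
theorem IsDiagonalAction.shift (h : IsDiagonalAction Λ χ b) (x₀ : Fin n → ℂ) :
    IsDiagonalAction Λ χ (fun g => b g + (charVec χ g - 1) * x₀) where
  mul_mem := h.mul_mem
  cocycle g k := by
    convert h.cocycle g k using 1
    rw [charVec_mul]
    ring
  free g hg x hx := h.free g hg (x + x₀) (by convert hx using 1; ring)
  faithful := h.faithful

/-- Compare the cocycle for `k * g` and `g * k`: since `b g` lives on a coordinate where all linear
parts are trivial, only `(χ(g) - 1) b(k)` survives. -/
theorem IsDiagonalAction.sub_one_mul_mem (h : IsDiagonalAction Λ χ b) {g : G}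
    {i₀ : Fin n} (hχ : χ i₀ = 1) (hg : ∀ i ≠ i₀, b g i = 0) (k : G) :
    (charVec χ g - 1) * b k ∈ Λ := by
  have h1 : (charVec χ k - 1) * b g = 0 := by
    ext i
    by_cases hi : i = i₀
    · subst hi; simp [charVec, hχ]
    · simp [hg i hi]
  have h2 := Λ.sub_mem (h.cocycle k g) (h.cocycle g k)
  rw [mul_comm k g] at h2
  convert h2 using 1
  linear_combination h1

/-- The projection of the lattice to a coordinate. -/
def latticeCoord (Λ : Submodule ℤ (Fin n → ℂ)) (i : Fin n) : AddSubgroup ℂ :=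
  Λ.toAddSubgroup.map (Pi.evalAddMonoidHom (fun _ : Fin n => ℂ) i)

theorem mem_latticeCoord {i : Fin n} {z : ℂ} : z ∈ latticeCoord Λ i ↔ ∃ l ∈ Λ, l i = z :=
  Iff.rfl

/-- The homomorphism by which the group acts by translations on a coordinate with trivial
character. -/
def IsDiagonalAction.translationHom (h : IsDiagonalAction Λ χ b) {i₀ : Fin n} (hχ : χ i₀ = 1) :
    G →* Multiplicative (ℂ ⧸ latticeCoord Λ i₀) :=
  MonoidHom.mk' (fun g => Multiplicative.ofAdd (QuotientAddGroup.mk (b g i₀))) (by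
    intro g k
    rw [← ofAdd_add, ← QuotientAddGroup.mk_add]
    congr 1
    rw [QuotientAddGroup.eq, ← neg_mem_iff]
    refine ⟨_, h.cocycle g k, ?_⟩
    simp [charVec, hχ]
    ring)

theorem IsDiagonalAction.translationHom_eq_one_iff (h : IsDiagonalAction Λ χ b) {i₀ : Fin n}
    (hχ : χ i₀ = 1) (g : G) :
    h.translationHom hχ g = 1 ↔ ∃ l ∈ Λ, l i₀ = b g i₀ := by
  rw [← mem_latticeCoord, ← QuotientAddGroup.eq_zero_iff]
  rfl

/-- The vectors lie in a discrete subgroup of a complex line, of real dimension two, so three of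
them are dependent over `ℤ`; division by the gcd makes the relation primitive. -/
theorem exists_int_relation [DiscreteTopology Λ] (i₀ : Fin n) {ι : Type*} [Fintype ι]
    (hι : 2 < Fintype.card ι) (t : ι → ℂ) (ht : ∀ j, Pi.single i₀ (t j) ∈ Λ) :
    ∃ c : ι → ℤ, ∑ j, (c j : ℂ) * t j = 0 ∧ Finset.univ.gcd c = 1 := by
  classical
  let S : ℂ →ₗ[ℝ] (Fin n → ℂ) := LinearMap.single ℝ (fun _ => ℂ) i₀
  let w : ι → Fin n → ℂ := fun j => S (t j)
  have hdep : ¬ LinearIndependent ℤ w := by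
    intro hw
    have hle : Submodule.span ℤ (Set.range w) ≤ Λ := by
      rw [Submodule.span_le]
      rintro _ ⟨j, rfl⟩
      exact ht j
    have hdisc : DiscreteTopology (Submodule.span ℤ (Set.range w)) :=
      DiscreteTopology.of_subset (s := (Λ : Set (Fin n → ℂ))) inferInstance hle
    have h1 := Real.finrank_eq_int_finrank_of_discrete hdisc
    rw [Set.finrank, Set.finrank, finrank_span_eq_card hw] at h1
    have h2 : Submodule.span ℝ (Set.range w) ≤ LinearMap.range S := by
      rw [Submodule.span_le]
      rintro _ ⟨j, rfl⟩
      exact ⟨_, rfl⟩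
    have h3 := Submodule.finrank_mono h2
    have h4 := LinearMap.finrank_range_le S
    rw [Complex.finrank_real_complex] at h4
    omega
  obtain ⟨c, hc, j, hj⟩ := Fintype.not_linearIndependent_iff.1 hdep
  have hc' : ∑ j, (c j : ℂ) * t j = 0 := by
    have := congrFun hc i₀
    simpa [w, S] using this
  obtain ⟨c', hcc', hgcd⟩ := Finset.univ.extract_gcd c ⟨j, Finset.mem_univ j⟩
  refine ⟨c', ?_, hgcd⟩
  have hne : Finset.univ.gcd c ≠ 0 := fun h0 => hj (Finset.gcd_eq_zero_iff.1 h0 j (Finset.mem_univ j))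
  have : ((Finset.univ.gcd c : ℤ) : ℂ) * ∑ j, (c' j : ℂ) * t j = 0 := by
    rw [← hc', Finset.mul_sum]
    refine Finset.sum_congr rfl fun j hj => ?_
    rw [hcc' j hj]
    push_cast
    ring
  exact (mul_eq_zero.1 this).resolve_left (by exact_mod_cast hne)

theorem exists_not_dvd_of_gcd_eq_one {ι : Type*} [Fintype ι] {c : ι → ℤ}
    (hc : Finset.univ.gcd c = 1) {m : ℤ} (hm : ¬ IsUnit m) : ∃ j, ¬ m ∣ c j := by
  by_contra! hall
  refine hm (isUnit_of_dvd_one ?_)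
  rw [← hc]
  exact Finset.dvd_gcd fun j _ => hall j

/-- A group acting by a full `μ_m³` on three coordinates and trivially on the fourth contains a
non-trivial element whose translation part is, up to the lattice, annihilated by `ζ - 1`. -/
theorem IsDiagonalAction.exists_translation_kernel [DiscreteTopology Λ] [Finite G]
    (h : IsDiagonalAction Λ χ b) {i₀ : Fin n} (hn : n = 4) (hχ : χ i₀ = 1) {ζ : ℂˣ} (hζ : ζ ≠ 1)
    (u : {i // i ≠ i₀} → G)
    (hu : ∀ i j : {i // i ≠ i₀}, χ i (u j) = if i = j then ζ else 1) :
    ∃ (b' : G → Fin n → ℂ) (c : {i // i ≠ i₀} → ℤ) (v : Fin n → ℂ), IsDiagonalAction Λ χ b' ∧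
      Finset.univ.gcd c = 1 ∧ v i₀ = 0 ∧ b' (∏ j, u j ^ c j) - v ∈ Λ ∧
      (∀ i : {i // i ≠ i₀}, χ i (∏ j, u j ^ c j) = ζ ^ c i) ∧
      (fun i => if i = i₀ then 0 else ((ζ : ℂ) - 1) * v i) ∈ Λ := by
  classical
  let g : G := ∏ j, u j
  have hprod : ∀ (i : {i // i ≠ i₀}) (c : {i // i ≠ i₀} → ℤ), χ i (∏ j, u j ^ c j) = ζ ^ c i := by
    intro i c
    rw [map_prod, Finset.prod_eq_single i]
    · rw [map_zpow, hu, if_pos rfl]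
    · intro j _ hj
      rw [map_zpow, hu, if_neg hj.symm, one_zpow]
    · simp
  have hg : ∀ i (hi : i ≠ i₀), χ i g = ζ := by
    intro i hi
    simpa [g] using hprod ⟨i, hi⟩ 1
  have hζ1 : (ζ : ℂ) - 1 ≠ 0 := sub_ne_zero.2 fun h1 => hζ (Units.ext h1)
  -- The new origin makes `g`, which acts by `ζ` on every coordinate but `i₀`, a pure translation of
  -- the coordinate `i₀`.
  let x₀ : Fin n → ℂ := fun i => if i = i₀ then 0 else - b g i / ((ζ : ℂ) - 1)
  have h' := h.shift x₀
  set b' := fun g => b g + (charVec χ g - 1) * x₀ with hb'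
  have hb'g : ∀ i ≠ i₀, b' g i = 0 := by
    intro i hi
    simp only [hb', charVec, Pi.add_apply, Pi.mul_apply, Pi.sub_apply, Pi.one_apply, hg i hi, x₀,
      if_neg hi]
    field_simp
    ring
  have hgv : charVec χ g = fun i => if i = i₀ then 1 else (ζ : ℂ) := by
    ext i
    by_cases hi : i = i₀
    · subst hi; simp [charVec, hχ]
    · simp [charVec, hg i hi, hi]
  set N := Nat.card G with hN
  have hN0 : (N : ℂ) ≠ 0 := by
    have : 0 < N := Nat.card_pos
    exact_mod_cast this.ne'
  have hζN : (ζ : ℂ) ^ N = 1 := by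
    by_cases hne : Nonempty {i // i ≠ i₀}
    · obtain ⟨i, hi⟩ := hne
      rw [← hg i hi]
      exact coe_apply_pow_card (χ i) g
    · exfalso
      have h1 : Fintype.card {i // i ≠ i₀} = n - 1 := by simp
      rw [Fintype.card_eq_zero_iff.2 (not_nonempty_iff.1 hne)] at h1
      omega
  have hgeom : ∑ s ∈ Finset.range N, (ζ : ℂ) ^ s = 0 := by
    have := geom_sum_mul (ζ : ℂ) N
    rw [hζN, sub_self] at this
    exact (mul_eq_zero.1 this).resolve_right hζ1
  -- Summing over the powers of `g` kills the coordinates other than `i₀`, because `1 + ζ + ⋯ + ζ ^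
  -- (N - 1) = 0`.
  have hsingle : ∀ l ∈ Λ, Pi.single i₀ ((N : ℂ) * l i₀) ∈ Λ := by
    intro l hl
    have h1 : ∑ s ∈ Finset.range N, charVec χ (g ^ s) * l ∈ Λ :=
      Λ.sum_mem fun s _ => h.mul_mem _ _ hl
    convert h1 using 1
    ext i
    simp only [Finset.sum_apply, Pi.mul_apply, ← Finset.sum_mul]
    by_cases hi : i = i₀
    · subst hi; simp [charVec, hχ]
    · rw [Pi.single_eq_of_ne hi]
      have : ∀ s, charVec χ (g ^ s) i = (ζ : ℂ) ^ s := fun s => by simp [charVec, hg i hi]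
      simp_rw [this]
      rw [hgeom, zero_mul]
  have hτ : ∀ k, ∃ l ∈ Λ, l i₀ = N * b' k i₀ := by
    intro k
    have h1 : (h'.translationHom hχ k) ^ N = 1 := by
      rw [← map_pow, pow_card_eq_one', map_one]
    obtain ⟨l, hl, hl'⟩ := (QuotientAddGroup.eq_zero_iff (N • b' k i₀)).1 h1
    exact ⟨l, hl, by simpa using hl'⟩
  have hτ2 : ∀ k, Pi.single i₀ ((N : ℂ) * (N * b' k i₀)) ∈ Λ := by
    intro k
    obtain ⟨l, hl, hl'⟩ := hτ k
    rw [← hl']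
    exact hsingle l hl
  -- One factor `N` brings the finite-order translation into the projected lattice, the other brings
  -- that projection into `Λ` itself.
  obtain ⟨c, hc, hgcd⟩ := exists_int_relation (Λ := Λ) i₀ (ι := {i // i ≠ i₀}) (by simp [hn])
    (fun j => (N : ℂ) * (N * b' (u j) i₀)) (fun j => hτ2 _)
  have hc' : ∑ j, (c j : ℂ) * b' (u j) i₀ = 0 := by
    have : (N : ℂ) * (N * ∑ j, (c j : ℂ) * b' (u j) i₀) = 0 := by
      rw [← hc, Finset.mul_sum, Finset.mul_sum]
      exact Finset.sum_congr rfl fun j _ => by ring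
    simpa [hN0] using this
  have hker : h'.translationHom hχ (∏ j, u j ^ c j) = 1 := by
    rw [map_prod]
    simp_rw [map_zpow]
    have h1 : ∏ j, h'.translationHom hχ (u j) ^ c j =
        Multiplicative.ofAdd (∑ j, c j • (QuotientAddGroup.mk (b' (u j) i₀) :
          ℂ ⧸ latticeCoord Λ i₀)) := by
      rw [ofAdd_sum]
      rfl
    have h2 : ∑ j, c j • (QuotientAddGroup.mk (b' (u j) i₀) : ℂ ⧸ latticeCoord Λ i₀) =
        QuotientAddGroup.mk (∑ j, c j • b' (u j) i₀) := by
      change _ = QuotientAddGroup.mk' _ _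
      rw [map_sum]
      rfl
    rw [h1, h2]
    simp only [zsmul_eq_mul, hc']
    rfl
  obtain ⟨l, hl, hl'⟩ := (h'.translationHom_eq_one_iff hχ _).1 hker
  have hmem := Λ.sub_mem (h'.sub_one_mul_mem hχ hb'g (∏ j, u j ^ c j))
    (Λ.sub_mem (h'.mul_mem g l hl) hl)
  refine ⟨b', c, b' (∏ j, u j ^ c j) - l, h', hgcd, ?_, ?_, fun i => hprod i c, ?_⟩
  · simp [hl']
  · simpa using hl
  · convert hmem using 1
    ext i
    simp only [hgv, Pi.sub_apply, Pi.mul_apply, Pi.one_apply]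
    split_ifs <;> ring

/-- For a primitive sixth root of unity `ζ - 1 = ζ ^ 2` is a unit, so the remaining translation `v`
lies in `Λ` and the element fixes the origin. It is non-trivial, as a primitive relation is not
divisible by 6. -/
theorem IsDiagonalAction.not_isCubeAction_six [DiscreteTopology Λ] [Finite G]
    (h : IsDiagonalAction Λ χ b) {i₀ : Fin n} (hn : n = 4) (hχ : χ i₀ = 1) {ζ : ℂˣ}
    (hζ : (ζ : ℂ) ^ 2 = ζ - 1) (u : {i // i ≠ i₀} → G)
    (hu : ∀ i j : {i // i ≠ i₀}, χ i (u j) = if i = j then ζ else 1) : False := by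
  classical
  have hζ3 : ζ ^ 3 = -1 := by
    ext
    simp only [Units.val_pow_eq_pow_val, Units.val_neg, Units.val_one]
    linear_combination ((ζ : ℂ) + 1) * hζ
  have hζ6 : ζ ^ 6 = 1 := by
    rw [show (6 : ℕ) = 3 * 2 from rfl, pow_mul, hζ3]
    simp
  have hζ1 : ζ ≠ 1 := by
    rintro rfl
    norm_num at hζ
  obtain ⟨b', c, v, h', hgcd, hv, hbv, hk, hmem⟩ := h.exists_translation_kernel hn hχ hζ1 u hu
  -- Applying `ζ ^ 4`, the inverse of `ζ - 1`, through the fourth powers of the generators.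
  have hvΛ : v ∈ Λ := by
    convert h'.mul_mem (∏ j, u j ^ (4 : ℤ)) _ hmem using 1
    ext i
    by_cases hi : i = i₀
    · subst hi; simp [hv]
    · have h1 : χ i (∏ j, u j ^ (4 : ℤ)) = ζ ^ 4 := by
        rw [map_prod, Finset.prod_eq_single ⟨i, hi⟩]
        · rw [map_zpow, hu ⟨i, hi⟩, if_pos rfl]; rfl
        · intro j _ hj
          rw [map_zpow, hu ⟨i, hi⟩, if_neg hj.symm, one_zpow]
        · simp
      have h2 : (ζ : ℂ) ^ 6 = 1 := by
        rw [← Units.val_pow_eq_pow_val, hζ6, Units.val_one]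
      simp only [Pi.mul_apply, charVec, h1, if_neg hi, Units.val_pow_eq_pow_val]
      linear_combination (- v i) * h2 + (ζ : ℂ) ^ 4 * v i * hζ
  obtain ⟨j, hj⟩ := exists_not_dvd_of_gcd_eq_one hgcd (m := 6) (by rw [Int.isUnit_iff]; omega)
  refine h'.free (∏ j, u j ^ c j) ?_ 0 ?_
  · intro h1
    have h2 := hk j
    rw [h1, map_one] at h2
    refine hj ?_
    have h3 : orderOf ζ = 6 := by
      refine orderOf_eq_of_pow_and_pow_div_prime (by norm_num) hζ6 ?_
      intro p hp hp6
      have : p = 2 ∨ p = 3 := by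
        have : p ∈ Nat.primeFactors 6 := by simp [hp, hp6]
        rw [show (6 : ℕ) = 2 * 3 from rfl, Nat.primeFactors_mul (by norm_num) (by norm_num),
          Nat.Prime.primeFactors Nat.prime_two, Nat.Prime.primeFactors Nat.prime_three] at this
        simpa using this
      rcases this with rfl | rfl
      · rw [show 6 / 2 = 3 from rfl, hζ3]
        intro h4
        have := congrArg Units.val h4
        norm_num at this
      · intro h4
        have h5 := congrArg Units.val h4
        simp only [show 6 / 3 = 2 from rfl, Units.val_pow_eq_pow_val, Units.val_one, hζ] at h5
        have h6 : (ζ : ℂ) = 2 := by linear_combination h5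
        rw [h6] at hζ
        norm_num at hζ
    have h4 := orderOf_dvd_iff_zpow_eq_one.2 h2.symm
    rw [h3] at h4
    exact_mod_cast h4
  · rw [mul_zero, zero_add]
    convert Λ.add_mem hbv hvΛ using 1
    ring

/-- Here `ζ - 1` only divides 2, so the element `k` itself may act freely; its square is non-trivial
and has a fixed point. -/
theorem IsDiagonalAction.not_isCubeAction_four [DiscreteTopology Λ] [Finite G]
    (h : IsDiagonalAction Λ χ b) {i₀ : Fin n} (hn : n = 4) (hχ : χ i₀ = 1) {ζ : ℂˣ}
    (hζ : (ζ : ℂ) ^ 2 = -1) (u : {i // i ≠ i₀} → G)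
    (hu : ∀ i j : {i // i ≠ i₀}, χ i (u j) = if i = j then ζ else 1) : False := by
  classical
  have hζ2 : ζ ^ 2 = -1 := by
    ext
    simpa using hζ
  have hζ1 : ζ ≠ 1 := by
    rintro rfl
    norm_num at hζ
  obtain ⟨b', c, v, h', hgcd, hv, hbv, hk, hmem⟩ := h.exists_translation_kernel hn hχ hζ1 u hu
  -- Applying `u j - 1` isolates the coordinate `j`, and `ζ (ζ - 1) ^ 2 = 2`.
  have hcoord : ∀ j : {i // i ≠ i₀}, Pi.single (j : Fin n) (2 * v j) ∈ Λ := by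
    intro j
    have h1 := h'.mul_mem (u j) _ (Λ.sub_mem (h'.mul_mem (u j) _ hmem) hmem)
    convert h1 using 1
    ext i
    by_cases hi : i = i₀
    · subst hi
      rw [Pi.single_eq_of_ne j.2.symm]
      simp
    · have h2 := hu ⟨i, hi⟩ j
      simp only at h2
      simp only [Pi.mul_apply, Pi.sub_apply, charVec, h2, if_neg hi]
      by_cases hij : i = j
      · have hij' : (⟨i, hi⟩ : {i // i ≠ i₀}) = j := Subtype.ext hij
        rw [if_pos hij', hij, Pi.single_eq_same]
        linear_combination (2 * v j - (ζ : ℂ) * v j) * hζ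
      · have hij' : (⟨i, hi⟩ : {i // i ≠ i₀}) ≠ j := fun h => hij (congrArg Subtype.val h)
        rw [if_neg hij', Pi.single_eq_of_ne hij]
        simp
  set k := ∏ j, u j ^ c j with hkdef
  have hzodd : ∀ m : ℤ, ¬ 2 ∣ m → ((ζ ^ m : ℂˣ) : ℂ) * ((ζ ^ m : ℂˣ) : ℂ) = -1 := by
    intro m hm
    obtain ⟨q, rfl⟩ : ∃ q, m = 2 * q + 1 := ⟨m / 2, by omega⟩
    rw [← Units.val_mul, ← zpow_add, show 2 * q + 1 + (2 * q + 1) = 2 * (2 * q + 1) by ring,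
      zpow_mul, zpow_ofNat, hζ2, zpow_add, zpow_mul]
    simp
  have hz4 : ∀ m : ℤ, 4 ∣ m → ((ζ ^ m : ℂˣ) : ℂ) = 1 := by
    rintro _ ⟨q, rfl⟩
    rw [zpow_mul, show (4 : ℤ) = 2 * 2 from rfl, zpow_mul, zpow_ofNat, zpow_ofNat, hζ2]
    simp
  have hz2 : ∀ m : ℤ, 2 ∣ m → ¬ 4 ∣ m → ((ζ ^ m : ℂˣ) : ℂ) = -1 := by
    intro m h2 h4
    obtain ⟨q, rfl⟩ : ∃ q, m = 4 * q + 2 := ⟨m / 4, by omega⟩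
    rw [zpow_add, Units.val_mul, hz4 _ (Dvd.intro _ rfl), one_mul, zpow_ofNat, hζ2]
    simp
  obtain ⟨j, hj⟩ := exists_not_dvd_of_gcd_eq_one hgcd (m := 2) (by rw [Int.isUnit_iff]; omega)
  have hkχ : ∀ i (hi : i ≠ i₀), charVec χ k i = ((ζ ^ c ⟨i, hi⟩ : ℂˣ) : ℂ) := fun i hi =>
    congrArg Units.val (hk ⟨i, hi⟩)
  have hk0 : charVec χ k i₀ = 1 := by simp [charVec, hχ]
  -- Modulo `Λ`, `k * k` translates by `(1 + χ(k)) v`. For odd `c i` its linear part is `-1`, and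
  -- halving gives the fixed coordinate; for `c i` congruent to 2 modulo 4 the translation vanishes;
  -- for `4 ∣ c i` it is `2 * v i`, in the lattice by `hcoord`.
  refine h'.free (k * k) ?_
    (fun i => if hi : i = i₀ then 0 else
      if 2 ∣ c ⟨i, hi⟩ then 0 else (1 + charVec χ k i) * v i / 2) ?_
  · intro h1
    have h2 : charVec χ (k * k) j = 1 := by rw [h1]; simp
    rw [charVec_mul, Pi.mul_apply, hkχ j j.2, hzodd _ hj] at h2
    norm_num at h2
  · have hsum : ∑ i : {i // i ≠ i₀}, (if 4 ∣ c i then Pi.single (i : Fin n) (2 * v i) else 0) ∈ Λ :=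
      Λ.sum_mem fun i _ => by
        split_ifs
        · exact hcoord i
        · exact Λ.zero_mem
    have h2 := Λ.add_mem (Λ.add_mem (h'.cocycle k k) (Λ.add_mem hbv (h'.mul_mem k _ hbv))) hsum
    convert h2 using 1
    have h3 : ∀ w w' : Fin n → ℂ, b' (k * k) - b' k - charVec χ k * b' k +
        (b' k - v + charVec χ k * (b' k - v)) + w = (w - (1 + charVec χ k) * v) + b' (k * k) := by
      intro w w'; ring
    rw [h3 _ 0]
    congr 1
    ext i
    rw [charVec_mul]
    simp only [Pi.mul_apply, Pi.sub_apply, Pi.add_apply, Pi.one_apply, Finset.sum_apply]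
    by_cases hi : i = i₀
    · subst hi
      rw [Finset.sum_eq_zero]
      · simp [hv]
      · intro j _
        split_ifs
        · rw [Pi.single_eq_of_ne j.2.symm]
        · rfl
    · rw [Finset.sum_eq_single ⟨i, hi⟩, dif_neg hi, hkχ i hi]
      · by_cases h2 : 2 ∣ c ⟨i, hi⟩
        · rw [if_pos h2]
          by_cases h4 : 4 ∣ c ⟨i, hi⟩
          · rw [if_pos h4, hz4 _ h4, Pi.single_eq_same]; ring
          · rw [if_neg h4, hz2 _ h2 h4]; simp
        · have h4 : ¬ 4 ∣ c ⟨i, hi⟩ := fun h => h2 (dvd_trans (by norm_num) h)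
          rw [if_neg h2, if_neg h4, hzodd _ h2, Pi.zero_apply]; ring
      · intro j _ hji
        have : i ≠ j := fun h => hji (Subtype.ext h.symm)
        split_ifs
        · rw [Pi.single_eq_of_ne this]
        · rfl
      · simp

end Translations
end Hyperelliptic

namespace Hyperelliptic

/-! ### Counting with characters when every element has a fixed vector. -/

section Characters

/-- The `m`-torsion subgroup of a commutative group. -/
abbrev torsionKer (G : Type*) [CommGroup G] (m : ℕ) : Subgroup G :=
  (powMonoidHom m : G →* G).ker

theorem mem_torsionKer {G : Type*} [CommGroup G] {m : ℕ} {g : G} :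
    g ∈ torsionKer G m ↔ g ^ m = 1 := Iff.rfl

/-- `m`-torsion characters separating points embed a group into `μ_mᵏ`. -/
theorem card_le_of_separating {S : Type*} [Group S] {ι : Type*} [Fintype ι] {m : ℕ} (hm : m ≠ 0)
    (χ : ι → S →* ℂˣ) (hinj : ∀ s, (∀ i, χ i s = 1) → s = 1) (hχ : ∀ i s, χ i s ^ m = 1) :
    Nat.card S ≤ m ^ Fintype.card ι ∧ (m ^ Fintype.card ι ≤ Nat.card S →
      ∀ z : ι → ℂˣ, (∀ i, z i ^ m = 1) → ∃ s, ∀ i, χ i s = z i) := by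
  have : NeZero m := ⟨hm⟩
  let F : S → ι → rootsOfUnity m ℂ := fun s i => ⟨χ i s, hχ i s⟩
  have hF : Function.Injective F := by
    intro s t hst
    have : s * t⁻¹ = 1 := hinj _ fun i => by
      have := congrArg Subtype.val (congrFun hst i)
      simp only [F] at this
      rw [map_mul, map_inv, this, mul_inv_cancel]
    exact mul_inv_eq_one.1 this
  have hcard : Nat.card (ι → rootsOfUnity m ℂ) = m ^ Fintype.card ι := by
    rw [Nat.card_fun, Complex.card_rootsOfUnity, Nat.card_eq_fintype_card]
  refine ⟨hcard ▸ Nat.card_le_card_of_injective F hF, fun hle z hz => ?_⟩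
  have hbij := hF.bijective_of_nat_card_le (hcard ▸ hle)
  obtain ⟨s, hs⟩ := hbij.2 fun i => ⟨z i, hz i⟩
  exact ⟨s, fun i => congrArg Subtype.val (congrFun hs i)⟩

theorem exists_units_pow_eq_one_ne_one {m : ℕ} (hm : 1 < m) :
    ∃ z : ℂˣ, z ^ m = 1 ∧ ∀ k, 0 < k → k < m → z ^ k ≠ 1 := by
  have h := Complex.isPrimitiveRoot_exp m (by omega)
  obtain ⟨z, hz⟩ := h.isUnit (by omega)
  rw [← hz, IsPrimitiveRoot.coe_units_iff] at h
  exact ⟨z, h.pow_eq_one, fun k hk hkm => h.pow_ne_one_of_pos_of_lt hk.ne' hkm⟩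

/-- Allows any element to be written as a product of two on which given characters are all
non-trivial. It fails for `m = 2` and `z = -1`. -/
theorem exists_mul_eq_of_three_le {m : ℕ} (hm : 3 ≤ m) (z : ℂˣ) (hz : z ^ m = 1) :
    ∃ x y : ℂˣ, x ^ m = 1 ∧ y ^ m = 1 ∧ x ≠ 1 ∧ y ≠ 1 ∧ x * y = z := by
  obtain ⟨w, hw, hw'⟩ := exists_units_pow_eq_one_ne_one (m := m) (by omega)
  have h1 : w ≠ 1 := by simpa using hw' 1 one_pos (by omega)
  have h2 : w ^ 2 ≠ 1 := hw' 2 two_pos (by omega)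
  by_cases hzw : z = w
  · refine ⟨w ^ 2, w⁻¹, ?_, ?_, h2, ?_, ?_⟩
    · rw [← pow_mul, mul_comm, pow_mul, hw, one_pow]
    · rw [inv_pow, hw, inv_one]
    · simpa using h1
    · rw [hzw, pow_two, mul_inv_cancel_right]
  · refine ⟨w, w⁻¹ * z, hw, ?_, h1, ?_, ?_⟩
    · rw [mul_pow, inv_pow, hw, hz]; simp
    · rw [Ne, inv_mul_eq_one]
      exact fun h => hzw h.symm
    · rw [mul_inv_cancel_left]

variable {G : Type*} [CommGroup G] {χ : Fin 4 → G →* ℂˣ}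

/-- If every element has a fixed vector and three of the characters identify the group with
`μ_m³`, `m ≥ 3`, then the fourth character is trivial. -/
theorem char_eq_one_of_surjective {m : ℕ} (hm : 3 ≤ m) (hU : ∀ g, ∃ i, χ i g = 1) (i₀ : Fin 4)
    (hχ : ∀ i g, χ i g ^ m = 1) (hinj : ∀ g, (∀ i ≠ i₀, χ i g = 1) → g = 1)
    (hsurj : ∀ z : {i // i ≠ i₀} → ℂˣ, (∀ i, z i ^ m = 1) →
      ∃ s, ∀ i : {i // i ≠ i₀}, χ i s = z i) : χ i₀ = 1 := by
  have key : ∀ g, (∀ i ≠ i₀, χ i g ≠ 1) → χ i₀ g = 1 := by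
    intro g hg
    obtain ⟨i, hi⟩ := hU g
    by_cases hii : i = i₀
    · rwa [← hii]
    · exact absurd hi (hg i hii)
  ext1 g
  -- Write `g = s * t`, where `s` and `t` have no fixed vector outside `i₀`; so `χ i₀` is trivial on
  -- both.
  choose x y hx hy hx1 hy1 hxy using fun i => exists_mul_eq_of_three_le hm (χ i g) (hχ i g)
  obtain ⟨s, hs⟩ := hsurj (fun i => x i) (fun i => hx i)
  obtain ⟨t, ht⟩ := hsurj (fun i => y i) (fun i => hy i)
  have hst : s * t * g⁻¹ = 1 := by
    refine hinj _ fun i hi => ?_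
    rw [map_mul, map_mul, map_inv, hs ⟨i, hi⟩, ht ⟨i, hi⟩]
    simp [hxy]
  rw [← mul_inv_eq_one.1 hst, map_mul, key s, key t, mul_one]
  · rfl
  · intro i hi; rw [ht ⟨i, hi⟩]; exact hy1 i
  · intro i hi; rw [hs ⟨i, hi⟩]; exact hx1 i

/-- Four characters separating the points of a group of exponent `p` and order less than `p⁴`
contain three that separate points. -/
theorem exists_three_separating {S : Type*} [CommGroup S] [Finite S] {p : ℕ} (hp : p.Prime)
    (ψ : Fin 4 → S →* ℂˣ) (hinj : ∀ s, (∀ i, ψ i s = 1) → s = 1) (hS : ∀ s : S, s ^ p = 1)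
    (hcard : Nat.card S < p ^ 4) : ∃ i₀, ∀ s, (∀ i ≠ i₀, ψ i s = 1) → s = 1 := by
  by_contra! hcon
  -- If no three characters separate, each `ψ i` has an element seen by `ψ i` alone; these four
  -- elements generate a copy of `μ_p⁴`.
  choose x hx hx1 using hcon
  have hψ : ∀ i s, ψ i s ^ p = 1 := fun i s => by rw [← map_pow, hS, map_one]
  have hne : ∀ i, ψ i (x i) ≠ 1 := by
    intro i hi
    refine hx1 i (hinj _ fun j => ?_)
    by_cases hji : j = i
    · rw [hji, hi]
    · exact hx i j hji
  have hprim : ∀ i, IsPrimitiveRoot (ψ i (x i)) p := by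
    intro i
    have := orderOf_eq_prime (p := p) (hp := ⟨hp⟩) (hψ i (x i)) (hne i)
    rw [← this]
    exact IsPrimitiveRoot.orderOf _
  have : NeZero p := ⟨hp.ne_zero⟩
  have hsurj : Function.Surjective
      (fun s : S => fun i : Fin 4 => (⟨ψ i s, hψ i s⟩ : rootsOfUnity p ℂ)) := by
    intro z
    choose k _ hk using fun i => (hprim i).eq_pow_of_mem_rootsOfUnity (z i).2
    refine ⟨∏ j, x j ^ k j, ?_⟩
    funext i
    apply Subtype.ext
    change ψ i (∏ j, x j ^ k j) = z i
    rw [map_prod, Finset.prod_eq_single i, map_pow, hk i]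
    · intro j _ hj
      rw [map_pow, hx j i hj.symm, one_pow]
    · simp
  have := Nat.card_le_card_of_surjective _ hsurj
  rw [Nat.card_fun, Complex.card_rootsOfUnity, Nat.card_eq_fintype_card, Fintype.card_fin] at this
  omega

/-- Dual basis elements for three characters identifying the group with `μ_m³`. -/
theorem exists_dual_elements {m : ℕ} (i₀ : Fin 4)
    (hsurj : ∀ z : {i // i ≠ i₀} → ℂˣ, (∀ i, z i ^ m = 1) →
      ∃ s, ∀ i : {i // i ≠ i₀}, χ i s = z i) {ζ : ℂˣ} (hζ : ζ ^ m = 1) :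
    ∃ u : {i // i ≠ i₀} → G, ∀ i j : {i // i ≠ i₀}, χ i (u j) = if i = j then ζ else 1 := by
  choose u hu using fun j : {i // i ≠ i₀} => hsurj (fun i => if i = j then ζ else 1) (by
    intro i; split_ifs <;> simp [hζ])
  exact ⟨u, fun i j => hu j i⟩

/-- A non-trivial element of a group of exponent 4 has a power of order 2, so three characters
separating the 2-torsion separate `G`; the order 64 makes them an isomorphism onto `μ₄³`. -/
theorem exists_dual_elements_four [Finite G] (hU : ∀ g, ∃ i, χ i g = 1)
    (hinj : ∀ g, (∀ i, χ i g = 1) → g = 1) (hG : ∀ g : G, g ^ 4 = 1) (hcard : Nat.card G = 64)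
    (h2 : Nat.card (torsionKer G 2) = 8) {ζ : ℂˣ} (hζ : ζ ^ 4 = 1) :
    ∃ i₀, χ i₀ = 1 ∧ ∃ u : {i // i ≠ i₀} → G,
      ∀ i j : {i // i ≠ i₀}, χ i (u j) = if i = j then ζ else 1 := by
  obtain ⟨i₀, hi₀⟩ := exists_three_separating Nat.prime_two
    (fun i => (χ i).comp (torsionKer G 2).subtype)
    (fun s hs => Subtype.ext (hinj s hs)) (fun s => Subtype.ext s.2) (by rw [h2]; norm_num)
  have hinj' : ∀ g, (∀ i ≠ i₀, χ i g = 1) → g = 1 := by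
    intro g hg
    have h1 : ∀ k, k ^ 2 = 1 → (∀ i ≠ i₀, χ i k = 1) → k = 1 := fun k hk hk' =>
      congrArg Subtype.val (hi₀ ⟨k, hk⟩ hk')
    refine h1 g (h1 (g ^ 2) ?_ ?_) hg
    · rw [← pow_mul]; exact hG g
    · intro i hi; rw [map_pow, hg i hi, one_pow]
  have hχ : ∀ i g, χ i g ^ 4 = 1 := fun i g => by rw [← map_pow, hG, map_one]
  have hsurj := (card_le_of_separating (m := 4) (by norm_num)
    (fun i : {i // i ≠ i₀} => χ i) (fun s hs => hinj' s fun i hi => hs ⟨i, hi⟩)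
    (fun i s => hχ i s)).2 (by simp [hcard])
  exact ⟨i₀, char_eq_one_of_surjective (by norm_num) hU i₀ hχ hinj' hsurj,
    exists_dual_elements i₀ hsurj hζ⟩

/-- The covering argument for `m = 3` makes the fourth character trivial on the 3-torsion. It fails
for `m = 2`, so the 2-torsion is handled by multiplying with an element of order 3. -/
theorem exists_dual_elements_six [Finite G] (hU : ∀ g, ∃ i, χ i g = 1)
    (hinj : ∀ g, (∀ i, χ i g = 1) → g = 1) (hG : ∀ g : G, g ^ 6 = 1) (hcard : Nat.card G = 216)
    (h3 : Nat.card (torsionKer G 3) = 27) {ζ : ℂˣ} (hζ : ζ ^ 6 = 1) :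
    ∃ i₀, χ i₀ = 1 ∧ ∃ u : {i // i ≠ i₀} → G,
      ∀ i j : {i // i ≠ i₀}, χ i (u j) = if i = j then ζ else 1 := by
  obtain ⟨i₀, hi₀⟩ := exists_three_separating Nat.prime_three
    (fun i => (χ i).comp (torsionKer G 3).subtype)
    (fun s hs => Subtype.ext (hinj s hs)) (fun s => Subtype.ext s.2) (by rw [h3]; norm_num)
  have hχ3 : ∀ i (s : torsionKer G 3), χ i s ^ 3 = 1 := fun i s => by
    rw [← map_pow, mem_torsionKer.1 s.2, map_one]
  have hsurj3 := (card_le_of_separating (m := 3) (by norm_num)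
    (fun i : {i // i ≠ i₀} => (χ i).comp (torsionKer G 3).subtype)
    (fun s hs => hi₀ s fun i hi => hs ⟨i, hi⟩) (fun i s => hχ3 i s)).2 (by rw [h3]; simp)
  have htriv3 := char_eq_one_of_surjective (by norm_num)
    (fun g : torsionKer G 3 => hU g) i₀ hχ3 hi₀ hsurj3
  obtain ⟨w, hw, hw'⟩ := exists_units_pow_eq_one_ne_one (m := 3) (by norm_num)
  obtain ⟨s, hs⟩ := hsurj3 (fun _ => w) (fun _ => hw)
  have h3triv : ∀ k, k ^ 3 = 1 → χ i₀ k = 1 := fun k hk => DFunLike.congr_fun htriv3 ⟨k, hk⟩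
  -- Outside `i₀` the values at `k * s` have square `w ^ 2 ≠ 1`, so the fixed vector of `k * s` lies
  -- in the coordinate `i₀`.
  have h2triv : ∀ k, k ^ 2 = 1 → χ i₀ k = 1 := by
    intro k hk
    obtain ⟨i, hi⟩ := hU (k * s)
    by_cases hii : i = i₀
    · rw [hii, map_mul, h3triv s s.2, mul_one] at hi
      exact hi
    · exfalso
      have h4 : χ i s = w := hs ⟨i, hii⟩
      have h5 : χ i (k * s) ^ 2 = w ^ 2 := by
        rw [map_mul, mul_pow, ← map_pow, hk, map_one, one_mul, h4]
      rw [hi, one_pow] at h5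
      exact hw' 2 (by norm_num) (by norm_num) h5.symm
  have htriv : χ i₀ = 1 := by
    ext1 k
    have h4 := h3triv (k ^ 2) (by rw [← pow_mul]; exact hG k)
    have h5 := h2triv (k ^ 3) (by rw [← pow_mul]; exact hG k)
    rw [map_pow] at h4 h5
    rw [pow_succ, h4, one_mul] at h5
    exact h5
  have hinj' : ∀ g, (∀ i ≠ i₀, χ i g = 1) → g = 1 := by
    intro g hg
    refine hinj g fun i => ?_
    by_cases hii : i = i₀
    · rw [hii, htriv]; rfl
    · exact hg i hii
  have hχ : ∀ i g, χ i g ^ 6 = 1 := fun i g => by rw [← map_pow, hG, map_one]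
  have hsurj := (card_le_of_separating (m := 6) (by norm_num)
    (fun i : {i // i ≠ i₀} => χ i) (fun s hs => hinj' s fun i hi => hs ⟨i, hi⟩)
    (fun i s => hχ i s)).2 (by simp [hcard])
  exact ⟨i₀, htriv, exists_dual_elements i₀ hsurj hζ⟩

/-- Sixteen elements would fill `μ₂⁴`, including `-1` on all coordinates, which has no fixed vector.
-/
theorem card_torsionKer_two_lt [Finite G] (hU : ∀ g, ∃ i, χ i g = 1)
    (hinj : ∀ g, (∀ i, χ i g = 1) → g = 1) : Nat.card (torsionKer G 2) < 16 := by
  by_contra! hle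
  obtain ⟨s, hs⟩ := (card_le_of_separating (m := 2) (by norm_num)
    (fun i => (χ i).comp (torsionKer G 2).subtype)
    (fun s hs => Subtype.ext (hinj s hs)) (fun i s => by
      rw [← map_pow, show s ^ 2 = 1 from Subtype.ext s.2, map_one])).2 (by simpa using hle)
      (fun _ => -1) (by simp)
  obtain ⟨i, hi⟩ := hU s
  have h1 := hs i
  simp only [MonoidHom.comp_apply, Subgroup.subtype_apply, hi] at h1
  have := congrArg Units.val h1
  norm_num at this

/-- The squares of the elements of order dividing `4`. -/
abbrev squaresOfFourTorsion (G : Type*) [CommGroup G] : Subgroup G :=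
  (torsionKer G 4).map (powMonoidHom 2)

/-- Squaring on the 4-torsion has the 2-torsion as its kernel. -/
theorem card_squaresOfFourTorsion [Finite G] :
    Nat.card (squaresOfFourTorsion G) * Nat.card (torsionKer G 2) = Nat.card (torsionKer G 4) := by
  have hle : torsionKer G 2 ≤ torsionKer G 4 := fun g hg => by
    rw [mem_torsionKer] at hg ⊢
    rw [show 4 = 2 * 2 from rfl, pow_mul, hg, one_pow]
  have h1 := Subgroup.relIndex_ker (K := torsionKer G 4) (powMonoidHom 2 : G →* G)
  rw [squaresOfFourTorsion, ← h1, mul_comm]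
  simpa using Subgroup.relIndex_mul_relIndex ⊥ (torsionKer G 2) (torsionKer G 4) bot_le hle

/-- The number of factors `C₄` plus the number of factors `C₃` is at most three. -/
theorem add_le_three_of_characters [Finite G] (hU : ∀ g, ∃ i, χ i g = 1)
    (hinj : ∀ g, (∀ i, χ i g = 1) → g = 1)
    (hχ : ∀ i, (∀ g, χ i g ^ 4 = 1) ∨ (∀ g, χ i g ^ 6 = 1)) {b e : ℕ}
    (hb : Nat.card (torsionKer G 4) = 2 ^ b * Nat.card (torsionKer G 2))
    (he : Nat.card (torsionKer G 3) = 3 ^ e) : b + e ≤ 3 := by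
  classical
  -- Elements of order 3 are invisible to the coordinates in `p`, squares of 4-torsion to the
  -- others. So `e` and `b` are bounded by the sizes of complementary sets of coordinates.
  let p : Fin 4 → Prop := fun i => ∀ g, χ i g ^ 4 = 1
  have hP : Nat.card (squaresOfFourTorsion G) = 2 ^ b := by
    have := card_squaresOfFourTorsion (G := G)
    rw [hb] at this
    exact Nat.eq_of_mul_eq_mul_right Nat.card_pos this
  have hnp : ∀ i, ¬ p i → ∀ g, χ i g ^ 6 = 1 := fun i hi => (hχ i).resolve_left hi
  have hp3 : ∀ i, p i → ∀ g, g ^ 3 = 1 → χ i g = 1 := by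
    intro i hi g hg
    have h1 := hi g
    rw [pow_succ, ← map_pow, hg, map_one, one_mul] at h1
    exact h1
  have hnp4 : ∀ i, ¬ p i → ∀ g, g ^ 4 = 1 → χ i g ^ 2 = 1 := by
    intro i hi g hg
    have h1 := hnp i hi g
    rw [show 6 = 4 + 2 from rfl, pow_add, ← map_pow, hg, map_one, one_mul] at h1
    exact h1
  have hJ := card_le_of_separating (m := 3) (by norm_num)
    (fun i : {i // ¬ p i} => (χ i).comp (torsionKer G 3).subtype)
    (fun s hs => Subtype.ext (hinj s fun i => by
      by_cases hi : p i
      · exact hp3 i hi s s.2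
      · exact hs ⟨i, hi⟩)) (fun i s => by
      rw [← map_pow, show s ^ 3 = 1 from Subtype.ext s.2, map_one])
  have hI := card_le_of_separating (m := 2) (by norm_num)
    (fun i : {i // p i} => (χ i).comp (squaresOfFourTorsion G).subtype)
    (fun s hs => Subtype.ext (hinj s fun i => by
      by_cases hi : p i
      · exact hs ⟨i, hi⟩
      · obtain ⟨_, c, hc, rfl⟩ := s
        change χ i (c ^ 2) = 1
        rw [map_pow]
        exact hnp4 i hi c hc)) (by
      rintro i ⟨_, c, hc, rfl⟩
      change χ i (c ^ 2) ^ 2 = 1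
      rw [← map_pow, ← pow_mul, show c ^ (2 * 2) = 1 from hc, map_one])
  rw [he] at hJ
  rw [hP] at hI
  have hsum : Fintype.card {i // p i} + Fintype.card {i // ¬ p i} = 4 := by
    have := Fintype.card_subtype_compl p
    have h2 := Fintype.card_subtype_le p
    rw [Fintype.card_fin] at this h2
    omega
  have hb' := (Nat.pow_le_pow_iff_right (by norm_num)).1 hI.1
  have he' := (Nat.pow_le_pow_iff_right (by norm_num)).1 hJ.1
  by_contra! hlt
  -- If both bounds are attained, some `s` has value `w` on every coordinate outside `p` and some `c
  -- ^ 2` has value `-1` on every coordinate in `p`; then `c * s` has no fixed vector.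
  obtain ⟨w, hw, hw'⟩ := exists_units_pow_eq_one_ne_one (m := 3) (by norm_num)
  obtain ⟨s, hs⟩ := hJ.2 (Nat.pow_le_pow_right (by norm_num) (by omega)) (fun _ => w) (fun _ => hw)
  obtain ⟨⟨_, c, hc, rfl⟩, ht⟩ := hI.2 (Nat.pow_le_pow_right (by norm_num) (by omega))
    (fun _ => -1) (by simp)
  have hc4 : c ^ 4 = 1 := hc
  obtain ⟨i, hi⟩ := hU (c * s)
  have h2 : χ i c ^ 2 * χ i s ^ 2 = 1 := by rw [← mul_pow, ← map_mul, hi, one_pow]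
  by_cases hpi : p i
  · have h3 : χ i (c ^ 2) = -1 := ht ⟨i, hpi⟩
    rw [← map_pow, h3, hp3 i hpi s s.2] at h2
    have := congrArg Units.val h2
    norm_num at this
  · have h3 : χ i s = w := hs ⟨i, hpi⟩
    rw [hnp4 i hpi c hc4, one_mul, h3] at h2
    exact hw' 2 (by norm_num) (by norm_num) h2

end Characters
end Hyperelliptic

namespace Hyperelliptic

/-! ### Products of cyclic groups, torsion counts and primary decompositions. -/

section Lists

/-- A product of cyclic groups splits off its first factor. -/
def consEquiv (x : ℕ) (L : List ℕ) :
    CyclicProduct (x :: L) ≃* Multiplicative (ZMod x) × CyclicProduct L where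
  toFun f := (f (0 : Fin (L.length + 1)), fun i => f i.succ)
  invFun p := Fin.cons (α := fun i : Fin (L.length + 1) => Multiplicative (ZMod ((x :: L).get i)))
    p.1 p.2
  left_inv f := Fin.cons_self_tail (n := L.length)
    (α := fun i : Fin (L.length + 1) => Multiplicative (ZMod ((x :: L).get i))) f
  right_inv _ := rfl
  map_mul' _ _ := rfl

/-- The factors of a triple product can be interchanged. -/
def prodLeftComm (A B C : Type*) [Mul A] [Mul B] [Mul C] : A × B × C ≃* B × A × C where
  toFun p := (p.2.1, p.1, p.2.2)
  invFun p := (p.2.1, p.1, p.2.2)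
  left_inv _ := rfl
  right_inv _ := rfl
  map_mul' _ _ := rfl

/-- Permuting the factors of a product of cyclic groups. -/
theorem nonempty_mulEquiv_of_perm {L L' : List ℕ} (h : L.Perm L') :
    Nonempty (CyclicProduct L ≃* CyclicProduct L') := by
  induction h with
  | nil => exact ⟨MulEquiv.refl _⟩
  | cons x _ ih =>
    obtain ⟨e⟩ := ih
    exact ⟨(consEquiv _ _).trans (((MulEquiv.refl _).prodCongr e).trans (consEquiv _ _).symm)⟩
  | swap x y L =>
    exact ⟨((consEquiv _ _).trans ((MulEquiv.refl _).prodCongr (consEquiv _ _))).trans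
      ((prodLeftComm (Multiplicative (ZMod y)) (Multiplicative (ZMod x)) (CyclicProduct L)).trans
        ((consEquiv _ _).trans ((MulEquiv.refl _).prodCongr (consEquiv _ _))).symm)⟩
  | trans _ _ ih ih' =>
    obtain ⟨e⟩ := ih
    obtain ⟨e'⟩ := ih'
    exact ⟨e.trans e'⟩

theorem nonempty_mulEquiv_filter_ne_one (L : List ℕ) :
    Nonempty (CyclicProduct L ≃* CyclicProduct (L.filter (· ≠ 1))) := by
  induction L with
  | nil => exact ⟨MulEquiv.refl _⟩
  | cons x L ih =>
    obtain ⟨e⟩ := ih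
    by_cases hx : x = 1
    · subst hx
      have : Unique (Multiplicative (ZMod 1)) := inferInstanceAs (Unique (Fin 1))
      rw [List.filter_cons_of_neg (by simp)]
      exact ⟨(consEquiv _ _).trans (MulEquiv.uniqueProd.trans e)⟩
    · rw [List.filter_cons_of_pos (by simpa using hx)]
      exact ⟨(consEquiv _ _).trans (((MulEquiv.refl _).prodCongr e).trans (consEquiv _ _).symm)⟩

theorem exists_injective_zmod {x y : ℕ} (h : x ∣ y) (hy : y ≠ 0) :
    ∃ f : Multiplicative (ZMod x) →* Multiplicative (ZMod y), Function.Injective f := by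
  obtain ⟨k, rfl⟩ := h
  have hk : k ≠ 0 := fun h => hy (by simp [h])
  have hx : x ≠ 0 := fun h => hy (by simp [h])
  let f : ZMod x →+ ZMod (x * k) := ZMod.lift x
    ⟨(zmultiplesHom (ZMod (x * k))) (k : ZMod (x * k)), by
      simp only [zmultiplesHom_apply, natCast_zsmul, nsmul_eq_mul]
      exact_mod_cast ZMod.natCast_self (x * k)⟩
  have hf : Function.Injective f := by
    rw [ZMod.lift_injective]
    intro m hm
    simp only [zmultiplesHom_apply, zsmul_eq_mul] at hm
    have h1 : ((m * k : ℤ) : ZMod (x * k)) = 0 := by exact_mod_cast hm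
    rw [ZMod.intCast_zmod_eq_zero_iff_dvd] at h1 ⊢
    push_cast at h1
    exact Int.dvd_of_mul_dvd_mul_right (by exact_mod_cast hk) h1
  exact ⟨AddMonoidHom.toMultiplicative f, hf⟩

theorem exists_injective_of_sublistForall {L L' : List ℕ} (h : List.SublistForall₂ (· ∣ ·) L L')
    (hL : ∀ l ∈ L', l ≠ 0) :
    ∃ f : CyclicProduct L →* CyclicProduct L', Function.Injective f := by
  induction h with
  | nil => exact ⟨1, fun a b _ => Subsingleton.elim (α := (i : Fin 0) → _) a b⟩
  | cons hab _ ih =>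
    obtain ⟨f, hf⟩ := ih fun l hl => hL l (List.mem_cons_of_mem _ hl)
    obtain ⟨g, hg⟩ := exists_injective_zmod hab (hL _ List.mem_cons_self)
    refine ⟨(consEquiv _ _).symm.toMonoidHom.comp
      ((g.prodMap f).comp (consEquiv _ _).toMonoidHom), ?_⟩
    exact (consEquiv _ _).symm.injective.comp ((hg.prodMap hf).comp (consEquiv _ _).injective)
  | cons_right _ ih =>
    obtain ⟨f, hf⟩ := ih fun l hl => hL l (List.mem_cons_of_mem _ hl)
    refine ⟨(consEquiv _ _).symm.toMonoidHom.comp ((MonoidHom.inr _ _).comp f), ?_⟩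
    exact (consEquiv _ _).symm.injective.comp
      ((Prod.mk_right_injective _).comp hf)

/-- The number of elements of order dividing `n` in a product of cyclic groups. -/
def torsionCount (n : ℕ) (L : List ℕ) : ℕ :=
  (L.map fun l => l.gcd n).prod

theorem finite_cyclicProduct {L : List ℕ} (hL : ∀ l ∈ L, l ≠ 0) : Finite (CyclicProduct L) := by
  have : ∀ i : Fin L.length, NeZero (L.get i) := fun i => ⟨hL _ (List.get_mem _ _)⟩
  have : ∀ i : Fin L.length, Finite (Multiplicative (ZMod (L.get i))) := fun i =>
    inferInstanceAs (Finite (ZMod (L.get i)))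
  infer_instance

theorem card_torsionKer_le {G K : Type*} [CommGroup G] [CommGroup K] [Finite K] {f : G →* K}
    (hf : Function.Injective f) (n : ℕ) :
    Nat.card (torsionKer G n) ≤ Nat.card (torsionKer K n) :=
  Nat.card_le_card_of_injective
    (fun g : torsionKer G n => (⟨f g, by
      rw [mem_torsionKer, ← map_pow, mem_torsionKer.1 g.2, map_one]⟩ : torsionKer K n))
    (fun g h hgh => Subtype.ext (hf (congrArg Subtype.val hgh)))

theorem card_torsionKer_congr {G K : Type*} [CommGroup G] [CommGroup K] (e : G ≃* K) (n : ℕ) :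
    Nat.card (torsionKer G n) = Nat.card (torsionKer K n) :=
  Nat.card_congr (e.toEquiv.subtypeEquiv fun g => by
    change g ∈ torsionKer G n ↔ e g ∈ torsionKer K n
    rw [mem_torsionKer, mem_torsionKer, ← map_pow, EmbeddingLike.map_eq_one_iff])

theorem card_torsionKer_prod (G K : Type*) [CommGroup G] [CommGroup K] (n : ℕ) :
    Nat.card (torsionKer (G × K) n) = Nat.card (torsionKer G n) * Nat.card (torsionKer K n) := by
  rw [← Nat.card_prod]
  refine Nat.card_congr ⟨fun x => (⟨x.1.1, congrArg Prod.fst x.2⟩, ⟨x.1.2, congrArg Prod.snd x.2⟩),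
    fun y => ⟨(y.1.1, y.2.1), Prod.ext y.1.2 y.2.2⟩, fun x => rfl, fun y => rfl⟩

theorem card_torsionKer_cyclicProduct {L : List ℕ} (hL : ∀ l ∈ L, l ≠ 0) (n : ℕ) :
    Nat.card (torsionKer (CyclicProduct L) n) = torsionCount n L := by
  induction L with
  | nil =>
    have : Subsingleton (CyclicProduct []) :=
      ⟨fun a b => Subsingleton.elim (α := (i : Fin 0) → _) a b⟩
    rw [Nat.card_unique]
    rfl
  | cons x L ih =>
    have : NeZero x := ⟨hL _ List.mem_cons_self⟩
    have : Finite (Multiplicative (ZMod x)) := inferInstanceAs (Finite (ZMod x))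
    rw [card_torsionKer_congr (consEquiv x L), card_torsionKer_prod,
      ih fun l hl => hL l (List.mem_cons_of_mem _ hl), IsCyclic.card_powMonoidHom_ker]
    have : Nat.card (Multiplicative (ZMod x)) = x := Nat.card_zmod x
    rw [this]
    rfl

theorem pow_eq_one_of_forall_dvd {L : List ℕ} {N : ℕ} (h : ∀ l ∈ L, l ∣ N)
    (g : CyclicProduct L) : g ^ N = 1 := by
  funext i
  have h1 : (N : ZMod (L.get i)) = 0 := (ZMod.natCast_eq_zero_iff _ _).2 (h _ (List.get_mem _ _))
  change N • (Multiplicative.toAdd (g i)) = 0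
  rw [nsmul_eq_mul, h1, zero_mul]

theorem dvd_of_forall_pow_eq_one {L : List ℕ} {N : ℕ} (h : ∀ g : CyclicProduct L, g ^ N = 1) :
    ∀ l ∈ L, l ∣ N := by
  intro l hl
  obtain ⟨i, rfl⟩ := List.get_of_mem hl
  have h1 := congrFun (h fun i => Multiplicative.ofAdd 1) i
  rw [← ZMod.natCast_eq_zero_iff]
  have h2 : N • (1 : ZMod (L.get i)) = 0 := h1
  simpa using h2

/-- The list with `a, b, c, e, f, g, h` entries `2, 4, 8, 3, 9, 5, 7`. -/
def primaryList (a b c e f g h : ℕ) : List ℕ :=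
  List.replicate a 2 ++ List.replicate b 4 ++ List.replicate c 8 ++ List.replicate e 3 ++
    List.replicate f 9 ++ List.replicate g 5 ++ List.replicate h 7

/-- `2520 = 2³ · 3² · 5 · 7` is the least common multiple of the orders `d` with `φ(d) ≤ 6`. -/
theorem primePow_dvd_cases {p e : ℕ} (hp : p.Prime) (h : p ^ e ∣ 2520) (h1 : p ^ e ≠ 1) :
    p ^ e ∈ [2, 4, 8, 3, 9, 5, 7] := by
  have he : e ≠ 0 := by rintro rfl; exact h1 rfl
  have hp2 : p ∣ 2520 := (dvd_pow_self p he).trans h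
  have : p = 2 ∨ p = 3 ∨ p = 5 ∨ p = 7 := by
    rw [show 2520 = 2 ^ 3 * 3 ^ 2 * 5 * 7 by norm_num, hp.dvd_mul, hp.dvd_mul, hp.dvd_mul] at hp2
    rcases hp2 with ((h | h) | h) | h
    · exact Or.inl ((Nat.prime_dvd_prime_iff_eq hp Nat.prime_two).1 (hp.dvd_of_dvd_pow h))
    · exact Or.inr (Or.inl ((Nat.prime_dvd_prime_iff_eq hp Nat.prime_three).1
        (hp.dvd_of_dvd_pow h)))
    · exact Or.inr (Or.inr (Or.inl ((Nat.prime_dvd_prime_iff_eq hp Nat.prime_five).1 h)))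
    · exact Or.inr (Or.inr (Or.inr ((Nat.prime_dvd_prime_iff_eq hp (by norm_num)).1 h)))
  have hbound : ∀ k, ¬ p ^ k ∣ 2520 → e < k := by
    intro k hk
    by_contra! hle
    exact hk ((pow_dvd_pow p hle).trans h)
  rcases this with rfl | rfl | rfl | rfl
  · have := hbound 4 (by norm_num)
    interval_cases e <;> simp_all
  · have := hbound 3 (by norm_num)
    interval_cases e <;> simp_all
  · have := hbound 2 (by norm_num)
    interval_cases e <;> simp_all
  · have := hbound 2 (by norm_num)
    interval_cases e <;> simp_all

theorem exists_primePow_list (G : Type*) [CommGroup G] [Finite G] :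
    ∃ L : List ℕ, (∀ l ∈ L, ∃ p e, p.Prime ∧ l = p ^ e) ∧ Nonempty (G ≃* CyclicProduct L) := by
  obtain ⟨ι, _, p, hp, n, ⟨e⟩⟩ := AddCommGroup.equiv_directSum_zmod_of_finite (Additive G)
  let E : Fin (Fintype.card ι) ≃ ι := (Fintype.equivFin ι).symm
  let L := List.ofFn fun i => p (E i) ^ n (E i)
  have hlen : L.length = Fintype.card ι := List.length_ofFn
  let E' : Fin L.length ≃ ι := (finCongr hlen).trans E
  have hE' : ∀ i, L.get i = p (E' i) ^ n (E' i) := fun i => by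
    simp only [L, E', List.get_eq_getElem, List.getElem_ofFn]
    rfl
  refine ⟨L, ?_, ?_⟩
  · intro l hl
    obtain ⟨i, rfl⟩ := List.get_of_mem hl
    exact ⟨_, _, hp (E' i), hE' i⟩
  · have e1 : Additive G ≃+ ((i : ι) → ZMod (p i ^ n i)) := e.trans (DirectSum.addEquivProd _)
    have e2 : ((i : ι) → ZMod (p i ^ n i)) ≃+ ((i : Fin L.length) → ZMod (L.get i)) :=
      { Equiv.symm (E'.piCongr fun i => (ZMod.ringEquivCongr (hE' i)).toEquiv) with
        map_add' := fun x y => by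
          funext i
          exact map_add (ZMod.ringEquivCongr (hE' i)).symm (x (E' i)) (y (E' i)) }
    exact ⟨(MulEquiv.toAdditive.symm ((e1.trans e2).trans
      (AddEquiv.refl _ : _ ≃+ Additive (CyclicProduct L))))⟩

theorem exists_mulEquiv_primaryList (G : Type*) [CommGroup G] [Finite G]
    (hG : ∀ g : G, g ^ 2520 = 1) :
    ∃ a b c e f g h, Nonempty (G ≃* CyclicProduct (primaryList a b c e f g h)) := by
  obtain ⟨L, hL, ⟨e⟩⟩ := exists_primePow_list G
  obtain ⟨e'⟩ := nonempty_mulEquiv_filter_ne_one L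
  set M := L.filter (· ≠ 1) with hM
  have hMG : ∀ g : CyclicProduct M, g ^ 2520 = 1 := by
    intro g
    have h1 := hG ((e.trans e').symm g)
    rw [← map_pow, EmbeddingLike.map_eq_one_iff] at h1
    exact h1
  have hmem : ∀ l ∈ M, l ∈ [2, 4, 8, 3, 9, 5, 7] := by
    intro l hl
    have hdvd := dvd_of_forall_pow_eq_one hMG l hl
    rw [hM, List.mem_filter] at hl
    obtain ⟨p, k, hp, rfl⟩ := hL l hl.1
    exact primePow_dvd_cases hp hdvd (by simpa using hl.2)
  have hperm : M.Perm (primaryList (M.count 2) (M.count 4) (M.count 8) (M.count 3) (M.count 9)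
      (M.count 5) (M.count 7)) := by
    rw [List.perm_iff_count]
    intro l
    by_cases hl : l ∈ M
    · have := hmem l hl
      simp only [List.mem_cons, List.not_mem_nil, or_false] at this
      rcases this with rfl | rfl | rfl | rfl | rfl | rfl | rfl <;>
        simp [primaryList, List.count_append, List.count_replicate]
    · rw [List.count_eq_zero_of_not_mem hl, eq_comm, List.count_eq_zero]
      intro h
      simp only [primaryList, List.mem_append, List.mem_replicate] at h
      rcases h with (((((h | h) | h) | h) | h) | h) | h <;>
        · obtain ⟨h1, rfl⟩ := h
          exact hl (List.count_pos_iff.1 (Nat.pos_of_ne_zero h1))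
  obtain ⟨e''⟩ := nonempty_mulEquiv_of_perm hperm
  exact ⟨_, _, _, _, _, _, _, ⟨(e.trans e').trans e''⟩⟩

end Lists
end Hyperelliptic

namespace Hyperelliptic

/-! ### Finite checks on the table. -/

section Table

/-- The prime powers used to tell the groups of the table apart. -/
abbrev testPowers : List ℕ := [2, 4, 8, 3, 9, 5, 7]

theorem dvd_of_mem_primaryList {a b c e f g h l : ℕ} (hl : l ∈ primaryList a b c e f g h) :
    l ∣ 2520 := by
  simp only [primaryList, List.mem_append, List.mem_replicate] at hl
  rcases hl with (((((hl | hl) | hl) | hl) | hl) | hl) | hl <;> rw [hl.2] <;> norm_num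

theorem ne_zero_of_forall_dvd {L : List ℕ} (hL : ∀ l ∈ L, l ∣ 2520) : ∀ l ∈ L, l ≠ 0 := by
  intro l hl h0
  have := hL l hl
  rw [h0] at this
  omega

theorem torsionCount_primaryList (n a b c e f g h : ℕ) :
    torsionCount n (primaryList a b c e f g h) = Nat.gcd 2 n ^ a * Nat.gcd 4 n ^ b *
      Nat.gcd 8 n ^ c * Nat.gcd 3 n ^ e * Nat.gcd 9 n ^ f * Nat.gcd 5 n ^ g * Nat.gcd 7 n ^ h := by
  simp [torsionCount, primaryList, mul_assoc]

/-- The exponents of a primary decomposition are determined by the torsion counts. -/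
theorem primaryList_injective {a b c e f g h a' b' c' e' f' g' h' : ℕ}
    (H : ∀ n ∈ testPowers, torsionCount n (primaryList a b c e f g h) =
      torsionCount n (primaryList a' b' c' e' f' g' h')) :
    primaryList a b c e f g h = primaryList a' b' c' e' f' g' h' := by
  simp only [torsionCount_primaryList, List.forall_mem_cons, List.not_mem_nil, false_implies,
    implies_true, and_true] at H
  norm_num at H
  obtain ⟨h2, h4, h8, h3, h9, h5, h7⟩ := H
  -- With every factor a power of 2 or of 3, the equalities become linear equations in the
  -- exponents.
  have e4 : (4 : ℕ) = 2 ^ 2 := rfl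
  have e8 : (8 : ℕ) = 2 ^ 3 := rfl
  have e9 : (9 : ℕ) = 3 ^ 2 := rfl
  simp only [e4, e8, e9, ← pow_mul, ← pow_add] at h2 h4 h8 h3 h9
  have h2 := Nat.pow_right_injective le_rfl h2
  have h4 := Nat.pow_right_injective le_rfl h4
  have h8 := Nat.pow_right_injective le_rfl h8
  have h3 := Nat.pow_right_injective (by norm_num) h3
  have h9 := Nat.pow_right_injective (by norm_num) h9
  obtain rfl : a = a' := by omega
  obtain rfl : b = b' := by omega
  obtain rfl : c = c' := by omega
  obtain rfl : e = e' := by omega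
  obtain rfl : f = f' := by omega
  rw [h5, h7]

/-- Groups of exponent dividing `2520` are determined by their torsion counts. -/
theorem nonempty_mulEquiv_of_card_torsionKer {G K : Type*} [CommGroup G] [CommGroup K] [Finite G]
    [Finite K] (hG : ∀ g : G, g ^ 2520 = 1) (hK : ∀ g : K, g ^ 2520 = 1)
    (H : ∀ n ∈ testPowers, Nat.card (torsionKer G n) = Nat.card (torsionKer K n)) :
    Nonempty (G ≃* K) := by
  obtain ⟨a, b, c, e, f, g, h, ⟨E⟩⟩ := exists_mulEquiv_primaryList G hG
  obtain ⟨a', b', c', e', f', g', h', ⟨E'⟩⟩ := exists_mulEquiv_primaryList K hK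
  have hL : primaryList a b c e f g h = primaryList a' b' c' e' f' g' h' :=
    primaryList_injective fun n hn => by
    rw [← card_torsionKer_cyclicProduct (ne_zero_of_forall_dvd fun _ => dvd_of_mem_primaryList),
      ← card_torsionKer_congr E, H n hn, card_torsionKer_congr E',
      card_torsionKer_cyclicProduct (ne_zero_of_forall_dvd fun _ => dvd_of_mem_primaryList)]
  rw [hL] at E
  exact ⟨E.trans E'.symm⟩

theorem nonempty_mulEquiv_of_torsionCount {L M : List ℕ} (hL : ∀ l ∈ L, l ∣ 2520)
    (hM : ∀ l ∈ M, l ∣ 2520) (h : ∀ n ∈ testPowers, torsionCount n L = torsionCount n M) :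
    Nonempty (CyclicProduct L ≃* CyclicProduct M) := by
  have := finite_cyclicProduct (ne_zero_of_forall_dvd hL)
  have := finite_cyclicProduct (ne_zero_of_forall_dvd hM)
  refine nonempty_mulEquiv_of_card_torsionKer (pow_eq_one_of_forall_dvd hL)
    (pow_eq_one_of_forall_dvd hM) fun n hn => ?_
  rw [card_torsionKer_cyclicProduct (ne_zero_of_forall_dvd hL),
    card_torsionKer_cyclicProduct (ne_zero_of_forall_dvd hM), h n hn]

theorem dvd_of_mem_abelianTable : ∀ d ∈ abelianTable, ∀ l ∈ d, l ∣ 2520 := by decide +kernel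

theorem torsionCount_eq_of_mulEquiv {L M : List ℕ} (hL : ∀ l ∈ L, l ≠ 0) (hM : ∀ l ∈ M, l ≠ 0)
    (e : CyclicProduct L ≃* CyclicProduct M) (n : ℕ) : torsionCount n L = torsionCount n M := by
  rw [← card_torsionKer_cyclicProduct hL, card_torsionKer_congr e,
    card_torsionKer_cyclicProduct hM]

theorem pairwise_abelianTable : abelianTable.Pairwise (fun d e =>
    ¬ Nonempty (CyclicProduct d ≃* CyclicProduct e)) := by
  have h : abelianTable.Pairwise (fun d e =>
      ¬ ∀ n ∈ testPowers, torsionCount n d = torsionCount n e) := by decide +kernel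
  refine h.imp_of_mem fun {d e} hd he hne ⟨f⟩ => hne fun n _ => ?_
  exact torsionCount_eq_of_mulEquiv (ne_zero_of_forall_dvd (dvd_of_mem_abelianTable d hd))
    (ne_zero_of_forall_dvd (dvd_of_mem_abelianTable e he)) f n

theorem maximalTable_subset : ∀ m ∈ maximalTable, m ∈ abelianTable := by decide

/-- A Boolean test for `List.SublistForall₂ (· ∣ ·)`. -/
def embedsComponentwise : List ℕ → List ℕ → Bool
  | [], _ => true
  | _ :: _, [] => false
  | a :: L, b :: M =>
    (decide (a ∣ b) && embedsComponentwise L M) || embedsComponentwise (a :: L) M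

theorem sublistForall_of_embedsComponentwise {L M : List ℕ} (h : embedsComponentwise L M = true) :
    List.SublistForall₂ (· ∣ ·) L M := by
  induction M generalizing L with
  | nil =>
    cases L with
    | nil => exact .nil
    | cons a L => simp [embedsComponentwise] at h
  | cons b M ih =>
    cases L with
    | nil => exact .nil
    | cons a L =>
      simp only [embedsComponentwise, Bool.or_eq_true, Bool.and_eq_true, decide_eq_true_eq] at h
      rcases h with ⟨h1, h2⟩ | h
      · exact .cons h1 (ih h2)
      · exact .cons_right (ih h)

theorem exists_injective_of_embedsComponentwise {L M : List ℕ} (hM : ∀ l ∈ M, l ∣ 2520)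
    (h : embedsComponentwise L M = true) :
    ∃ f : CyclicProduct L →* CyclicProduct M, Function.Injective f :=
  exists_injective_of_sublistForall (sublistForall_of_embedsComponentwise h)
    (ne_zero_of_forall_dvd hM)

theorem exists_embedding_maximalTable : ∀ d ∈ abelianTable, ∃ m ∈ maximalTable,
    ∃ f : CyclicProduct d →* CyclicProduct m, Function.Injective f := by
  have h : ∀ d ∈ abelianTable, ∃ m ∈ maximalTable, embedsComponentwise d m = true := by
    decide +kernel
  intro d hd
  obtain ⟨m, hm, hdm⟩ := h d hd
  exact ⟨m, hm, exists_injective_of_embedsComponentwise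
    (dvd_of_mem_abelianTable m (maximalTable_subset m hm)) hdm⟩

/-- An embedding respects torsion counts and exponents. Counts alone do not suffice: those of `C₁₈`
are bounded by those of `C₃ × C₆ × C₆`. -/
theorem eq_of_injective_of_mem_maximalTable : ∀ m ∈ maximalTable, ∀ d ∈ abelianTable,
    (∃ f : CyclicProduct m →* CyclicProduct d, Function.Injective f) → d = m := by
  have h : ∀ m ∈ maximalTable, ∀ d ∈ abelianTable, (∀ l ∈ d, l ∣ d.foldr Nat.lcm 1) ∧
      ((∀ l ∈ m, l ∣ d.foldr Nat.lcm 1) →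
        (∀ n ∈ testPowers, torsionCount n m ≤ torsionCount n d) → d = m) := by
    decide +kernel
  rintro m hm d hd ⟨f, hf⟩
  obtain ⟨h1, h2⟩ := h m hm d hd
  have hd0 := ne_zero_of_forall_dvd (dvd_of_mem_abelianTable d hd)
  have hm0 := ne_zero_of_forall_dvd (dvd_of_mem_abelianTable m (maximalTable_subset m hm))
  have := finite_cyclicProduct hd0
  refine h2 (dvd_of_forall_pow_eq_one fun g => hf ?_) fun n _ => ?_
  · rw [map_pow, map_one]
    exact pow_eq_one_of_forall_dvd h1 _
  · rw [← card_torsionKer_cyclicProduct hm0, ← card_torsionKer_cyclicProduct hd0]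
    exact card_torsionKer_le hf n

/-- Whether the table contains a group with the same torsion counts. -/
def inTable (L : List ℕ) : Prop :=
  ∃ d ∈ abelianTable, ∀ n ∈ testPowers, torsionCount n L = torsionCount n d

instance (L : List ℕ) : Decidable (inTable L) :=
  inferInstanceAs (Decidable (∃ d ∈ abelianTable, _))

theorem exists_mulEquiv_of_inTable {L : List ℕ} (hL : ∀ l ∈ L, l ∣ 2520) (h : inTable L) :
    ∃ d ∈ abelianTable, Nonempty (CyclicProduct L ≃* CyclicProduct d) := by
  obtain ⟨d, hd, h⟩ := h
  exact ⟨d, hd, nonempty_mulEquiv_of_torsionCount hL (dvd_of_mem_abelianTable d hd) h⟩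

/-- The pairs `(d, e)` such that the subgroups of `C_d × C_e` come from three dimensions. -/
def rankTwoPairs : List (ℕ × ℕ) :=
  ([5, 8, 10, 12] ×ˢ [1, 2, 3, 4, 6]) ++ [(7, 1), (9, 1), (14, 1), (18, 1)]

theorem lcm_dvd_of_mem_rankTwoPairs : ∀ p ∈ rankTwoPairs, Nat.lcm p.1 p.2 ∣ 2520 := by
  decide +kernel

/-- Comparison of the torsion counts for the given orders. -/
def TorsionLE (L M ns : List ℕ) : Prop :=
  ∀ n ∈ ns, torsionCount n L ≤ torsionCount n M

instance (L M ns : List ℕ) : Decidable (TorsionLE L M ns) :=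
  inferInstanceAs (Decidable (∀ n ∈ ns, _))

-- The conditions for 2, for 3 and for 5 and 7 are interleaved with the quantifiers, so that each
-- prunes the search before the next exponents are enumerated.
set_option synthInstance.maxHeartbeats 400000 in
set_option synthInstance.maxSize 10000 in
theorem inTable_of_rankTwo : ∀ p ∈ rankTwoPairs, ∀ a < 3, ∀ b < 3, ∀ c < 3,
    TorsionLE (primaryList a b c 0 0 0 0) [p.1, p.2] [2, 4, 8] ∧
      (b ≠ 0 → 4 ∣ Nat.lcm p.1 p.2) ∧ (c ≠ 0 → 8 ∣ Nat.lcm p.1 p.2) → ∀ e < 3, ∀ f < 3,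
    TorsionLE (primaryList 0 0 0 e f 0 0) [p.1, p.2] [3, 9] ∧
      (f ≠ 0 → 9 ∣ Nat.lcm p.1 p.2) → ∀ g < 2, ∀ h < 2,
    TorsionLE (primaryList 0 0 0 0 0 g h) [p.1, p.2] [5, 7] ∧
      primaryList a b c e f g h ≠ [] → inTable (primaryList a b c e f g h) := by
  decide +kernel

theorem torsionCount_bound_of_rankTwo : ∀ p ∈ rankTwoPairs, torsionCount 2 [p.1, p.2] ≤ 2 ^ 2 ∧
    torsionCount 3 [p.1, p.2] ≤ 3 ^ 2 ∧ torsionCount 5 [p.1, p.2] ≤ 5 ^ 1 ∧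
    torsionCount 7 [p.1, p.2] ≤ 7 ^ 1 := by
  decide +kernel

theorem primaryList_ne_nil {G : Type*} [CommGroup G] [Nontrivial G] {a b c e f g h : ℕ}
    (E : G ≃* CyclicProduct (primaryList a b c e f g h)) : primaryList a b c e f g h ≠ [] := by
  intro h0
  rw [h0] at E
  have : Subsingleton (CyclicProduct []) :=
    ⟨fun a b => Subsingleton.elim (α := (i : Fin 0) → _) a b⟩
  exact not_subsingleton G E.toEquiv.subsingleton

/-- A group with the torsion bounds of a subgroup of `C_d × C_e` is in the table. -/
theorem exists_mulEquiv_of_rankTwo {G : Type*} [CommGroup G] [Finite G] [Nontrivial G]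
    {p : ℕ × ℕ} (hp : p ∈ rankTwoPairs) (hG : ∀ g : G, g ^ Nat.lcm p.1 p.2 = 1)
    (hcount : ∀ n, n ≠ 0 → Nat.card (torsionKer G n) ≤ torsionCount n [p.1, p.2]) :
    ∃ d ∈ abelianTable, Nonempty (G ≃* CyclicProduct d) := by
  have hN := lcm_dvd_of_mem_rankTwoPairs p hp
  obtain ⟨a, b, c, e, f, g, h, ⟨E⟩⟩ := exists_mulEquiv_primaryList G fun x => by
    obtain ⟨k, hk⟩ := hN
    rw [hk, pow_mul, hG, one_pow]
  have hdvd : ∀ l ∈ primaryList a b c e f g h, l ∣ Nat.lcm p.1 p.2 :=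
    dvd_of_forall_pow_eq_one fun x => by
      rw [← E.apply_symm_apply x, ← map_pow, hG, map_one]
  have H : ∀ n, n ≠ 0 → torsionCount n (primaryList a b c e f g h) ≤ torsionCount n [p.1, p.2] := by
    intro n hn
    rw [← card_torsionKer_cyclicProduct (ne_zero_of_forall_dvd fun _ => dvd_of_mem_primaryList),
      ← card_torsionKer_congr E]
    exact hcount n hn
  have h2 := H 2 (by norm_num)
  have h4 := H 4 (by norm_num)
  have h8 := H 8 (by norm_num)
  have h3 := H 3 (by norm_num)
  have h9 := H 9 (by norm_num)
  have h5 := H 5 (by norm_num)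
  have h7 := H 7 (by norm_num)
  rw [torsionCount_primaryList] at h2 h4 h8 h3 h9 h5 h7
  norm_num at h2 h4 h8 h3 h9 h5 h7
  obtain ⟨b2, b3, b5, b7⟩ := torsionCount_bound_of_rankTwo p hp
  have c2 := h2.trans b2
  have c3 := h3.trans b3
  have c5 := (Nat.pow_le_pow_iff_right (by norm_num)).1 (h5.trans b5)
  have c7 := (Nat.pow_le_pow_iff_right (by norm_num)).1 (h7.trans b7)
  rw [← pow_add, ← pow_add] at c2
  rw [← pow_add] at c3
  have c2 := (Nat.pow_le_pow_iff_right (by norm_num)).1 c2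
  have c3 := (Nat.pow_le_pow_iff_right (by norm_num)).1 c3
  have hT := inTable_of_rankTwo p hp a (by omega) b (by omega) c (by omega)
    ⟨by
      intro n hn
      fin_cases hn <;> rw [torsionCount_primaryList] <;> norm_num
      exacts [h2, h4, h8], fun hb => hdvd 4 (by simp [primaryList, hb]), fun hc => hdvd 8 (by simp [primaryList, hc])⟩
    e (by omega) f (by omega)
    ⟨by
      intro n hn
      fin_cases hn <;> rw [torsionCount_primaryList] <;> norm_num
      exacts [h3, h9], fun hf => hdvd 9 (by simp [primaryList, hf])⟩
    g (by omega) h (by omega)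
    ⟨by
      intro n hn
      fin_cases hn <;> rw [torsionCount_primaryList] <;> norm_num
      exacts [h5, h7], primaryList_ne_nil E⟩
  obtain ⟨d, hd, ⟨E'⟩⟩ := exists_mulEquiv_of_inTable (fun _ => dvd_of_mem_primaryList) hT
  exact ⟨d, hd, ⟨E.trans E'⟩⟩

-- The sum inequalities come from fixed vectors; `b < 3` removes `C₄³`, and the negated conjunction
-- removes `C₆³`.
set_option synthInstance.maxHeartbeats 400000 in
set_option synthInstance.maxSize 10000 in
theorem inTable_of_exponent_twelve : ∀ a < 4, ∀ b < 3, ∀ e < 4, a + b ≤ 3 → b + e ≤ 3 →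
    ¬ (3 ≤ a + b ∧ 3 ≤ e) → primaryList a b 0 e 0 0 0 ≠ [] →
    inTable (primaryList a b 0 e 0 0 0) := by
  decide +kernel

end Table
end Hyperelliptic

namespace Hyperelliptic

/-! ### Hyperelliptic abelian groups belong to the table. -/

section Classification

theorem pow_dvd_of_totient_le_six {p k : ℕ} (hp : p.Prime) (h : (p ^ k).totient ≤ 6) :
    p ^ k ∣ 2520 := by
  rcases k with - | k
  · simp
  rw [Nat.totient_prime_pow_succ hp] at h
  have hp2 := hp.two_le
  have h1 : p - 1 ≤ 6 := le_trans (Nat.le_mul_of_pos_left _ (pow_pos hp.pos k)) h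
  have h2 : p ^ k ≤ 6 := le_trans (Nat.le_mul_of_pos_right _ (by omega)) h
  have h3 : k < 3 := by
    by_contra! hk
    have h4 : 2 ^ 3 ≤ p ^ k := (Nat.pow_le_pow_left hp2 3).trans (Nat.pow_le_pow_right hp.pos hk)
    omega
  have h5 : p ≤ 7 := by omega
  interval_cases p <;> interval_cases k <;> revert hp h <;> norm_num

/-- Checked on prime powers dividing `d`, whose totients divide `φ(d)`. -/
theorem dvd_of_totient_le_six {d : ℕ} (hd : d ≠ 0) (h : d.totient ≤ 6) : d ∣ 2520 := by
  rw [Nat.dvd_iff_prime_pow_dvd_dvd]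
  intro p k hp hk
  refine pow_dvd_of_totient_le_six hp (le_trans (Nat.le_of_dvd ?_ (Nat.totient_dvd_of_dvd hk)) h)
  exact Nat.totient_pos.2 (Nat.pos_of_ne_zero hd)

theorem totient_cases {d : ℕ} (hd : d ≠ 0) (h : d.totient ≤ 6) :
    (d.totient ≤ 2 → d ∈ [1, 2, 3, 4, 6]) ∧
    (3 ≤ d.totient → d.totient ≤ 4 → d ∈ [5, 8, 10, 12]) ∧
    (5 ≤ d.totient → d ∈ [7, 9, 14, 18]) := by
  have key : ∀ d ∈ Nat.divisors 2520, d.totient ≤ 6 → (d.totient ≤ 2 → d ∈ [1, 2, 3, 4, 6]) ∧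
      (3 ≤ d.totient → d.totient ≤ 4 → d ∈ [5, 8, 10, 12]) ∧
      (5 ≤ d.totient → d ∈ [7, 9, 14, 18]) := by decide +kernel
  exact key d (Nat.mem_divisors.2 ⟨dvd_of_totient_le_six hd h, by norm_num⟩) h

variable {G : Type*} [CommGroup G]

theorem apply_pow_orderOf (ψ : G →* ℂˣ) (g : G) : ψ g ^ orderOf ψ = 1 :=
  DFunLike.congr_fun (pow_orderOf_eq_one ψ) g

theorem apply_eq_one_of_zpowers_eq {ψ θ : G →* ℂˣ}
    (h : Subgroup.zpowers ψ = Subgroup.zpowers θ) {g : G} (hg : θ g = 1) : ψ g = 1 := by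
  have : ψ ∈ Subgroup.zpowers θ := h ▸ Subgroup.mem_zpowers ψ
  obtain ⟨k, hk⟩ := Subgroup.mem_zpowers_iff.1 this
  rw [← hk]
  change θ g ^ k = 1
  rw [hg, one_zpow]

/-- A group with two jointly faithful characters of orders `d` and `e` satisfies the torsion
bounds of `C_d × C_e`. -/
theorem card_torsionKer_le_of_two_characters {ψ θ : G →* ℂˣ} {d e : ℕ} (hd : d ≠ 0) (he : e ≠ 0)
    (hψ : ∀ g, ψ g ^ d = 1) (hθ : ∀ g, θ g ^ e = 1) (hinj : ∀ g, ψ g = 1 → θ g = 1 → g = 1)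
    (n : ℕ) : Nat.card (torsionKer G n) ≤ torsionCount n [d, e] := by
  have : NeZero (d.gcd n) := ⟨Nat.gcd_ne_zero_left hd⟩
  have : NeZero (e.gcd n) := ⟨Nat.gcd_ne_zero_left he⟩
  have hψ' : ∀ g : torsionKer G n, ψ g ^ d.gcd n = 1 := fun g =>
    pow_gcd_eq_one.2 ⟨hψ g, by rw [← map_pow, mem_torsionKer.1 g.2, map_one]⟩
  have hθ' : ∀ g : torsionKer G n, θ g ^ e.gcd n = 1 := fun g =>
    pow_gcd_eq_one.2 ⟨hθ g, by rw [← map_pow, mem_torsionKer.1 g.2, map_one]⟩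
  let F : torsionKer G n → rootsOfUnity (d.gcd n) ℂ × rootsOfUnity (e.gcd n) ℂ := fun g =>
    (⟨ψ g, hψ' g⟩, ⟨θ g, hθ' g⟩)
  have hF : Function.Injective F := by
    intro g k hgk
    have h1 : ψ g = ψ k := congrArg Subtype.val (congrArg Prod.fst hgk)
    have h2 : θ g = θ k := congrArg Subtype.val (congrArg Prod.snd hgk)
    refine Subtype.ext (mul_inv_eq_one.1 (hinj _ ?_ ?_))
    · rw [map_mul, map_inv, h1, mul_inv_cancel]
    · rw [map_mul, map_inv, h2, mul_inv_cancel]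
  refine (Nat.card_le_card_of_injective F hF).trans (le_of_eq ?_)
  rw [Nat.card_prod, Complex.card_rootsOfUnity, Complex.card_rootsOfUnity]
  simp [torsionCount]

theorem exists_mulEquiv_of_two_characters [Finite G] [Nontrivial G] {ψ θ : G →* ℂˣ} {d e : ℕ}
    (hp : (d, e) ∈ rankTwoPairs)
    (hψ : ∀ g, ψ g ^ d = 1) (hθ : ∀ g, θ g ^ e = 1) (hinj : ∀ g, ψ g = 1 → θ g = 1 → g = 1) :
    ∃ L ∈ abelianTable, Nonempty (G ≃* CyclicProduct L) := by
  have hlcm := lcm_dvd_of_mem_rankTwoPairs _ hp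
  have hd : d ≠ 0 := by
    rintro rfl
    simp at hlcm
  have he : e ≠ 0 := by
    rintro rfl
    simp at hlcm
  refine exists_mulEquiv_of_rankTwo hp (fun g => hinj _ ?_ ?_)
    (fun n _ => card_torsionKer_le_of_two_characters hd he hψ hθ hinj n)
  · obtain ⟨k, hk⟩ := Nat.dvd_lcm_left d e
    rw [map_pow]
    simp only [hk]
    rw [pow_mul, hψ, one_pow]
  · obtain ⟨k, hk⟩ := Nat.dvd_lcm_right d e
    rw [map_pow]
    simp only [hk]
    rw [pow_mul, hθ, one_pow]

theorem exists_mulEquiv_of_one_character [Finite G] [Nontrivial G] {ψ : G →* ℂˣ} {d : ℕ}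
    (hp : (d, 1) ∈ rankTwoPairs) (hψ : ∀ g, ψ g ^ d = 1) (hinj : ∀ g, ψ g = 1 → g = 1) :
    ∃ L ∈ abelianTable, Nonempty (G ≃* CyclicProduct L) :=
  exists_mulEquiv_of_two_characters (θ := 1) hp hψ (fun g => by simp) fun g hg _ => hinj g hg

/-- If a group is the union of three kernels, one of which belongs to a character of order at
least three, then one of the two others is the whole group. -/
theorem eq_one_or_eq_one_of_union {ψ θ η : G →* ℂˣ} (hU : ∀ g, ψ g = 1 ∨ θ g = 1 ∨ η g = 1)
    (hψ : ψ ^ 2 ≠ 1) : θ = 1 ∨ η = 1 := by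
  by_contra! hne
  obtain ⟨x, hx⟩ : ∃ x, θ x ≠ 1 := by
    by_contra! h
    exact hne.1 (MonoidHom.ext h)
  obtain ⟨y, hy⟩ : ∃ y, η y ≠ 1 := by
    by_contra! h
    exact hne.2 (MonoidHom.ext h)
  obtain ⟨t, ht⟩ : ∃ t, ψ t ^ 2 ≠ 1 := by
    by_contra! h
    exact hψ (MonoidHom.ext h)
  have ht1 : ψ t ≠ 1 := fun h => ht (by rw [h, one_pow])
  -- Two proper subgroups do not cover a group. Such an `h` lies in the kernel of `ψ`, so `t`, `t *
  -- h` and `t ^ 2 * h` all avoid that kernel; distributing them over the two other kernels is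
  -- contradictory.
  obtain ⟨h, hθ, hη⟩ : ∃ h, θ h ≠ 1 ∧ η h ≠ 1 := by
    by_cases h1 : η x = 1
    · by_cases h2 : θ y = 1
      · exact ⟨x * y, by rw [map_mul, h2, mul_one]; exact hx, by rw [map_mul, h1, one_mul]; exact hy⟩
      · exact ⟨y, h2, hy⟩
    · exact ⟨x, hx, h1⟩
  have hψh : ψ h = 1 := ((hU h).resolve_right (by tauto))
  have h1 := (hU t).resolve_left ht1
  have h2 := (hU (t * h)).resolve_left (by rw [map_mul, hψh, mul_one]; exact ht1)
  have h3 := (hU (t ^ 2 * h)).resolve_left (by rw [map_mul, hψh, mul_one, map_pow]; exact ht)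
  simp only [map_mul, map_pow] at h2 h3
  rcases h1 with h1 | h1
  · rw [h1, one_mul] at h2
    rw [h1, one_pow, one_mul] at h3
    have h2 := h2.resolve_left hθ
    have h3 := h3.resolve_left hθ
    rw [pow_two, mul_assoc, h2, mul_one] at h3
    rw [h3, one_mul] at h2
    exact hη h2
  · rw [h1, one_mul] at h2
    rw [h1, one_pow, one_mul] at h3
    have h2 := h2.resolve_right hη
    have h3 := h3.resolve_right hη
    rw [pow_two, mul_assoc, h2, mul_one] at h3
    rw [h3, one_mul] at h2
    exact hθ h2

theorem card_eq_torsionCount [Finite G] {L : List ℕ} (hL : ∀ l ∈ L, l ∣ 2520)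
    (E : G ≃* CyclicProduct L) {n : ℕ} (hn : ∀ g : G, g ^ n = 1) :
    Nat.card G = torsionCount n L := by
  rw [← card_torsionKer_cyclicProduct (ne_zero_of_forall_dvd hL), ← card_torsionKer_congr E]
  refine (Nat.card_congr (Equiv.subtypeUnivEquiv fun g => ?_)).symm
  exact hn g

variable {Λ : Submodule ℤ (Fin 4 → ℂ)} {χ : Fin 4 → G →* ℂˣ} {b : G → Fin 4 → ℂ}

/-- The case in which all characters have order dividing 4 or 6: the only one where fixed vectors
alone do not decide and translations enter. -/
theorem IsDiagonalAction.exists_mulEquiv_of_exponent [DiscreteTopology Λ]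
    [Finite G] [Nontrivial G] (h : IsDiagonalAction Λ χ b)
    (hχ : ∀ i, (∀ g, χ i g ^ 4 = 1) ∨ (∀ g, χ i g ^ 6 = 1)) :
    ∃ L ∈ abelianTable, Nonempty (G ≃* CyclicProduct L) := by
  have hU := h.exists_eq_one
  have h12 : ∀ g : G, g ^ 12 = 1 := by
    intro g
    refine h.faithful _ fun i => ?_
    rw [map_pow]
    rcases hχ i with h1 | h1
    · rw [show 12 = 4 * 3 from rfl, pow_mul, h1, one_pow]
    · rw [show 12 = 6 * 2 from rfl, pow_mul, h1, one_pow]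
  obtain ⟨a, m, c, e, f, g, k, ⟨E⟩⟩ := exists_mulEquiv_primaryList G fun x => by
    rw [show 2520 = 12 * 210 from rfl, pow_mul, h12, one_pow]
  have hdvd : ∀ l ∈ primaryList a m c e f g k, l ∣ 12 :=
    dvd_of_forall_pow_eq_one fun x => by
      rw [← E.apply_symm_apply x, ← map_pow, h12, map_one]
  have hne : ∀ l, ¬ l ∣ 12 → l ∉ primaryList a m c e f g k := fun l hl hmem => hl (hdvd l hmem)
  obtain rfl : c = 0 := by
    by_contra hc; exact hne 8 (by norm_num) (by simp [primaryList, hc])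
  obtain rfl : f = 0 := by
    by_contra hc; exact hne 9 (by norm_num) (by simp [primaryList, hc])
  obtain rfl : g = 0 := by
    by_contra hc; exact hne 5 (by norm_num) (by simp [primaryList, hc])
  obtain rfl : k = 0 := by
    by_contra hc; exact hne 7 (by norm_num) (by simp [primaryList, hc])
  have hcount : ∀ n, Nat.card (torsionKer G n) = torsionCount n (primaryList a m 0 e 0 0 0) := by
    intro n
    rw [card_torsionKer_congr E,
      card_torsionKer_cyclicProduct (ne_zero_of_forall_dvd fun _ => dvd_of_mem_primaryList)]
  have hc2 : Nat.card (torsionKer G 2) = 2 ^ (a + m) := by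
    rw [hcount, torsionCount_primaryList]; norm_num [pow_add]
  have hc4 : Nat.card (torsionKer G 4) = 2 ^ m * Nat.card (torsionKer G 2) := by
    rw [hc2, hcount, torsionCount_primaryList]
    norm_num [pow_add]
    rw [show (4 : ℕ) = 2 * 2 from rfl, mul_pow]
    ring
  have hc3 : Nat.card (torsionKer G 3) = 3 ^ e := by
    rw [hcount, torsionCount_primaryList]; norm_num
  have ham : a + m ≤ 3 := by
    have h1 := card_torsionKer_two_lt hU h.faithful
    rw [hc2, show 16 = 2 ^ 4 from rfl, Nat.pow_lt_pow_iff_right (by norm_num)] at h1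
    omega
  have hme : m + e ≤ 3 := add_le_three_of_characters hU h.faithful hχ hc4 hc3
  have hm : m < 3 := by
    by_contra! hm
    obtain rfl : m = 3 := by omega
    obtain rfl : a = 0 := by omega
    obtain rfl : e = 0 := by omega
    have hG : ∀ g : G, g ^ 4 = 1 := fun g => by
      rw [← EmbeddingLike.map_eq_one_iff (f := E), map_pow]
      exact pow_eq_one_of_forall_dvd (by decide) _
    obtain ⟨ζ, hζ⟩ : ∃ ζ : ℂˣ, (ζ : ℂ) ^ 2 = -1 :=
      ⟨Units.mk0 Complex.I Complex.I_ne_zero, by simp⟩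
    obtain ⟨i₀, hi₀, u, hu⟩ := exists_dual_elements_four hU h.faithful hG
      (by rw [card_eq_torsionCount (fun _ => dvd_of_mem_primaryList) E hG]; rfl) hc2
      (ζ := ζ) (by
        ext
        rw [Units.val_pow_eq_pow_val, show 4 = 2 * 2 from rfl, pow_mul, hζ]
        norm_num)
    exact h.not_isCubeAction_four rfl hi₀ hζ u hu
  have h33 : ¬ (3 ≤ a + m ∧ 3 ≤ e) := by
    rintro ⟨h1, h2⟩
    obtain rfl : m = 0 := by omega
    obtain rfl : a = 3 := by omega
    obtain rfl : e = 3 := by omega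
    have hG : ∀ g : G, g ^ 6 = 1 := fun g => by
      rw [← EmbeddingLike.map_eq_one_iff (f := E), map_pow]
      exact pow_eq_one_of_forall_dvd (by decide) _
    -- A primitive sixth root of unity, `1 / 2` plus a square root of `-3 / 4`.
    obtain ⟨z, hz⟩ : ∃ z : ℂ, z ^ 2 = z - 1 := by
      obtain ⟨z, hz⟩ := IsAlgClosed.exists_pow_nat_eq (-3 / 4 : ℂ) (n := 2) two_pos
      exact ⟨z + 1 / 2, by linear_combination hz⟩
    have hz0 : z ≠ 0 := by
      rintro rfl
      norm_num at hz
    obtain ⟨i₀, hi₀, u, hu⟩ := exists_dual_elements_six hU h.faithful hG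
      (by rw [card_eq_torsionCount (fun _ => dvd_of_mem_primaryList) E hG]; rfl) hc3
      (ζ := Units.mk0 z hz0) (by
        ext
        rw [Units.val_pow_eq_pow_val, Units.val_mk0, Units.val_one]
        linear_combination (z ^ 4 + z ^ 3 - z - 1) * hz)
    exact h.not_isCubeAction_six rfl hi₀ (by simpa using hz) u hu
  obtain ⟨d, hd, ⟨E'⟩⟩ := exists_mulEquiv_of_inTable (fun _ => dvd_of_mem_primaryList)
    (inTable_of_exponent_twelve a (by omega) m hm e (by omega) ham hme h33 (primaryList_ne_nil E))
  exact ⟨d, hd, ⟨E.trans E'⟩⟩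

/-- The abelian groups that act freely without translations on a four-dimensional complex torus
belong to the table. -/
theorem IsHyperelliptic.exists_mulEquiv (h : IsHyperelliptic 4 G) :
    ∃ L ∈ abelianTable, Nonempty (G ≃* CyclicProduct L) := by
  classical
  obtain ⟨_, _, Λ, _, _, χ, b, h⟩ := h.exists_isDiagonalAction
  have hU := h.exists_eq_one
  -- The block of `j`: the coordinates whose characters generate the same cyclic group as `χ j`, and
  -- so have the same kernel.
  let S : Fin 4 → Finset (Fin 4) := fun j =>
    {i | Subgroup.zpowers (χ i) = Subgroup.zpowers (χ j)}
  have hS : ∀ i j, i ∈ S j ↔ Subgroup.zpowers (χ i) = Subgroup.zpowers (χ j) := by simp [S]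
  have hφ : ∀ j, (orderOf (χ j)).totient ≤ 2 * (S j).card := by
    intro j
    have := h.totient_orderOf_le j
    rw [Nat.card_eq_fintype_card, Fintype.card_subtype] at this
    exact this
  have hd0 : ∀ j, orderOf (χ j) ≠ 0 := fun j h0 =>
    Nat.card_pos.ne' (Nat.eq_zero_of_zero_dvd (h0 ▸ orderOf_char_dvd_card (χ j)) : Nat.card G = 0)
  -- If one block were everything, all characters would share a kernel and fixed vectors would make
  -- it all of `G`. So blocks of large totient have at most three coordinates, whence `φ ≤ 6`.
  have hker : ∀ j, χ j ≠ 1 → ∃ i, i ∉ S j := by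
    intro j hj
    by_contra! hall
    refine hj (MonoidHom.ext fun g => ?_)
    obtain ⟨i, hi⟩ := hU g
    exact apply_eq_one_of_zpowers_eq ((hS i j).1 (hall i)).symm hi
  have hne1 : ∀ j, 3 ≤ (orderOf (χ j)).totient → χ j ≠ 1 := by
    intro j hj h1
    rw [h1, orderOf_one] at hj
    norm_num at hj
  have hScard : ∀ j, 3 ≤ (orderOf (χ j)).totient → (S j).card ≤ 3 := by
    intro j hj
    obtain ⟨i, hi⟩ := hker j (hne1 j hj)
    have : (S j).card < Fintype.card (Fin 4) := Finset.card_lt_univ_of_notMem hi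
    rw [Fintype.card_fin] at this
    omega
  have hφ6 : ∀ j, (orderOf (χ j)).totient ≤ 6 := by
    intro j
    by_contra! hlt
    have h1 := hφ j
    have h2 := hScard j (by omega)
    omega
  by_cases hall : ∀ j, (orderOf (χ j)).totient ≤ 2
  · refine h.exists_mulEquiv_of_exponent fun i => ?_
    have h1 := (totient_cases (hd0 i) (hφ6 i)).1 (hall i)
    have h2 : ∀ n, orderOf (χ i) ∣ n → ∀ g, χ i g ^ n = 1 := by
      rintro n ⟨k, rfl⟩ g
      rw [pow_mul, apply_pow_orderOf, one_pow]
    have h3 : orderOf (χ i) ∣ 4 ∨ orderOf (χ i) ∣ 6 := by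
      simp only [List.mem_cons, List.not_mem_nil, or_false] at h1
      rcases h1 with h1 | h1 | h1 | h1 | h1 <;> rw [h1] <;> norm_num
    exact h3.imp (h2 4) (h2 6)
  · push Not at hall
    obtain ⟨j, hj⟩ := hall
    have hjmem : j ∈ S j := (hS j j).2 rfl
    have hj3 := hScard j (by omega)
    have hj2 := hφ j
    have hcases := totient_cases (hd0 j) (hφ6 j)
    by_cases hcard : (S j).card = 3
    · obtain ⟨l, hl⟩ := hker j (hne1 j (by omega))
      have hSl : ∀ i, i ≠ l → i ∈ S j := by
        have hsub : S j ⊆ Finset.univ.erase l := fun i hi =>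
          Finset.mem_erase.2 ⟨fun h => hl (h ▸ hi), Finset.mem_univ i⟩
        have heq := Finset.eq_of_subset_of_card_le hsub (by simp [hcard])
        intro i hi
        rw [heq]
        exact Finset.mem_erase.2 ⟨hi, Finset.mem_univ i⟩
      -- The kernels of `χ j` and `χ l` cover `G`. Then `χ j` alone is faithful and `G` is cyclic.
      have hχl : χ l = 1 := by
        have hU' : ∀ g, χ j g = 1 ∨ χ l g = 1 ∨ χ l g = 1 := by
          intro g
          obtain ⟨i, hi⟩ := hU g
          by_cases hil : i = l
          · right; left; rw [← hil]; exact hi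
          · left; exact apply_eq_one_of_zpowers_eq ((hS i j).1 (hSl i hil)).symm hi
        have := eq_one_or_eq_one_of_union hU' (by
          intro h2
          have h3 := Nat.le_of_dvd two_pos (orderOf_dvd_of_pow_eq_one h2)
          have := Nat.totient_le (orderOf (χ j))
          omega)
        exact this.elim id id
      refine exists_mulEquiv_of_one_character (ψ := χ j) (d := orderOf (χ j)) ?_
        (apply_pow_orderOf _) fun g hg => h.faithful g fun i => ?_
      · have : orderOf (χ j) ∈ [5, 8, 10, 12] ++ [7, 9, 14, 18] := by
          rw [List.mem_append]
          rcases Nat.lt_or_ge (orderOf (χ j)).totient 5 with h5 | h5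
          · exact Or.inl (hcases.2.1 (by omega) (by omega))
          · exact Or.inr (hcases.2.2 h5)
        have key : ∀ d ∈ [5, 8, 10, 12] ++ [7, 9, 14, 18], (d, 1) ∈ rankTwoPairs := by decide
        exact key _ this
      · by_cases hil : i = l
        · rw [hil, hχl]; rfl
        · exact apply_eq_one_of_zpowers_eq ((hS i j).1 (hSl i hil)) hg
    · have hcard2 : (S j).card = 2 := by omega
      have hcompl : (S j)ᶜ.card = 2 := by
        rw [Finset.card_compl, hcard2, Fintype.card_fin]
      obtain ⟨l, l', hll', hcl⟩ := Finset.card_eq_two.1 hcompl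
      have hcl' : ∀ i, i ∉ S j ↔ i = l ∨ i = l' := by
        intro i
        rw [← Finset.mem_compl, hcl]
        simp
      have hU' : ∀ g, χ j g = 1 ∨ χ l g = 1 ∨ χ l' g = 1 := by
        intro g
        obtain ⟨i, hi⟩ := hU g
        by_cases hij : i ∈ S j
        · left; exact apply_eq_one_of_zpowers_eq ((hS i j).1 hij).symm hi
        · rcases (hcl' i).1 hij with rfl | rfl
          · right; left; exact hi
          · right; right; exact hi
      have h2 : χ j ^ 2 ≠ 1 := by
        intro h2
        have h3 := Nat.le_of_dvd two_pos (orderOf_dvd_of_pow_eq_one h2)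
        have := Nat.totient_le (orderOf (χ j))
        omega
      -- By the covering lemma one coordinate outside the block has trivial character. The other has
      -- totient at most 2: a larger one would need a second coordinate in its block, and none is
      -- available.
      have key : ∀ l l', (∀ i, i ∉ S j ↔ i = l ∨ i = l') → χ l = 1 →
          ∃ L ∈ abelianTable, Nonempty (G ≃* CyclicProduct L) := by
        intro l l' hcl hl
        have hl'2 : (orderOf (χ l')).totient ≤ 2 := by
          by_contra! hlt
          have h1 := hφ l'
          obtain ⟨i, hi, hil'⟩ := Finset.exists_mem_ne (s := S l') (by omega) l'
          have hiz := (hS i l').1 hi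
          by_cases hij : i ∈ S j
          · exact (hcl l').2 (Or.inr rfl) ((hS l' j).2 (hiz.symm.trans ((hS i j).1 hij)))
          · have hil := ((hcl i).1 hij).resolve_right hil'
            rw [hil, hl] at hiz
            refine hne1 l' hlt (MonoidHom.ext fun g => ?_)
            exact apply_eq_one_of_zpowers_eq hiz.symm rfl
        have hl'c := (totient_cases (hd0 l') (hφ6 l')).1 hl'2
        have hjc := hcases.2.1 (by omega) (by omega)
        refine exists_mulEquiv_of_two_characters (ψ := χ j) (θ := χ l') (d := orderOf (χ j))
          (e := orderOf (χ l')) ?_ (apply_pow_orderOf _) (apply_pow_orderOf _)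
          fun g hg hg' => h.faithful g fun i => ?_
        · exact List.mem_append_left _ (List.mem_product.2 ⟨hjc, hl'c⟩)
        · by_cases hij : i ∈ S j
          · exact apply_eq_one_of_zpowers_eq ((hS i j).1 hij) hg
          · rcases (hcl i).1 hij with rfl | rfl
            · rw [hl]; rfl
            · exact hg'
      rcases eq_one_or_eq_one_of_union hU' h2 with h1 | h1
      · exact key l l' hcl' h1
      · exact key l' l (fun i => by rw [hcl' i, or_comm]) h1

end Classification
end Hyperelliptic

namespace Hyperelliptic

/-! ### Lattices from cyclotomic integers. -/

section CyclotomicLattice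

open Polynomial

variable {n : ℕ} {κ : Type*}

/-- The sum over `κ` of the lattices of vectors `(P(ζ_s))_s`, `P ∈ ℤ[X]`, where `s` runs through
the coordinates in a fibre of `β`. -/
noncomputable def cyclotomicLattice (β : Fin n → κ) (ζ : Fin n → ℂ) : Submodule ℤ (Fin n → ℂ) :=
  LinearMap.range (LinearMap.pi fun s =>
    (aeval (ζ s) : ℤ[X] →ₐ[ℤ] ℂ).toLinearMap ∘ₗ LinearMap.proj (β s) :
      (κ → ℤ[X]) →ₗ[ℤ] (Fin n → ℂ))

theorem mem_cyclotomicLattice {β : Fin n → κ} {ζ : Fin n → ℂ} {z : Fin n → ℂ} :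
    z ∈ cyclotomicLattice β ζ ↔ ∃ P : κ → ℤ[X], ∀ s, aeval (ζ s) (P (β s)) = z s := by
  rw [cyclotomicLattice, LinearMap.mem_range]
  refine exists_congr fun P => ?_
  rw [funext_iff]
  rfl

theorem mul_mem_cyclotomicLattice {β : Fin n → κ} {ζ : Fin n → ℂ} {w z : Fin n → ℂ}
    (hw : w ∈ cyclotomicLattice β ζ) (hz : z ∈ cyclotomicLattice β ζ) :
    w * z ∈ cyclotomicLattice β ζ := by
  rw [mem_cyclotomicLattice] at hw hz ⊢
  obtain ⟨P, hP⟩ := hw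
  obtain ⟨Q, hQ⟩ := hz
  exact ⟨P * Q, fun s => by rw [Pi.mul_apply, map_mul, hP, hQ]; rfl⟩

variable [Fintype κ] [DecidableEq κ] (β : Fin n → κ) (N : κ → ℕ) (ζ : Fin n → ℂ)

/-- The power basis of the cyclotomic lattice. -/
noncomputable def cyclotomicVector (x : Σ k, Fin (N k).totient) : Fin n → ℂ :=
  fun s => if β s = x.1 then ζ s ^ (x.2 : ℕ) else 0

variable {β N ζ}

/-- A relation in one block is a real polynomial of degree less than `φ(N)` that vanishes at the
roots `ζ s` and their conjugates, which are `φ(N)` distinct points. -/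
theorem linearIndependent_cyclotomicVector
    (hinj : ∀ s t, β s = β t → ζ s = ζ t → s = t)
    (hconj : ∀ s t, β s = β t → ζ s ≠ starRingEnd ℂ (ζ t))
    (hcard : ∀ k, (N k).totient = 2 * Fintype.card {s // β s = k}) :
    LinearIndependent ℝ (cyclotomicVector β N ζ) := by
  classical
  rw [Fintype.linearIndependent_iff]
  rintro c hc ⟨k, j⟩
  let p : ℝ[X] := ∑ j : Fin (N k).totient, C (c ⟨k, j⟩) * X ^ (j : ℕ)
  have hpeval : ∀ s, β s = k → (p.map (algebraMap ℝ ℂ)).eval (ζ s) = 0 := by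
    intro s hs
    have h1 := congrFun hc s
    rw [Finset.sum_apply, Fintype.sum_sigma, Finset.sum_eq_single k] at h1
    · simpa [p, eval_map, eval₂_finsetSum, cyclotomicVector, hs] using h1
    · intro k' _ hk'
      refine Finset.sum_eq_zero fun j _ => ?_
      simp [cyclotomicVector, hs, hk'.symm]
    · simp
  have hpconj : ∀ s, β s = k → (p.map (algebraMap ℝ ℂ)).eval (starRingEnd ℂ (ζ s)) = 0 := by
    intro s hs
    have h1 := congrArg (starRingEnd ℂ) (hpeval s hs)
    rw [map_zero] at h1
    rw [← h1]
    simp [p, eval_map, eval₂_finsetSum]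
  have hdeg : p.degree < ((N k).totient : ℕ) := by
    rw [degree_lt_iff_coeff_zero]
    intro m hm
    simp only [p, finsetSum_coeff, coeff_C_mul, coeff_X_pow]
    refine Finset.sum_eq_zero fun j _ => ?_
    rw [if_neg (by have := j.2; omega), mul_zero]
  let T : Finset (Fin n) := Finset.univ.filter fun s => β s = k
  have hT : T.card = Fintype.card {s // β s = k} := (Fintype.card_subtype _).symm
  let R : Finset ℂ := T.image ζ ∪ T.image fun s => starRingEnd ℂ (ζ s)
  have hR : R.card = (N k).totient := by
    rw [Finset.card_union_of_disjoint, Finset.card_image_of_injOn, Finset.card_image_of_injOn,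
      hcard, hT, two_mul]
    · intro s hs t ht hst
      simp only [T, Finset.coe_filter, Finset.mem_univ, true_and, Set.mem_ofPred_eq] at hs ht
      exact hinj s t (hs.trans ht.symm) ((starRingEnd ℂ).injective hst)
    · intro s hs t ht hst
      simp only [T, Finset.coe_filter, Finset.mem_univ, true_and, Set.mem_ofPred_eq] at hs ht
      exact hinj s t (hs.trans ht.symm) hst
    · rw [Finset.disjoint_left]
      intro z hz hz'
      simp only [T, Finset.mem_image, Finset.mem_filter, Finset.mem_univ, true_and] at hz hz'
      obtain ⟨s, hs, rfl⟩ := hz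
      obtain ⟨t, ht, h⟩ := hz'
      exact hconj s t (hs.trans ht.symm) h.symm
  have hp0 : p.map (algebraMap ℝ ℂ) = 0 := by
    refine eq_zero_of_degree_lt_of_eval_finset_eq_zero R ?_ ?_
    · rw [hR]
      exact (degree_map_le).trans_lt hdeg
    · intro z hz
      simp only [R, T, Finset.mem_union, Finset.mem_image, Finset.mem_filter, Finset.mem_univ,
        true_and] at hz
      rcases hz with ⟨s, hs, rfl⟩ | ⟨s, hs, rfl⟩
      · exact hpeval s hs
      · exact hpconj s hs
  have hp : p = 0 := (Polynomial.map_eq_zero _).1 hp0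
  have h2 : p.coeff j = c ⟨k, j⟩ := by
    simp only [p, finsetSum_coeff, coeff_C_mul, coeff_X_pow]
    rw [Finset.sum_eq_single j]
    · simp
    · intro i _ hij
      rw [if_neg (fun h => hij (Fin.ext h.symm)), mul_zero]
    · simp
  rw [← h2, hp, coeff_zero]

/-- Polynomials are reduced modulo the cyclotomic polynomial, which vanishes on the whole block. -/
theorem cyclotomicLattice_eq_span (hN : ∀ s, 0 < N (β s))
    (hζ : ∀ s, IsPrimitiveRoot (ζ s) (N (β s))) :
    cyclotomicLattice β ζ = Submodule.span ℤ (Set.range (cyclotomicVector β N ζ)) := by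
  apply le_antisymm
  · intro z hz
    obtain ⟨P, hP⟩ := mem_cyclotomicLattice.1 hz
    have : z = ∑ x : Σ k, Fin (N k).totient,
        ((P x.1 %ₘ cyclotomic (N x.1) ℤ).coeff x.2) • cyclotomicVector β N ζ x := by
      ext s
      rw [Finset.sum_apply, Fintype.sum_sigma, Finset.sum_eq_single (β s), ← hP s]
      · have hpos : 0 < (N (β s)).totient := Nat.totient_pos.2 (hN _)
        have hroot : aeval (ζ s) (cyclotomic (N (β s)) ℤ) = 0 := by
          rw [cyclotomic_eq_minpoly (hζ s) (hN _), minpoly.aeval]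
        rw [← aeval_modByMonic_eq_self_of_root hroot,
          aeval_eq_sum_range' (n := (N (β s)).totient)]
        · rw [Finset.sum_range]
          refine Finset.sum_congr rfl fun j _ => ?_
          simp [cyclotomicVector]
        · rw [← natDegree_cyclotomic (N (β s)) ℤ]
          refine natDegree_modByMonic_lt _ (cyclotomic.monic _ ℤ) fun h1 => ?_
          have := natDegree_cyclotomic (N (β s)) ℤ
          rw [h1, natDegree_one] at this
          omega
      · intro k _ hk
        refine Finset.sum_eq_zero fun j _ => ?_
        simp [cyclotomicVector, hk.symm]
      · simp
    rw [this]
    exact Submodule.sum_mem _ fun x _ => Submodule.smul_mem _ _ (Submodule.subset_span ⟨x, rfl⟩)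
  · rw [Submodule.span_le]
    rintro _ ⟨⟨k, j⟩, rfl⟩
    refine mem_cyclotomicLattice.2 ⟨Pi.single k (X ^ (j : ℕ)), fun s => ?_⟩
    by_cases hs : β s = k
    · subst hs; simp [cyclotomicVector]
    · simp [cyclotomicVector, hs]

theorem isZLattice_cyclotomicLattice (hN : ∀ s, 0 < N (β s))
    (hζ : ∀ s, IsPrimitiveRoot (ζ s) (N (β s)))
    (hinj : ∀ s t, β s = β t → ζ s = ζ t → s = t)
    (hconj : ∀ s t, β s = β t → ζ s ≠ starRingEnd ℂ (ζ t))
    (hcard : ∀ k, (N k).totient = 2 * Fintype.card {s // β s = k}) :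
    ∃ _ : DiscreteTopology (cyclotomicLattice β ζ), IsZLattice ℝ (cyclotomicLattice β ζ) := by
  have hli := linearIndependent_cyclotomicVector hinj hconj hcard
  have hrank : Fintype.card (Σ k, Fin (N k).totient) = Module.finrank ℝ (Fin n → ℂ) := by
    rw [Fintype.card_sigma, Module.finrank_pi_fintype]
    simp only [Fintype.card_fin, hcard, Complex.finrank_real_complex, Finset.sum_const,
      Finset.card_univ, smul_eq_mul]
    rw [← Finset.mul_sum, ← Fintype.card_sigma, Fintype.card_congr (Equiv.sigmaFiberEquiv β),
      Fintype.card_fin, mul_comm]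
  let B : Module.Basis (Σ k, Fin (N k).totient) ℝ (Fin n → ℂ) :=
    Module.Basis.mk hli (by
      rw [hli.span_eq_top_of_card_eq_finrank' hrank])
  have hspan : cyclotomicLattice β ζ = Submodule.span ℤ (Set.range B) := by
    rw [cyclotomicLattice_eq_span hN hζ, Module.Basis.coe_mk]
  rw [hspan]
  exact ⟨inferInstance, inferInstance⟩

end CyclotomicLattice
end Hyperelliptic

namespace Hyperelliptic

/-! ### Free actions on cyclotomic tori. -/

section Construction

open Polynomial

variable {m : Fin 3 → ℕ}

/-- The exponent of the `k`-th generator in an element of `C_{m₀} × C_{m₁} × C_{m₂}`. -/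
def exponentAt (g : ∀ k, Multiplicative (ZMod (m k))) (k : Fin 3) : ℕ :=
  (Multiplicative.toAdd (g k)).val

theorem eq_one_of_exponentAt {g : ∀ k, Multiplicative (ZMod (m k))}
    (h : ∀ k, exponentAt g k = 0) : g = 1 :=
  funext fun k => (ZMod.val_eq_zero _).1 (h k)

variable [∀ k, NeZero (m k)]

theorem exponentAt_lt (g : ∀ k, Multiplicative (ZMod (m k))) (k : Fin 3) :
    exponentAt g k < m k :=
  ZMod.val_lt _

theorem exists_exponentAt_mul (g h : ∀ k, Multiplicative (ZMod (m k))) (k : Fin 3) :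
    ∃ c : ℕ, exponentAt g k + exponentAt h k = exponentAt (g * h) k + m k * c :=
  ⟨(exponentAt g k + exponentAt h k) / m k, by
    have : exponentAt (g * h) k = (exponentAt g k + exponentAt h k) % m k := ZMod.val_add _ _
    rw [this, Nat.mod_add_div]⟩

theorem pow_exponentAt_mul {u : ℂ} {k : Fin 3} (hu : u ^ m k = 1)
    (g h : ∀ k, Multiplicative (ZMod (m k))) :
    u ^ exponentAt (g * h) k = u ^ exponentAt g k * u ^ exponentAt h k := by
  obtain ⟨c, hc⟩ := exists_exponentAt_mul g h k
  rw [← pow_add, hc, pow_add, pow_mul, hu, one_pow, mul_one]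

/-- The character `g ↦ u₀ ^ g₀ * u₁ ^ g₁ * u₂ ^ g₂`. -/
noncomputable def productCharacter (u : Fin 3 → ℂ) (hu : ∀ k, u k ^ m k = 1) :
    (∀ k, Multiplicative (ZMod (m k))) →* ℂˣ :=
  MonoidHom.toHomUnits
    { toFun := fun g => ∏ k, u k ^ exponentAt g k
      map_one' := Finset.prod_eq_one fun k _ => by
        have : exponentAt (1 : ∀ k, Multiplicative (ZMod (m k))) k = 0 := ZMod.val_zero
        rw [this, pow_zero]
      map_mul' := fun g h => by
        rw [← Finset.prod_mul_distrib]
        exact Finset.prod_congr rfl fun k _ => pow_exponentAt_mul (hu k) g h }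

theorem productCharacter_apply (u : Fin 3 → ℂ) (hu : ∀ k, u k ^ m k = 1)
    (g : ∀ k, Multiplicative (ZMod (m k))) :
    (productCharacter u hu g : ℂ) = ∏ k, u k ^ exponentAt g k := rfl

variable {β : Fin 4 → Fin 4} {ζ : Fin 4 → ℂ}

theorem aeval_mul_mem_cyclotomicLattice (Q : ℤ[X]) {z : Fin 4 → ℂ}
    (hz : z ∈ cyclotomicLattice β ζ) :
    (fun s => aeval (ζ s) Q * z s) ∈ cyclotomicLattice β ζ :=
  mul_mem_cyclotomicLattice (w := fun s => aeval (ζ s) Q)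
    (mem_cyclotomicLattice.2 ⟨fun _ => Q, fun _ => rfl⟩) hz

theorem aeval_I_eq (P : ℤ[X]) : ∃ x y : ℤ, aeval Complex.I P = x + y * Complex.I := by
  induction P using Polynomial.induction_on' with
  | add p q hp hq =>
    obtain ⟨x, y, h⟩ := hp
    obtain ⟨x', y', h'⟩ := hq
    exact ⟨x + x', y + y', by rw [map_add, h, h']; push_cast; ring⟩
  | monomial n a =>
    induction n with
    | zero => exact ⟨a, 0, by simp⟩
    | succ n ih =>
      obtain ⟨x, y, h⟩ := ih
      refine ⟨-y, x, ?_⟩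
      rw [← monomial_mul_X, map_mul, h, aeval_X, add_mul, mul_assoc, Complex.I_mul_I]
      push_cast
      ring

/-- The group `C_{m₀} × C_{m₁} × C_{m₂}` acts on a cyclotomic torus: the `k`-th generator
multiplies the coordinates of the block `k < 3` by roots of unity, while the last coordinate is
translated by `g₀ / m₀ + i g₁ / m₁ + g₂ / r` and the first one by `p g₂`. -/
theorem exists_isDiagonalAction_of_blocks {V : Fin 3 → ℤ[X]} {r : ℕ} {p : ℂ}
    (hβ0 : β 0 = 0) (hβ3 : ∀ s, β s = 3 ↔ s = 3) (hζ3 : ζ 3 = Complex.I)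
    (hV : ∀ s k, β s = k.castSucc → IsPrimitiveRoot (aeval (ζ s) (V k)) (m k))
    (hne : ∀ k, m k = 1 ∨ ∃ s, β s = k.castSucc) (hr : r ∣ m 2)
    (hp1 : (Pi.single 0 (m 2 * p) : Fin 4 → ℂ) ∈ cyclotomicLattice β ζ)
    (hp2 : (Pi.single 0 ((aeval (ζ 0) (V 0) - 1) * p) : Fin 4 → ℂ) ∈ cyclotomicLattice β ζ)
    (hp3 : ∀ a < m 0, ∀ c < m 2, m 0 * r ∣ a * r + c * m 0 →
      a = 0 ∧ (c = 0 ∨ ∀ P : ℤ[X], aeval (ζ 0) P ≠ c * p)) :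
    ∃ (χ : Fin 4 → (∀ k, Multiplicative (ZMod (m k))) →* ℂˣ)
      (b : (∀ k, Multiplicative (ZMod (m k))) → Fin 4 → ℂ),
      IsDiagonalAction (cyclotomicLattice β ζ) χ b := by
  have hm : ∀ k, (m k : ℂ) ≠ 0 := fun k => Nat.cast_ne_zero.2 (NeZero.ne _)
  obtain ⟨r', hr'⟩ := hr
  have hr0 : r ≠ 0 := by
    rintro rfl
    exact NeZero.ne (m 2) (by rw [hr', zero_mul])
  have hrC : (r : ℂ) ≠ 0 := Nat.cast_ne_zero.2 hr0
  let u : Fin 4 → Fin 3 → ℂ := fun s k => if β s = k.castSucc then aeval (ζ s) (V k) else 1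
  have hu : ∀ s k, u s k ^ m k = 1 := by
    intro s k
    by_cases h : β s = k.castSucc
    · simp only [u, if_pos h]
      exact (hV s k h).pow_eq_one
    · simp only [u, if_neg h, one_pow]
  let χ : Fin 4 → (∀ k, Multiplicative (ZMod (m k))) →* ℂˣ := fun s =>
    productCharacter (u s) (hu s)
  have hχ : ∀ s k g, β s = k.castSucc →
      charVec χ g s = aeval (ζ s) (V k) ^ exponentAt g k := by
    intro s k g h
    change ((productCharacter (u s) (hu s) g : ℂˣ) : ℂ) = _
    rw [productCharacter_apply, Finset.prod_eq_single k]
    · simp only [u, if_pos h]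
    · intro j _ hj
      have : β s ≠ j.castSucc := fun h' => hj (Fin.castSucc_injective _ (h'.symm.trans h))
      simp only [u, if_neg this, one_pow]
    · simp
  have hχ3 : ∀ g, charVec χ g 3 = 1 := by
    intro g
    change ((productCharacter (u 3) (hu 3) g : ℂˣ) : ℂ) = _
    rw [productCharacter_apply]
    refine Finset.prod_eq_one fun k _ => ?_
    have : β 3 ≠ k.castSucc := by
      rw [(hβ3 3).2 rfl]
      exact (Fin.castSucc_lt_last k).ne'
    simp only [u, if_neg this, one_pow]
  have hχ0 : ∀ g, charVec χ g 0 = aeval (ζ 0) (V 0) ^ exponentAt g 0 := fun g => hχ 0 0 g hβ0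
  have hχmem : ∀ g, charVec χ g ∈ cyclotomicLattice β ζ := by
    intro g
    refine mem_cyclotomicLattice.2
      ⟨fun j => ∏ k : Fin 3, if j = k.castSucc then V k ^ exponentAt g k else 1, fun s => ?_⟩
    change _ = ((productCharacter (u s) (hu s) g : ℂˣ) : ℂ)
    rw [productCharacter_apply, map_prod]
    refine Finset.prod_congr rfl fun k _ => ?_
    by_cases h : β s = k.castSucc
    · simp only [u, if_pos h, map_pow]
    · simp only [u, if_neg h, one_pow, map_one]
  let τ : (∀ k, Multiplicative (ZMod (m k))) → ℂ := fun g =>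
    exponentAt g 0 / m 0 + exponentAt g 1 / m 1 * Complex.I + exponentAt g 2 / r
  -- The first generator and the third both move the last coordinate in the real direction, so their
  -- translations may cancel; the term `exponentAt g 2 * p` is there for the elements with `τ g` in
  -- the lattice.
  let b : (∀ k, Multiplicative (ZMod (m k))) → Fin 4 → ℂ := fun g =>
    Pi.single 3 (τ g) + Pi.single 0 (exponentAt g 2 * p)
  have hb0 : ∀ g, b g 0 = exponentAt g 2 * p := fun g => by simp [b]
  have hb3 : ∀ g, b g 3 = τ g := fun g => by simp [b]
  have hsingle3 : ∀ x y : ℤ,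
      (Pi.single 3 (x + y * Complex.I) : Fin 4 → ℂ) ∈ cyclotomicLattice β ζ := by
    intro x y
    refine mem_cyclotomicLattice.2 ⟨Pi.single 3 (C x + C y * X), fun s => ?_⟩
    by_cases h : s = 3
    · subst h
      rw [(hβ3 3).2 rfl, Pi.single_eq_same, Pi.single_eq_same, hζ3]
      simp
    · rw [Pi.single_eq_of_ne h, Pi.single_eq_of_ne (fun h' => h ((hβ3 s).1 h')), map_zero]
  refine ⟨χ, b, fun g z hz => mul_mem_cyclotomicLattice (hχmem g) hz, ?_, ?_, ?_⟩
  · intro g h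
    obtain ⟨c0, hc0⟩ := exists_exponentAt_mul g h 0
    obtain ⟨c1, hc1⟩ := exists_exponentAt_mul g h 1
    obtain ⟨c2, hc2⟩ := exists_exponentAt_mul g h 2
    have e0 : (exponentAt (g * h) 0 : ℂ) = exponentAt g 0 + exponentAt h 0 - m 0 * c0 :=
      eq_sub_of_add_eq (by exact_mod_cast hc0.symm)
    have e1 : (exponentAt (g * h) 1 : ℂ) = exponentAt g 1 + exponentAt h 1 - m 1 * c1 :=
      eq_sub_of_add_eq (by exact_mod_cast hc1.symm)
    have e2 : (exponentAt (g * h) 2 : ℂ) = exponentAt g 2 + exponentAt h 2 - m 2 * c2 :=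
      eq_sub_of_add_eq (by exact_mod_cast hc2.symm)
    have hrr : (m 2 : ℂ) = r * r' := by exact_mod_cast hr'
    have hτ : τ (g * h) - τ g - τ h =
        ((-(c0 + r' * c2) : ℤ) : ℂ) + ((-c1 : ℤ) : ℂ) * Complex.I := by
      simp only [τ, e0, e1, e2, hrr]
      have := hm 0
      have := hm 1
      push_cast
      field_simp
      ring
    -- By `hp2` the first generator fixes the point `p` modulo the lattice; hence so do its powers,
    -- and `p` yields a cocycle.
    have hgeom : (charVec χ g 0 - 1) * p =
        aeval (ζ 0) (∑ i ∈ Finset.range (exponentAt g 0), V 0 ^ i) *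
          ((aeval (ζ 0) (V 0) - 1) * p) := by
      rw [hχ0, ← mul_assoc, map_sum]
      simp only [map_pow]
      rw [geom_sum_mul]
    have key : b (g * h) - b g - charVec χ g * b h =
        Pi.single 3 (((-(c0 + r' * c2) : ℤ) : ℂ) + ((-c1 : ℤ) : ℂ) * Complex.I) -
        c2 • (Pi.single 0 (m 2 * p) : Fin 4 → ℂ) - exponentAt h 2 •
          (fun s => aeval (ζ s) (∑ i ∈ Finset.range (exponentAt g 0), V 0 ^ i) *
            (Pi.single 0 ((aeval (ζ 0) (V 0) - 1) * p) : Fin 4 → ℂ) s) := by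
      have h12 : ∀ s : Fin 4, s ≠ 0 → s ≠ 3 → ∀ g, b g s = 0 := fun s h0 h3 g => by
        simp [b, h0, h3]
      ext s
      by_cases h0 : s = 0
      · subst h0
        simp only [Pi.sub_apply, Pi.mul_apply, hb0, Pi.smul_apply, Pi.single_eq_same]
        rw [← hgeom, Pi.single_eq_of_ne (by decide), e2]
        simp only [nsmul_eq_mul]
        ring
      · by_cases h3 : s = 3
        · subst h3
          simp only [Pi.sub_apply, Pi.mul_apply, hb3, hχ3, one_mul, hτ, Pi.smul_apply,
            Pi.single_eq_same, Pi.single_eq_of_ne h0, mul_zero, smul_zero, sub_zero]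
        · simp only [Pi.sub_apply, Pi.mul_apply, h12 s h0 h3, Pi.smul_apply,
            Pi.single_eq_of_ne h0, Pi.single_eq_of_ne h3, mul_zero, smul_zero, sub_zero]
    rw [key]
    exact sub_mem (sub_mem (hsingle3 _ _) (nsmul_mem hp1 _))
      (nsmul_mem (aeval_mul_mem_cyclotomicLattice _ hp2) _)
  · intro g hg x hx
    obtain ⟨P, hP⟩ := mem_cyclotomicLattice.1 hx
    have h3 := hP 3
    obtain ⟨y, z, hyz⟩ := aeval_I_eq (P (β 3))
    rw [hζ3, hyz, Pi.add_apply, Pi.mul_apply, Pi.sub_apply, hχ3, Pi.one_apply, sub_self, zero_mul,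
      zero_add, hb3] at h3
    have hm0 : (m 0 : ℝ) ≠ 0 := Nat.cast_ne_zero.2 (NeZero.ne _)
    have hm1 : (m 1 : ℝ) ≠ 0 := Nat.cast_ne_zero.2 (NeZero.ne _)
    have hrR : (r : ℝ) ≠ 0 := Nat.cast_ne_zero.2 hr0
    have hτ : τ g = ((exponentAt g 0 / m 0 + exponentAt g 2 / r : ℝ) : ℂ) +
        ((exponentAt g 1 / m 1 : ℝ) : ℂ) * Complex.I := by
      simp only [τ]
      push_cast
      ring
    rw [hτ] at h3
    have him : (z : ℝ) = exponentAt g 1 / m 1 := by simpa using congrArg Complex.im h3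
    have hre : (y : ℝ) = exponentAt g 0 / m 0 + exponentAt g 2 / r := by
      simpa using congrArg Complex.re h3
    have h1 : exponentAt g 1 = 0 := by
      rw [eq_div_iff hm1] at him
      refine Nat.eq_zero_of_dvd_of_lt ?_ (exponentAt_lt g 1)
      exact Int.natCast_dvd_natCast.1 ⟨z, by rw [mul_comm]; exact_mod_cast him.symm⟩
    -- Integrality of the real part of `τ g`, with denominators cleared. By `hp3` the linear part on
    -- coordinate 0 is then trivial, and either `g = 1` or that coordinate is translated by a
    -- non-lattice vector.
    have hdvd : m 0 * r ∣ exponentAt g 0 * r + exponentAt g 2 * m 0 := by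
      refine Int.natCast_dvd_natCast.1 ⟨y, ?_⟩
      field_simp at hre
      have h2 : (exponentAt g 0 * r + exponentAt g 2 * m 0 : ℝ) = m 0 * r * y := by
        linarith
      exact_mod_cast h2
    obtain ⟨h0, h2⟩ := hp3 _ (exponentAt_lt g 0) _ (exponentAt_lt g 2) hdvd
    rcases h2 with h2 | h2
    · refine hg (eq_one_of_exponentAt fun k => ?_)
      fin_cases k
      exacts [h0, h1, h2]
    · refine h2 (P (β 0)) ?_
      rw [hP 0, Pi.add_apply, Pi.mul_apply, Pi.sub_apply, hχ0, h0, pow_zero, Pi.one_apply,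
        sub_self, zero_mul, zero_add, hb0]
  · intro g hg
    refine eq_one_of_exponentAt fun k => ?_
    rcases hne k with h | ⟨s, hs⟩
    · have := exponentAt_lt g k
      omega
    · refine Nat.eq_zero_of_dvd_of_lt ?_ (exponentAt_lt g k)
      refine (hV s k hs).dvd_of_pow_eq_one _ ?_
      rw [← hχ s k g hs]
      change ((χ s g : ℂˣ) : ℂ) = 1
      rw [hg s, Units.val_one]

theorem isPrimitiveRoot_neg_of_odd {z : ℂ} {N : ℕ} (hz : IsPrimitiveRoot z N) (hN : Odd N) :
    IsPrimitiveRoot (-z) (2 * N) := by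
  have h2 : orderOf (-1 : ℂ) = 2 := by
    rw [orderOf_neg_one, ringChar.eq_zero]; rfl
  have h := (Commute.all (-1 : ℂ) z).orderOf_mul_eq_mul_orderOf_of_coprime (by
    rw [h2, ← hz.eq_orderOf]
    exact Nat.coprime_two_left.2 hN)
  rw [h2, ← hz.eq_orderOf, neg_one_mul] at h
  rw [← h]
  exact IsPrimitiveRoot.orderOf _

end Construction
end Hyperelliptic

namespace Hyperelliptic

/-! ### Realising the nine maximal groups. -/

section Examples

open Polynomial

/-- The root of unity `exp(2πi / N)ᵉ` attached to a coordinate, where `N` depends on its block. -/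
noncomputable def rootAt (β : Fin 4 → Fin 4) (N e : Fin 4 → ℕ) (s : Fin 4) : ℂ :=
  Complex.exp (2 * Real.pi * Complex.I / N (β s)) ^ e s

variable {β : Fin 4 → Fin 4} {N e : Fin 4 → ℕ}

theorem isPrimitiveRoot_rootAt (hN : ∀ s, 0 < N (β s)) (he : ∀ s, (e s).Coprime (N (β s)))
    (s : Fin 4) : IsPrimitiveRoot (rootAt β N e s) (N (β s)) :=
  (Complex.isPrimitiveRoot_exp _ (hN s).ne').pow_of_coprime _ (he s)

/-- Numerical conditions under which `cyclotomicLattice β (rootAt β N e)` is a lattice. -/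
def IsCyclotomicType (β : Fin 4 → Fin 4) (N e : Fin 4 → ℕ) : Prop :=
  (∀ s, 0 < N (β s)) ∧ (∀ s, (e s).Coprime (N (β s))) ∧ (∀ s, e s < N (β s)) ∧
  (∀ s t, β s = β t → e s = e t → s = t) ∧ (∀ s t, β s = β t → ¬ N (β s) ∣ e s + e t) ∧
  ∀ k, (N k).totient = 2 * Fintype.card {s // β s = k}

instance (β : Fin 4 → Fin 4) (N e : Fin 4 → ℕ) : Decidable (IsCyclotomicType β N e) := by
  unfold IsCyclotomicType; infer_instance

theorem IsCyclotomicType.isZLattice (h : IsCyclotomicType β N e) :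
    ∃ _ : DiscreteTopology (cyclotomicLattice β (rootAt β N e)),
      IsZLattice ℝ (cyclotomicLattice β (rootAt β N e)) := by
  obtain ⟨hN, he, hlt, hinj, hconj, hcard⟩ := h
  refine isZLattice_cyclotomicLattice hN (isPrimitiveRoot_rootAt hN he) ?_ ?_ hcard
  · intro s t hst h
    refine hinj s t hst ((Complex.isPrimitiveRoot_exp _ (hN s).ne').pow_inj (hlt s) ?_ ?_)
    · rw [hst]; exact hlt t
    · rw [rootAt, rootAt, ← hst] at h
      exact h
  · intro s t hst h
    have hr := Complex.isPrimitiveRoot_exp _ (hN s).ne'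
    have h1 : rootAt β N e t ≠ 0 := (isPrimitiveRoot_rootAt hN he t).ne_zero (hN t).ne'
    rw [← Complex.inv_eq_conj ((isPrimitiveRoot_rootAt hN he t).norm'_eq_one (hN t).ne'),
      ← one_div, eq_div_iff h1, rootAt, rootAt, ← hst, ← pow_add] at h
    exact hconj s t hst (hr.dvd_of_pow_eq_one _ h)

/-- The generator of the `k`-th factor acts on the `k`-th block by `ζ` or by `-ζ`. -/
noncomputable def signedX (σ : Bool) : ℤ[X] := if σ then -X else X

/-- The order `m` of the root of unity `ζ` or `-ζ`, for a primitive `N`-th root of unity `ζ`. -/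
def IsSignedOrder (σ : Bool) (N m : ℕ) : Prop :=
  (m = 1 ∧ N = 0) ∨ (σ = false ∧ m = N) ∨ (σ = true ∧ Odd N ∧ m = 2 * N)

instance (σ : Bool) (N m : ℕ) : Decidable (IsSignedOrder σ N m) := by
  unfold IsSignedOrder; infer_instance

theorem IsSignedOrder.isPrimitiveRoot {σ : Bool} {N m : ℕ} (h : IsSignedOrder σ N m) {z : ℂ}
    (hN : 0 < N) (hz : IsPrimitiveRoot z N) : IsPrimitiveRoot (aeval z (signedX σ)) m := by
  rcases h with ⟨_, h⟩ | ⟨rfl, rfl⟩ | ⟨rfl, ho, rfl⟩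
  · omega
  · simpa [signedX] using hz
  · simpa [signedX] using isPrimitiveRoot_neg_of_odd hz ho

theorem rootAt_three (hβ3 : β 3 = 3) (hN3 : N 3 = 4) (he3 : e 3 = 1) :
    rootAt β N e 3 = Complex.I := by
  rw [rootAt, hβ3, hN3, he3, pow_one]
  have : (2 * Real.pi * Complex.I / ((4 : ℕ) : ℂ)) = Real.pi / 2 * Complex.I := by
    push_cast; ring
  rw [this, Complex.exp_pi_div_two_mul_I]

/-- A group acting freely and without translations on a complex torus of dimension `n`, with
simultaneously diagonal linear parts. -/
def HasDiagonalAction (n : ℕ) (G : Type*) [CommGroup G] : Prop :=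
  ∃ (Λ : Submodule ℤ (Fin n → ℂ)) (_ : DiscreteTopology Λ) (_ : IsZLattice ℝ Λ)
    (χ : Fin n → G →* ℂˣ) (b : G → Fin n → ℂ), IsDiagonalAction Λ χ b

theorem HasDiagonalAction.of_injective {n : ℕ} {G K : Type*} [CommGroup G] [CommGroup K]
    (h : HasDiagonalAction n G) {f : K →* G} (hf : Function.Injective f) :
    HasDiagonalAction n K := by
  obtain ⟨Λ, h1, h2, χ, b, h⟩ := h
  exact ⟨Λ, h1, h2, _, _, h.comp hf⟩

/-- At most two non-trivial cyclic factors, acting on blocks of coordinates by roots of unity. -/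
theorem hasDiagonalAction_of_isCyclotomicType (h : IsCyclotomicType β N e) {m : Fin 3 → ℕ}
    {σ : Fin 3 → Bool} (hm0 : ∀ k, m k ≠ 0)
    (hβ : β 0 = 0 ∧ (∀ s, β s = 3 ↔ s = 3) ∧ N 3 = 4 ∧ e 3 = 1)
    (hσ : ∀ k, IsSignedOrder (σ k) (N k.castSucc) (m k))
    (hne : ∀ k, m k = 1 ∨ ∃ s, β s = k.castSucc) (hm : m 2 = 1) :
    HasDiagonalAction 4 (∀ k, Multiplicative (ZMod (m k))) := by
  have : ∀ k, NeZero (m k) := fun k => ⟨hm0 k⟩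
  obtain ⟨hβ0, hβ3, hN3, he3⟩ := hβ
  obtain ⟨h1, h2⟩ := h.isZLattice
  refine ⟨_, h1, h2, exists_isDiagonalAction_of_blocks (V := fun k => signedX (σ k)) (r := 1)
    (p := 0) hβ0 hβ3 (rootAt_three ((hβ3 3).2 rfl) hN3 he3) ?_ hne (one_dvd _) ?_ ?_ ?_⟩
  · intro s k hs
    have hk := hσ k
    rw [← hs] at hk
    exact hk.isPrimitiveRoot (h.1 s) (isPrimitiveRoot_rootAt h.1 h.2.1 s)
  · simp
  · simp
  · intro a ha c hc hd
    have hc0 : c = 0 := by omega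
    subst hc0
    refine ⟨Nat.eq_zero_of_dvd_of_lt (a := m 0) ?_ ha, Or.inl rfl⟩
    simpa using hd

/-- The cyclotomic polynomial divides `(1 - X) * P - c`; evaluate at 1. With the next lemma, `(1 -
z)⁻¹` has exact order `Φ_N(1)` modulo `ℤ[z]`. -/
theorem eval_one_cyclotomic_dvd_of_aeval {z : ℂ} {N : ℕ} (hz : IsPrimitiveRoot z N) (hN : 0 < N)
    {P : ℤ[X]} {c : ℤ} (h : (1 - z) * aeval z P = c) : (cyclotomic N ℤ).eval 1 ∣ c := by
  have h0 : aeval z ((1 - X) * P - C c) = 0 := by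
    rw [map_sub, map_mul, map_sub, map_one, aeval_X, h]
    simp
  have h1 := minpoly.isIntegrallyClosed_dvd (hz.isIntegral hN) h0
  rw [← cyclotomic_eq_minpoly hz hN] at h1
  have h2 := eval_dvd (x := 1) h1
  simpa using h2

theorem exists_aeval_eq_eval_one_cyclotomic {z : ℂ} {N : ℕ} (hz : IsPrimitiveRoot z N)
    (hN : 0 < N) : ∃ Q : ℤ[X], (1 - z) * aeval z Q = (cyclotomic N ℤ).eval 1 := by
  obtain ⟨Q, hQ⟩ := X_sub_C_dvd_sub_C_eval (a := (1 : ℤ)) (p := cyclotomic N ℤ)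
  refine ⟨Q, ?_⟩
  have h := congrArg (aeval z) hQ
  rw [map_sub, map_mul, cyclotomic_eq_minpoly hz hN, minpoly.aeval,
    ← cyclotomic_eq_minpoly hz hN] at h
  simp only [map_sub, aeval_X, map_one, aeval_C] at h
  rw [← neg_sub z 1, neg_mul, ← h]
  simp

/-- Three cyclic factors, each acting on its own elliptic curve. -/
theorem hasDiagonalAction_of_elliptic {m : Fin 3 → ℕ} {σ : Fin 3 → Bool} {r : ℕ}
    (h : IsCyclotomicType id N (fun _ => 1)) (hm0 : ∀ k, m k ≠ 0) (hN3 : N 3 = 4)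
    (hσ : ∀ k, IsSignedOrder (σ k) (N k.castSucc) (m k)) (hσ0 : σ 0 = false) (hr : r ∣ m 2)
    {t : ℕ} (ht : (cyclotomic (N 0) ℤ).eval 1 = t) (htm : t ∣ m 2)
    (hfree : ∀ a < m 0, ∀ c < m 2, m 0 * r ∣ a * r + c * m 0 → a = 0 ∧ (c = 0 ∨ ¬ t ∣ c)) :
    HasDiagonalAction 4 (∀ k, Multiplicative (ZMod (m k))) := by
  have : ∀ k, NeZero (m k) := fun k => ⟨hm0 k⟩
  obtain ⟨h1, h2⟩ := h.isZLattice
  have hprim := isPrimitiveRoot_rootAt h.1 h.2.1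
  set z := rootAt id N (fun _ => 1) 0 with hz_def
  have hz : IsPrimitiveRoot z (N 0) := hprim 0
  have hN0 : 0 < N 0 := h.1 0
  have hz1 : 1 - z ≠ 0 := by
    intro h0
    have h1 : z = 1 := (sub_eq_zero.1 h0).symm
    rw [h1] at hz
    have h2 : N 0 = 1 := (IsPrimitiveRoot.one.unique hz).symm
    have h3 := h.2.2.2.2.2 0
    rw [h2] at h3
    simp at h3
  have hsingle : ∀ w, (∃ Q : ℤ[X], aeval z Q = w) →
      (Pi.single 0 w : Fin 4 → ℂ) ∈ cyclotomicLattice id (rootAt id N fun _ => 1) := by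
    rintro w ⟨Q, hQ⟩
    refine mem_cyclotomicLattice.2 ⟨Pi.single 0 Q, fun s => ?_⟩
    by_cases hs : s = 0
    · subst hs
      rw [id, Pi.single_eq_same, Pi.single_eq_same, ← hz_def, hQ]
    · rw [id, Pi.single_eq_of_ne hs, Pi.single_eq_of_ne hs, map_zero]
  -- `(1 - z)⁻¹` is fixed by `z` modulo `ℤ[z]`, because `(z - 1) * (1 - z)⁻¹ = -1`.
  refine ⟨_, h1, h2, exists_isDiagonalAction_of_blocks (V := fun k => signedX (σ k)) (r := r)
    (p := (1 - z)⁻¹) rfl (fun s => Iff.rfl) (rootAt_three rfl hN3 rfl) ?_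
    (fun k => Or.inr ⟨_, rfl⟩) hr ?_ ?_ ?_⟩
  · rintro s k rfl
    exact (hσ k).isPrimitiveRoot (h.1 _) (hprim _)
  · obtain ⟨Q, hQ⟩ := exists_aeval_eq_eval_one_cyclotomic hz hN0
    obtain ⟨c, hc⟩ := htm
    refine hsingle _ ⟨C (c : ℤ) * Q, ?_⟩
    rw [ht] at hQ
    rw [eq_mul_inv_iff_mul_eq₀ hz1, hc, map_mul, Nat.cast_mul, mul_assoc, mul_comm _ (1 - z), hQ]
    simp [mul_comm]
  · refine hsingle _ ⟨-1, ?_⟩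
    rw [hσ0, eq_mul_inv_iff_mul_eq₀ hz1, ← hz_def]
    simp [signedX]
  · intro a ha c hc hd
    obtain ⟨h0, hc0⟩ := hfree a ha c hc hd
    refine ⟨h0, hc0.imp id fun hc0 P hP => hc0 ?_⟩
    rw [← hz_def, eq_mul_inv_iff_mul_eq₀ hz1, mul_comm] at hP
    have := eval_one_cyclotomic_dvd_of_aeval hz hN0 (c := c) (by exact_mod_cast hP)
    rw [ht] at this
    exact_mod_cast this

/-- Torsion counts absorb the regrouping of factors, such as `C₂ × C₃₀` and `C₁₀ × C₆`. -/
theorem hasDiagonalAction_cyclicProduct {m : Fin 3 → ℕ} {L : List ℕ}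
    (h : HasDiagonalAction 4 (∀ k, Multiplicative (ZMod (m k))))
    (hm : ∀ l ∈ [m 0, m 1, m 2], l ∣ 2520) (hL : ∀ l ∈ L, l ∣ 2520)
    (ht : ∀ n ∈ testPowers, torsionCount n L = torsionCount n [m 0, m 1, m 2]) :
    HasDiagonalAction 4 (CyclicProduct L) := by
  obtain ⟨f⟩ := nonempty_mulEquiv_of_torsionCount hL hm ht
  let ι : CyclicProduct [m 0, m 1, m 2] →* (∀ k, Multiplicative (ZMod (m k))) :=
    { toFun := fun g k => match k with
        | 0 => g 0
        | 1 => g 1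
        | 2 => g 2
      map_one' := by ext k; fin_cases k <;> rfl
      map_mul' := fun g h => by ext k; fin_cases k <;> rfl }
  have hι : Function.Injective ι := by
    intro g h hgh
    ext k
    fin_cases k
    exacts [congrFun hgh 0, congrFun hgh 1, congrFun hgh 2]
  exact h.of_injective (f := ι.comp f.toMonoidHom) (hι.comp f.injective)

theorem hasDiagonalAction_of_mem_maximalTable :
    ∀ L ∈ maximalTable, HasDiagonalAction 4 (CyclicProduct L) := by
  have e4 : (cyclotomic 4 ℤ).eval 1 = (2 : ℕ) := by
    have : Fact (Nat.Prime 2) := ⟨Nat.prime_two⟩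
    exact eval_one_cyclotomic_prime_pow (R := ℤ) (p := 2) 1
  have e3 : (cyclotomic 3 ℤ).eval 1 = (3 : ℕ) := by
    have : Fact (Nat.Prime 3) := ⟨Nat.prime_three⟩
    exact eval_one_cyclotomic_prime (R := ℤ) (p := 3)
  simp only [maximalTable, List.forall_mem_cons, List.not_mem_nil, false_implies, implies_true,
    and_true]
  refine ⟨?_, ?_, ?_, ?_, ?_, ?_, ?_, ?_, ?_⟩
  -- `N = 0` marks an empty block, consistent with `φ(0) = 0`. The exponents `e` choose one root
  -- from each complex conjugate pair, and `σ` replaces `ζ` by `-ζ` to double an odd order.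
  · exact hasDiagonalAction_cyclicProduct (hasDiagonalAction_of_isCyclotomicType
      (β := ![0, 0, 0, 3]) (N := ![7, 0, 0, 4]) (e := ![1, 2, 3, 1]) (m := ![14, 1, 1])
      (σ := ![true, true, true]) (by decide) (by decide) (by decide) (by decide) (by decide) rfl)
      (by decide) (by decide) (by decide)
  · exact hasDiagonalAction_cyclicProduct (hasDiagonalAction_of_isCyclotomicType
      (β := ![0, 0, 0, 3]) (N := ![9, 0, 0, 4]) (e := ![1, 2, 4, 1]) (m := ![18, 1, 1])
      (σ := ![true, true, true]) (by decide) (by decide) (by decide) (by decide) (by decide) rfl)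
      (by decide) (by decide) (by decide)
  · exact hasDiagonalAction_cyclicProduct (hasDiagonalAction_of_isCyclotomicType
      (β := ![0, 0, 1, 3]) (N := ![8, 4, 0, 4]) (e := ![1, 3, 1, 1]) (m := ![8, 4, 1])
      (σ := ![false, false, true]) (by decide) (by decide) (by decide) (by decide) (by decide) rfl)
      (by decide) (by decide) (by decide)
  · exact hasDiagonalAction_cyclicProduct (hasDiagonalAction_of_isCyclotomicType
      (β := ![0, 0, 1, 3]) (N := ![5, 4, 0, 4]) (e := ![1, 2, 1, 1]) (m := ![10, 4, 1])
      (σ := ![true, false, true]) (by decide) (by decide) (by decide) (by decide) (by decide) rfl)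
      (by decide) (by decide) (by decide)
  · exact hasDiagonalAction_cyclicProduct (hasDiagonalAction_of_isCyclotomicType
      (β := ![0, 0, 1, 3]) (N := ![8, 3, 0, 4]) (e := ![1, 3, 1, 1]) (m := ![8, 6, 1])
      (σ := ![false, true, true]) (by decide) (by decide) (by decide) (by decide) (by decide) rfl)
      (by decide) (by decide) (by decide)
  · exact hasDiagonalAction_cyclicProduct (hasDiagonalAction_of_isCyclotomicType
      (β := ![0, 0, 1, 3]) (N := ![5, 3, 0, 4]) (e := ![1, 2, 1, 1]) (m := ![10, 6, 1])
      (σ := ![true, true, true]) (by decide) (by decide) (by decide) (by decide) (by decide) rfl)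
      (by decide) (by decide) (by decide)
  -- In the three elliptic examples the third factor has order `6 = r * t`: the last curve detects
  -- its exponent modulo `r`, the first curve modulo `t`.
  · exact hasDiagonalAction_cyclicProduct (hasDiagonalAction_of_elliptic
      (N := ![4, 4, 3, 4]) (m := ![4, 4, 6]) (σ := ![false, false, true]) (r := 3) (t := 2)
      (by decide) (by decide) rfl (by decide) rfl (by decide) e4 (by decide) (by decide))
      (by decide) (by decide) (by decide)
  · exact hasDiagonalAction_cyclicProduct (hasDiagonalAction_of_elliptic
      (N := ![3, 3, 3, 4]) (m := ![3, 6, 6]) (σ := ![false, true, true]) (r := 2) (t := 3)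
      (by decide) (by decide) rfl (by decide) rfl (by decide) e3 (by decide) (by decide))
      (by decide) (by decide) (by decide)
  · exact hasDiagonalAction_cyclicProduct (hasDiagonalAction_of_elliptic
      (N := ![4, 3, 3, 4]) (m := ![4, 6, 6]) (σ := ![false, true, true]) (r := 3) (t := 2)
      (by decide) (by decide) rfl (by decide) rfl (by decide) e4 (by decide) (by decide))
      (by decide) (by decide) (by decide)

theorem exists_ne_one_of_mem_abelianTable : ∀ d ∈ abelianTable, ∃ l ∈ d, l ≠ 1 := by
  decide +kernel

theorem isHyperelliptic_of_mulEquiv {G : Type*} [CommGroup G] {d : List ℕ}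
    (hd : d ∈ abelianTable) (f : G ≃* CyclicProduct d) : IsHyperelliptic 4 G := by
  obtain ⟨m, hm, j, hj⟩ := exists_embedding_maximalTable d hd
  obtain ⟨Λ, _, _, χ, b, h⟩ := (hasDiagonalAction_of_mem_maximalTable m hm).of_injective
    (f := j.comp f.toMonoidHom) (hj.comp f.injective)
  have : Finite (CyclicProduct d) :=
    finite_cyclicProduct (ne_zero_of_forall_dvd (dvd_of_mem_abelianTable d hd))
  have : Finite G := Finite.of_equiv _ f.symm.toEquiv
  have : Nontrivial (CyclicProduct d) := by
    obtain ⟨l, hl, hl1⟩ := exists_ne_one_of_mem_abelianTable d hd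
    obtain ⟨i, rfl⟩ := List.get_of_mem hl
    have : Nontrivial (Multiplicative (ZMod (d.get i))) := ZMod.nontrivial_iff.2 hl1
    exact Pi.nontrivial_at i
  have : Nontrivial G := f.toEquiv.nontrivial
  exact h.isHyperelliptic

end Examples
end Hyperelliptic

/-- The abelian groups that are hyperelliptic in dimension `4` are, up to isomorphism, exactly the
`44` pairwise non-isomorphic groups of the table; the nine groups of the second list are
among them, each group of the table embeds in one of these nine, and none of the nine embeds in
any other group of the table. -/
theorem mainTheorem3 :
    (∀ (G : Type*) [CommGroup G],
      Hyperelliptic.IsHyperelliptic 4 G ↔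
        ∃ d ∈ Hyperelliptic.abelianTable, Nonempty (G ≃* Hyperelliptic.CyclicProduct d)) ∧
    (Hyperelliptic.abelianTable.length = 44 ∧
      Hyperelliptic.abelianTable.Pairwise (fun d e =>
        ¬ Nonempty (Hyperelliptic.CyclicProduct d ≃* Hyperelliptic.CyclicProduct e))) ∧
    (Hyperelliptic.maximalTable.length = 9 ∧
      (∀ m ∈ Hyperelliptic.maximalTable, m ∈ Hyperelliptic.abelianTable) ∧
      (∀ d ∈ Hyperelliptic.abelianTable, ∃ m ∈ Hyperelliptic.maximalTable,
        ∃ f : Hyperelliptic.CyclicProduct d →* Hyperelliptic.CyclicProduct m,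
          Function.Injective f) ∧
      (∀ m ∈ Hyperelliptic.maximalTable, ∀ d ∈ Hyperelliptic.abelianTable,
        (∃ f : Hyperelliptic.CyclicProduct m →* Hyperelliptic.CyclicProduct d,
          Function.Injective f) → d = m)) :=
  ⟨fun _ _ => ⟨fun h => h.exists_mulEquiv,
      fun ⟨_, hd, ⟨f⟩⟩ => Hyperelliptic.isHyperelliptic_of_mulEquiv hd f⟩,
    ⟨rfl, Hyperelliptic.pairwise_abelianTable⟩, rfl, Hyperelliptic.maximalTable_subset,
    Hyperelliptic.exists_embedding_maximalTable,
    Hyperelliptic.eq_of_injective_of_mem_maximalTable⟩
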